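/- Let $n\ge 2$, $s\in(0,1)$, $\epsilon>0$. Let $\beta:\mathbb R\to[0,\infty)$ be Lipschitz with $\operatorname{supp}\beta=[0,1]$, $\beta>0$ on $(0,1)$, $\int_0^1\beta=M$, and $|\beta|,|\beta'|\le A$ (the latter a.e.). Put $\beta_\epsilon(t)=\frac1\epsilon\beta(t/\epsilon)$ and $\mathcal B_\epsilon(t)=\int_0^t\beta_\epsilon$. Write $x=(x',x_n)\in\mathbb R^{n-1}\times\mathbb R$, $B_r(x_0)=\{|x-x_0|<r\}$, $B'_r(x_0)=B_r(x_0)\cap\{x_n=0\}$, and omit the centre when it is $0$. Let $u_\epsilon\in W^{1,2}_{\rm loc}(B_1,|x_n|^{1-2s})$ be even in $x_n$, with $\|u_\epsilon\|_{L^\infty(B_1)}\le L$, and a weak solution of $$(P_\epsilon)\qquad \operatorname{div}(|x_n|^{1-2s}\nabla u_\epsilon)=0 \text{ in } B_1\cap\{x_n>0\},\qquad -\lim_{x_n\to0+}x_n^{1-2s}\frac{\partial u_\epsilon}{\partial x_n}=-\beta_\epsilon(u_\epsilon)\text{ on }B_1',$$ that is, for all $\phi\in C_c^\infty(B_1)$,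 $$\int_{B_1}|x_n|^{1-2s}\nabla u_\epsilon\cdot\nabla\phi\,dx+\int_{B_1'}2\beta_\epsilon(u_\epsilon)\phi\,dx'=0 .$$ Let $x_0\in B_1'$ and, for $0<r<1-|x_0|$, let $$\Psi_\epsilon^{x_0}(u_\epsilon,r)=\frac1{r^{n-1}}\int_{B_r(x_0)}|x_n|^{1-2s}|\nabla u_\epsilon|^2-\frac{s}{r^n}\int_{\partial B_r(x_0)}|x_n|^{1-2s}u_\epsilon^2+\frac1{r^{n-1}}\int_{B_r'(x_0)}4\mathcal B_\epsilon(u_\epsilon),$$ where the values of $u_\epsilon$ on $\partial B_r(x_0)$ and on $B'_1$ are understood as traces. Then for each such $r$ the trace of $u_\epsilon$ on $\partial B_r(x_0)$ exists and the three integrals are finite, and $r\mapsto\Psi_\epsilon^{x_0}(u_\epsilon,r)$ is nondecreasing on $(0,1-|x_0|)$. -/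

import Mathlib

open MeasureTheory Metric Set
open scoped NNReal ContDiff

noncomputable section

namespace ThinReaction

/-- Euclidean space `ℝⁿ` with `n = d + 1`; the coordinate `x (Fin.last d)` is `xₙ`. -/
abbrev Space (d : ℕ) := EuclideanSpace ℝ (Fin (d + 1))

/-- The weight `|xₙ|^(1-2s)`. -/
def weight {d : ℕ} (s : ℝ) (x : Space d) : ℝ := |x (Fin.last d)| ^ (1 - 2 * s)

/-- The reflection `(x', xₙ) ↦ (x', -xₙ)`. -/
def reflect {d : ℕ} (x : Space d) : Space d :=
  WithLp.toLp 2 (Function.update (fun i => x i) (Fin.last d) (-x (Fin.last d)))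

/-- The embedding `x' ↦ (x', 0)` of `ℝⁿ⁻¹` into `ℝⁿ`. -/
def thinEmbed {d : ℕ} (y : EuclideanSpace ℝ (Fin d)) : Space d :=
  WithLp.toLp 2 (Fin.snoc (α := fun _ => ℝ) (fun i => y i) 0)

theorem continuous_thinEmbed {d : ℕ} : Continuous (thinEmbed (d := d)) := by
  refine (PiLp.continuous_toLp 2 _).comp (continuous_pi fun i => ?_)
  refine Fin.lastCases ?_ (fun j => ?_) i
  · simpa using continuous_const
  · simpa using (by fun_prop : Continuous fun y : EuclideanSpace ℝ (Fin d) => y j)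

/-- The measure `dx'`: Lebesgue measure of `ℝⁿ⁻¹`, carried by `{xₙ = 0} ⊆ ℝⁿ`. An integral over the
thin ball `B'_r(x₀)` is an integral over `B_r(x₀)` with respect to this measure. -/
def thinMeasure (d : ℕ) : Measure (Space d) := Measure.map thinEmbed volume

/-- The surface measure of the sphere `∂B_r(x₀)`, as a measure on `ℝⁿ` (used for `r > 0`):
`r^(n-1)` times the image of the surface measure of the unit sphere under `θ ↦ x₀ + r θ`. -/
def sphereMeasure {d : ℕ} (x₀ : Space d) (r : ℝ) : Measure (Space d) :=
  ENNReal.ofReal (r ^ d) •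
    Measure.map (fun θ : sphere (0 : Space d) 1 => x₀ + r • (θ : Space d))
      (volume : Measure (Space d)).toSphere

/-- Test functions: `φ ∈ C_c^∞(U)`. -/
structure IsTest {d : ℕ} (U : Set (Space d)) (φ : Space d → ℝ) : Prop where
  smooth : ContDiff ℝ ∞ φ
  compact : HasCompactSupport φ
  support : tsupport φ ⊆ U

/-- `G` is the weak gradient of `u` in the open set `U`. -/
structure IsWeakGradient {d : ℕ} (U : Set (Space d)) (u : Space d → ℝ) (G : Space d → Space d) :
    Prop where
  locInt : LocallyIntegrableOn u U
  locInt_grad : LocallyIntegrableOn G U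
  eq : ∀ φ : Space d → ℝ, IsTest U φ → ∀ e : Space d,
    ∫ x in U, u x * fderiv ℝ φ x e = -∫ x in U, inner ℝ (G x) e * φ x

/-- `u ∈ W^{1,2}_loc(U, |xₙ|^(1-2s))`, with weak gradient `G`. -/
structure MemWeightedSobolevLoc {d : ℕ} (s : ℝ) (U : Set (Space d))
    (u : Space d → ℝ) (G : Space d → Space d) : Prop where
  weakGradient : IsWeakGradient U u G
  sq : LocallyIntegrableOn (fun x => weight s x * u x ^ 2) U
  sq_grad : LocallyIntegrableOn (fun x => weight s x * ‖G x‖ ^ 2) U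

/-- `τ` is the trace on the thin unit ball `B'_1` of the function `u` with weak gradient `G`, in the
sense of the Gauss-Green formula in the upper half ball `B_1⁺` (outer normal `-eₙ` on `B'_1`). -/
structure IsThinTrace {d : ℕ} (u : Space d → ℝ) (G : Space d → Space d) (τ : Space d → ℝ) :
    Prop where
  locInt : LocallyIntegrableOn τ (ball 0 1) (thinMeasure d)
  eq : ∀ φ : Space d → ℝ, IsTest (ball 0 1) φ →
    ∫ x in ball 0 1 ∩ {x | 0 < x (Fin.last d)},
        (u x * fderiv ℝ φ x (EuclideanSpace.single (Fin.last d) 1) + G x (Fin.last d) * φ x)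
      = -∫ x in ball 0 1, τ x * φ x ∂thinMeasure d

/-- `T` is the trace on the sphere `∂B_r(x₀)` of the function `u` with weak gradient `G`, in the
sense of the Gauss-Green formula in `B_r(x₀)` (outer normal `(x - x₀) / r`). -/
structure IsSphereTrace {d : ℕ} (u : Space d → ℝ) (G : Space d → Space d) (x₀ : Space d) (r : ℝ)
    (T : Space d → ℝ) : Prop where
  int : Integrable T (sphereMeasure x₀ r)
  eq : ∀ φ : Space d → ℝ, IsTest univ φ → ∀ e : Space d,
    ∫ x in ball x₀ r, (u x * fderiv ℝ φ x e + inner ℝ (G x) e * φ x)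
      = ∫ x, T x * φ x * inner ℝ (r⁻¹ • (x - x₀)) e ∂sphereMeasure x₀ r

open Classical in
/-- The trace of `u` on `∂B_r(x₀)` (it is unique up to null sets of the surface measure). -/
def sphereTrace {d : ℕ} (u : Space d → ℝ) (G : Space d → Space d) (x₀ : Space d) (r : ℝ) :
    Space d → ℝ :=
  if h : ∃ T, IsSphereTrace u G x₀ r T then h.choose else 0

/-- The assumptions on the reaction term `β`: it is in `C_c^{0,1}(ℝ)`, nonnegative, with support
`[0,1]`, positive on `(0,1)`, of integral `M`, and `|β|`, `|β'|` are at most `A`. -/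
structure IsCombustion (β : ℝ → ℝ) (M : ℝ) (A : ℝ≥0) : Prop where
  nonneg : ∀ t, 0 ≤ β t
  tsupport_eq : tsupport β = Icc 0 1
  pos : ∀ t ∈ Ioo (0 : ℝ) 1, 0 < β t
  integral_eq : ∫ t in (0 : ℝ)..1, β t = M
  bound : ∀ t, |β t| ≤ A
  lipschitz : LipschitzWith A β

/-- `β_ε(t) = (1/ε) β(t/ε)`. -/
def betaEps (β : ℝ → ℝ) (ε t : ℝ) : ℝ := (1 / ε) * β (t / ε)

/-- The primitive `𝓑_ε(t) = ∫_0^t β_ε`. -/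
def primEps (β : ℝ → ℝ) (ε t : ℝ) : ℝ := ∫ σ in (0 : ℝ)..t, betaEps β ε σ

/-- `u`, with weak gradient `G` in `B_1` and trace `τ` on `B'_1`, is a weak solution of
`div(|xₙ|^(1-2s) ∇u) = 0` in `B_1⁺`, `lim xₙ^(1-2s) ∂u/∂xₙ = β_ε(u)` on `B'_1`, extended to `B_1` by
even reflection. -/
structure IsWeakSolution {d : ℕ} (s ε : ℝ) (β : ℝ → ℝ)
    (u : Space d → ℝ) (G : Space d → Space d) (τ : Space d → ℝ) : Prop where
  sobolev : MemWeightedSobolevLoc s (ball 0 1) u G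
  even : ∀ᵐ x : Space d, x ∈ ball (0 : Space d) 1 → u (reflect x) = u x
  trace : IsThinTrace u G τ
  eq : ∀ φ : Space d → ℝ, IsTest (ball 0 1) φ →
    (∫ x in ball 0 1, weight s x * fderiv ℝ φ x (G x))
      + ∫ x in ball 0 1, 2 * betaEps β ε (τ x) * φ x ∂thinMeasure d = 0

/-- The Weiss functional `Ψ_ε^{x₀}(u, r)`, where `n = d + 1`. -/
def weiss {d : ℕ} (s ε : ℝ) (β : ℝ → ℝ) (u : Space d → ℝ) (G : Space d → Space d)
    (τ : Space d → ℝ) (x₀ : Space d) (r : ℝ) : ℝ :=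
  1 / r ^ d * (∫ x in ball x₀ r, weight s x * ‖G x‖ ^ 2)
    - s / r ^ (d + 1) * (∫ x, weight s x * sphereTrace u G x₀ r x ^ 2 ∂sphereMeasure x₀ r)
    + 1 / r ^ d * (∫ x in ball x₀ r, 4 * primEps β ε (τ x) ∂thinMeasure d)

end ThinReaction

end

/-! A translation along the thin space reduces to `x₀ = 0`. Write `n = d + 1`, `w = |xₙ|^(1-2s)` and
`N = x · ∇u`. For a nonnegative test function `ψ` on `(0, ρ)` put `η(r) = ∫_r^∞ ψ(t) / t^(d+1) dt`
and `c(x) = ψ(|x|) / |x|^(d+2)`. The theorem follows from the identity `∫ ψ' Ψ = -2 ∫ w c (N - s u)²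
- 4 s ∫_thin η(|x|) u β_ε(u)`. Both terms on the right are nonpositive, the second one because `β_ε`
is nonnegative and vanishes on the negative axis. Hence the continuous function `Ψ` has a
nonnegative distributional derivative and is nondecreasing
(`monotoneOn_of_integral_deriv_mul_nonpos`, `ApproxSolution.monotoneOn_energy`).

The identity is the sum of three others. The layer-cake formula turns the two ball integrals in `∫
ψ' Ψ` into integrals with the radial multiplier `d η + r η'`, and these are evaluated by the domain
variation identity `ApproxSolution.inner_variation`. The equation tested with `η(|x|) u` gives
`ApproxSolution.energy_identity`. Integration by parts along rays,
`ApproxSolution.integral_slice_sq_eq`, treats the sphere term.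

The domain variation identity is the delicate point, since nothing is known about the regularity of
`u` at the thin space. Let `Φ_t(x) = exp(t η(|x|)) x` and `J(v) = ∫ w |∇v|² + 4 ∫_thin 𝓑_ε(v)`. In
the expansion of `J(u ∘ Φ_t)` about `u` the linear term vanishes by the equation, the quadratic
gradient term is nonnegative, and the nonconvexity of `𝓑_ε` costs at most `4K ∫_thin (u ∘ Φ_t -
u)²`, where `K` is a Lipschitz constant of `β_ε`. A trace inequality with a small factor of the
energy absorbs this cost into the gradient term, up to a multiple of `∫ w (u ∘ Φ_t - u)²`, which is
`O(t²)`. So `J(u ∘ Φ_t) - J(u) ≥ -D t²` for small `t` of both signs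
(`ApproxSolution.exists_energy_lower_bound`). A change of variables moves the dependence on `t` to
smooth coefficients, so that `J(u ∘ Φ_t)` has a first-order expansion in `t` with quadratic error;
its linear coefficient must then vanish, and this is the identity.

These computations are made for smooth compactly supported approximations, or pass to the limit
along them. The weight satisfies the A₂ condition, so mollifications of a truncated solution
converge together with their gradients in the weighted `L²` space. Their restrictions to the thin
space and to every sphere about the origin converge in `L²`, on the spheres with a rate that is
uniform away from radius `0`. This gives the continuity of `Ψ`, and the Gauss-Green formula
identifies the limits with the traces of the statement. -/

noncomputable section

/-! ### Coordinates adapted to the thin space, the weight and the weighted measure -/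

namespace ThinReaction
open Filter Topology
open scoped ENNReal

/-- The unit vector in the direction of the last coordinate. -/
def normalVec (d : ℕ) : Space d := EuclideanSpace.single (Fin.last d) 1

theorem norm_normalVec (d : ℕ) : ‖normalVec d‖ = 1 := by simp [normalVec]

@[simp] theorem normalVec_last (d : ℕ) : normalVec d (Fin.last d) = 1 := by simp [normalVec]

@[simp] theorem thinEmbed_last {d : ℕ} (y : EuclideanSpace ℝ (Fin d)) :
    thinEmbed y (Fin.last d) = 0 := by simp [thinEmbed]

@[simp] theorem thinEmbed_castSucc {d : ℕ} (y : EuclideanSpace ℝ (Fin d)) (i : Fin d) :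
    thinEmbed y i.castSucc = y i := by simp [thinEmbed]

theorem norm_thinEmbed {d : ℕ} (y : EuclideanSpace ℝ (Fin d)) : ‖thinEmbed y‖ = ‖y‖ := by
  simp [EuclideanSpace.norm_eq, Fin.sum_univ_castSucc]

theorem thinEmbed_smul {d : ℕ} (c : ℝ) (y : EuclideanSpace ℝ (Fin d)) :
    thinEmbed (c • y) = c • thinEmbed y := by
  ext i; refine Fin.lastCases ?_ (fun j => ?_) i <;> simp

theorem thinEmbed_add {d : ℕ} (y z : EuclideanSpace ℝ (Fin d)) :
    thinEmbed (y + z) = thinEmbed y + thinEmbed z := by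
  ext i; refine Fin.lastCases ?_ (fun j => ?_) i <;> simp

/-- The coordinates `(x', t) ↦ (x', t)`. -/
def sliceMap {d : ℕ} (p : EuclideanSpace ℝ (Fin d) × ℝ) : Space d :=
  thinEmbed p.1 + p.2 • normalVec d

theorem continuous_sliceMap {d : ℕ} : Continuous (sliceMap (d := d)) :=
  (continuous_thinEmbed.comp continuous_fst).add (continuous_snd.smul continuous_const)

@[simp] theorem sliceMap_last {d : ℕ} (p : EuclideanSpace ℝ (Fin d) × ℝ) :
    sliceMap p (Fin.last d) = p.2 := by simp [sliceMap]

theorem measurePreserving_sliceMap (d : ℕ) :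
    MeasurePreserving (sliceMap (d := d)) (volume.prod volume) volume := by
  have h1 : MeasurePreserving (Prod.swap : EuclideanSpace ℝ (Fin d) × ℝ → _)
      (volume.prod volume) (volume.prod volume) := Measure.measurePreserving_swap
  have h2 : MeasurePreserving (Prod.map id WithLp.ofLp :
      ℝ × EuclideanSpace ℝ (Fin d) → ℝ × (Fin d → ℝ))
      (volume.prod volume) (volume.prod volume) :=
    (MeasurePreserving.id _).prod (PiLp.volume_preserving_ofLp (Fin d))
  have h3 := (volume_preserving_piFinSuccAbove (fun _ : Fin (d + 1) => ℝ) (Fin.last d)).symm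
  have h4 := PiLp.volume_preserving_toLp (Fin (d + 1))
  have := h4.comp (h3.comp (h2.comp h1))
  have heq : sliceMap (d := d) = WithLp.toLp 2 ∘
      (MeasurableEquiv.piFinSuccAbove (fun _ : Fin (d + 1) => ℝ) (Fin.last d)).symm ∘
      Prod.map id WithLp.ofLp ∘ Prod.swap := by
    ext p i
    refine Fin.lastCases ?_ (fun j => ?_) i
    · simp [sliceMap, MeasurableEquiv.piFinSuccAbove]
    · simp [sliceMap, MeasurableEquiv.piFinSuccAbove, normalVec]
  rw [heq]
  exact this

theorem lintegral_slice {d : ℕ} {f : Space d → ℝ≥0∞} (hf : Measurable f) :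
    ∫⁻ x, f x = ∫⁻ y, ∫⁻ t, f (sliceMap (y, t)) := by
  rw [← (measurePreserving_sliceMap d).lintegral_comp hf,
    lintegral_prod (fun p => f (sliceMap p)) (hf.comp continuous_sliceMap.measurable).aemeasurable]

theorem measurable_last {d : ℕ} : Measurable (fun x : Space d => x (Fin.last d)) := by fun_prop

theorem measurable_weight {d : ℕ} (s : ℝ) : Measurable (weight s : Space d → ℝ) := by
  unfold weight; fun_prop

theorem weight_nonneg {d : ℕ} (s : ℝ) (x : Space d) : 0 ≤ weight s x :=
  Real.rpow_nonneg (abs_nonneg _) _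

theorem weight_pos {d : ℕ} (s : ℝ) {x : Space d} (hx : x (Fin.last d) ≠ 0) : 0 < weight s x :=
  Real.rpow_pos_of_pos (abs_pos.2 hx) _

theorem weight_smul {d : ℕ} (s : ℝ) {r : ℝ} (hr : 0 ≤ r) (x : Space d) :
    weight s (r • x) = r ^ (1 - 2 * s) * weight s x := by
  simp [weight, abs_mul, abs_of_nonneg hr, Real.mul_rpow hr (abs_nonneg _)]

theorem weight_add_of_last_eq_zero {d : ℕ} (s : ℝ) {z : Space d} (hz : z (Fin.last d) = 0)
    (x : Space d) : weight s (z + x) = weight s x := by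
  simp [weight, hz]

/-- The class of weights is closed under inversion, with `s` replaced by `1 - s`. The inverse
weight, which appears in every use of the Cauchy-Schwarz inequality, is therefore covered by the
results on `wMeasure`. -/
theorem weight_one_sub {d : ℕ} (s : ℝ) (x : Space d) : weight (1 - s) x = (weight s x)⁻¹ := by
  rw [weight, weight, ← Real.rpow_neg (abs_nonneg _)]; congr 1; ring

theorem ae_last_ne_zero (d : ℕ) : ∀ᵐ x : Space d, x (Fin.last d) ≠ 0 := by
  have hm : MeasurableSet {x : Space d | x (Fin.last d) = 0} :=
    measurable_last (measurableSet_singleton (0 : ℝ))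
  rw [ae_iff]
  simp only [ne_eq, not_not]
  rw [← lintegral_indicator_one hm, lintegral_slice (measurable_one.indicator hm)]
  have : ∀ y : EuclideanSpace ℝ (Fin d), ∫⁻ t : ℝ,
      indicator {x : Space d | x (Fin.last d) = 0} (1 : Space d → ℝ≥0∞) (sliceMap (y, t)) = 0 := by
    intro y
    rw [lintegral_congr_ae (g := fun _ => 0), lintegral_zero]
    filter_upwards [Measure.ae_ne volume (0 : ℝ)] with t ht
    simp [indicator, ht]
  simp [this]

theorem lintegral_abs_rpow_lt_top {a : ℝ} (ha : -1 < a) (R : ℝ) :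
    ∫⁻ t in ball (0 : ℝ) R, ENNReal.ofReal (|t| ^ a) < ⊤ := by
  have h : IntegrableOn (fun t : ℝ => ‖t‖ ^ a) (ball (0 : ℝ) R) := by
    rw [integrableOn_fun_norm_addHaar volume (f := fun y : ℝ => y ^ a)]
    rcases lt_or_ge 0 R with hR | hR
    · simpa using (intervalIntegral.integrableOn_Ioo_rpow_iff hR).2 ha
    · simp [Ioo_eq_empty (not_lt.2 hR)]
  exact h.lintegral_lt_top

/-- The measure `|xₙ|^(1-2s) dx`. -/
def wMeasure (d : ℕ) (s : ℝ) : Measure (Space d) :=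
  volume.withDensity fun x => ENNReal.ofReal (weight s x)

theorem lintegral_wMeasure {d : ℕ} (s : ℝ) {f : Space d → ℝ≥0∞} (hf : Measurable f) :
    ∫⁻ x, f x ∂wMeasure d s = ∫⁻ x, ENNReal.ofReal (weight s x) * f x := by
  rw [wMeasure, lintegral_withDensity_eq_lintegral_mul _ (measurable_weight s).ennreal_ofReal hf]
  rfl

theorem norm_fst_le_norm_sliceMap {d : ℕ} (p : EuclideanSpace ℝ (Fin d) × ℝ) :
    ‖p.1‖ ≤ ‖sliceMap p‖ := by
  rw [EuclideanSpace.norm_eq, EuclideanSpace.norm_eq, Fin.sum_univ_castSucc]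
  refine Real.sqrt_le_sqrt ?_
  simp [sliceMap, normalVec, sq_nonneg]

theorem abs_last_le_norm {d : ℕ} (x : Space d) : |x (Fin.last d)| ≤ ‖x‖ :=
  PiLp.norm_apply_le x (Fin.last d)

/-- The ball lies in a cylinder, where the integral factors; the vertical factor is finite because
`1 - 2s > -1`. -/
theorem wMeasure_ball_lt_top {d : ℕ} {s : ℝ} (hs : s < 1) (R : ℝ) :
    wMeasure d s (ball 0 R) < ⊤ := by
  have hm : MeasurableSet (ball (0 : Space d) R) := measurableSet_ball
  rw [wMeasure, withDensity_apply _ hm, ← lintegral_indicator hm,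
    lintegral_slice ((measurable_weight s).ennreal_ofReal.indicator hm)]
  calc _ ≤ ∫⁻ y : EuclideanSpace ℝ (Fin d), (ball 0 R).indicator (fun _ =>
      ∫⁻ t in ball (0 : ℝ) R, ENNReal.ofReal (|t| ^ (1 - 2 * s))) y := by
        refine lintegral_mono fun y => ?_
        by_cases hy : y ∈ ball (0 : EuclideanSpace ℝ (Fin d)) R
        · rw [indicator_of_mem hy, ← lintegral_indicator measurableSet_ball]
          refine lintegral_mono fun t => ?_
          by_cases ht : sliceMap (y, t) ∈ ball (0 : Space d) R
          · have : t ∈ ball (0 : ℝ) R := by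
              have := abs_last_le_norm (sliceMap (y, t))
              simp only [mem_ball_zero_iff, sliceMap_last, Real.norm_eq_abs] at *
              linarith
            simp only [indicator_of_mem ht, indicator_of_mem this]
            simp [weight]
          · simp [ht]
        · rw [indicator_of_notMem hy]
          simp only [nonpos_iff_eq_zero]
          have : ∀ t : ℝ, sliceMap (y, t) ∉ ball (0 : Space d) R := by
            intro t ht
            apply hy
            have := norm_fst_le_norm_sliceMap (y, t)
            simp only [mem_ball_zero_iff] at *
            linarith
          simp [this]
    _ < ⊤ := by
        rw [lintegral_indicator measurableSet_ball, setLIntegral_const]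
        exact ENNReal.mul_lt_top (lintegral_abs_rpow_lt_top (a := 1 - 2 * s) (by linarith) R) measure_ball_lt_top

theorem isFiniteMeasureOnCompacts_wMeasure {d : ℕ} {s : ℝ} (hs : s < 1) :
    IsFiniteMeasureOnCompacts (wMeasure d s) where
  lt_top_of_isCompact K hK := by
    obtain ⟨R, hR⟩ := hK.isBounded.subset_ball 0
    exact (measure_mono hR).trans_lt (wMeasure_ball_lt_top hs R)

theorem volume_absolutelyContinuous_wMeasure (d : ℕ) (s : ℝ) :
    (volume : Measure (Space d)) ≪ wMeasure d s := by
  refine withDensity_absolutelyContinuous' (measurable_weight s).ennreal_ofReal.aemeasurable ?_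
  filter_upwards [ae_last_ne_zero d] with x hx
  simpa using weight_pos s hx

theorem wMeasure_absolutelyContinuous (d : ℕ) (s : ℝ) :
    wMeasure d s ≪ (volume : Measure (Space d)) := withDensity_absolutelyContinuous _ _

theorem integral_wMeasure {d : ℕ} (s : ℝ) (f : Space d → ℝ) (S : Set (Space d))
    (hS : MeasurableSet S) :
    ∫ x in S, f x ∂wMeasure d s = ∫ x in S, weight s x * f x := by
  rw [wMeasure, restrict_withDensity hS,
    integral_withDensity_eq_integral_toReal_smul (measurable_weight s).ennreal_ofReal (by simp)]
  simp [ENNReal.toReal_ofReal, weight_nonneg]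

theorem integrableOn_wMeasure_iff {d : ℕ} (s : ℝ) (f : Space d → ℝ) (S : Set (Space d))
    (hS : MeasurableSet S) :
    IntegrableOn f S (wMeasure d s) ↔ IntegrableOn (fun x => weight s x * f x) S := by
  rw [IntegrableOn, wMeasure, restrict_withDensity hS,
    integrable_withDensity_iff_integrable_smul' (measurable_weight s).ennreal_ofReal (by simp)]
  simp [ENNReal.toReal_ofReal, weight_nonneg, IntegrableOn]

end ThinReaction

/-! ### Symmetries of the weighted measure and the Muckenhoupt A₂ condition -/

namespace ThinReaction
open Filter Topology
open scoped ENNReal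

/-- The weight depends on the last coordinate only. This invariance is what allows a centre on the
thin space to be moved to the origin. -/
theorem measurePreserving_add_wMeasure {d : ℕ} (s : ℝ) {z : Space d} (hz : z (Fin.last d) = 0) :
    MeasurePreserving (fun x => z + x) (wMeasure d s) (wMeasure d s) := by
  refine ⟨measurable_const_add z, ?_⟩
  ext A hA
  have hw : Measurable fun x : Space d => ENNReal.ofReal (weight s x) :=
    (measurable_weight s).ennreal_ofReal
  rw [Measure.map_apply (measurable_const_add z) hA, wMeasure,
    withDensity_apply _ (measurable_const_add z hA), withDensity_apply _ hA,
    ← lintegral_indicator (measurable_const_add z hA), ← lintegral_indicator hA,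
    ← lintegral_add_left_eq_self (A.indicator fun x => ENNReal.ofReal (weight s x)) z]
  refine lintegral_congr fun x => ?_
  by_cases hx : z + x ∈ A
  · rw [indicator_of_mem hx, indicator_of_mem (show x ∈ (fun x => z + x) ⁻¹' A from hx),
      weight_add_of_last_eq_zero s hz]
  · rw [indicator_of_notMem hx, indicator_of_notMem (show x ∉ (fun x => z + x) ⁻¹' A from hx)]

theorem wMeasure_ball_add {d : ℕ} (s : ℝ) {z : Space d} (hz : z (Fin.last d) = 0) (r : ℝ) :
    wMeasure d s (ball z r) = wMeasure d s (ball 0 r) := by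
  rw [← (measurePreserving_add_wMeasure s hz).measure_preimage
    measurableSet_ball.nullMeasurableSet]
  congr 1
  ext x
  simp

theorem wMeasure_ball_eq_rpow_mul {d : ℕ} (s : ℝ) {r : ℝ} (hr : 0 < r) :
    wMeasure d s (ball 0 r) =
      ENNReal.ofReal (r ^ ((d : ℝ) + 1 + (1 - 2 * s))) * wMeasure d s (ball 0 1) := by
  have hw : Measurable fun x : Space d => ENNReal.ofReal (weight s x) :=
    (measurable_weight s).ennreal_ofReal
  have hmap := Measure.map_addHaar_smul (volume : Measure (Space d)) hr.ne'
  have key : ∫⁻ x in ball (0 : Space d) 1, ENNReal.ofReal (weight s (r • x)) =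
      ENNReal.ofReal |(r ^ Module.finrank ℝ (Space d))⁻¹| * wMeasure d s (ball 0 r) := by
    rw [wMeasure, withDensity_apply _ measurableSet_ball, ← lintegral_indicator measurableSet_ball,
      ← lintegral_indicator measurableSet_ball, ← smul_eq_mul, ← lintegral_smul_measure, ← hmap,
      lintegral_map (hw.indicator measurableSet_ball) (measurable_const_smul r)]
    refine lintegral_congr fun x => ?_
    have : r • x ∈ ball (0 : Space d) r ↔ x ∈ ball (0 : Space d) 1 := by
      simp [norm_smul, abs_of_pos hr, hr]
    by_cases hx : x ∈ ball (0 : Space d) 1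
    · rw [indicator_of_mem hx, indicator_of_mem (this.2 hx)]
    · rw [indicator_of_notMem hx, indicator_of_notMem (this.not.2 hx)]
  have key2 : ∫⁻ x in ball (0 : Space d) 1, ENNReal.ofReal (weight s (r • x)) =
      ENNReal.ofReal (r ^ (1 - 2 * s)) * wMeasure d s (ball 0 1) := by
    rw [wMeasure, withDensity_apply _ measurableSet_ball, ← lintegral_const_mul _ hw]
    refine lintegral_congr fun x => ?_
    rw [weight_smul s hr.le, ENNReal.ofReal_mul (Real.rpow_nonneg hr.le _)]
  rw [key2] at key
  have hpos : (0 : ℝ) < r ^ (d + 1) := pow_pos hr _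
  have h3 : ENNReal.ofReal (r ^ (d + 1)) *
      (ENNReal.ofReal |(r ^ Module.finrank ℝ (Space d))⁻¹| * wMeasure d s (ball 0 r)) =
      wMeasure d s (ball 0 r) := by
    rw [← mul_assoc, ← ENNReal.ofReal_mul hpos.le, finrank_euclideanSpace, Fintype.card_fin,
      abs_of_pos (inv_pos.2 hpos), mul_inv_cancel₀ hpos.ne', ENNReal.ofReal_one, one_mul]
  rw [← h3, ← key, ← mul_assoc, ← ENNReal.ofReal_mul hpos.le, ← Real.rpow_natCast,
    ← Real.rpow_add hr]
  push_cast
  rfl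

theorem rpow_le_of_comparable {x m : ℝ} (a : ℝ) (hm : 0 < m) (h1 : m / 2 ≤ x) (h2 : x ≤ 2 * m) :
    x ^ a ≤ 2 ^ |a| * m ^ a := by
  rcases le_total 0 a with ha | ha
  · rw [abs_of_nonneg ha, ← Real.mul_rpow zero_le_two hm.le]
    exact Real.rpow_le_rpow (by linarith) h2 ha
  · have h : (m / 2) ^ a = 2 ^ |a| * m ^ a := by
      rw [abs_of_nonpos ha, Real.div_rpow hm.le zero_le_two, Real.rpow_neg zero_le_two,
        div_eq_inv_mul]
    rw [← h]
    exact Real.rpow_le_rpow_of_nonpos (by linarith) h1 ha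

/-- On a ball that is small compared with its distance to the thin space, the weight stays within a
factor of its value at the centre. -/
theorem wMeasure_ball_le_of_le {d : ℕ} (s : ℝ) {y : Space d} {r : ℝ} (hr : 0 < r)
    (hy : 2 * r ≤ |y (Fin.last d)|) :
    wMeasure d s (ball y r) ≤
      ENNReal.ofReal (2 ^ |1 - 2 * s| * |y (Fin.last d)| ^ (1 - 2 * s)) *
        volume (ball (0 : Space d) r) := by
  rw [wMeasure, withDensity_apply _ measurableSet_ball, ← Measure.addHaar_ball_center volume y,
    ← setLIntegral_const]
  refine setLIntegral_mono measurable_const fun x hx => ENNReal.ofReal_le_ofReal ?_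
  have h := abs_last_le_norm (x - y)
  rw [mem_ball, dist_eq_norm] at hx
  simp only [PiLp.sub_apply] at h
  have h1 := abs_sub_abs_le_abs_sub (x (Fin.last d)) (y (Fin.last d))
  have h2 := abs_sub_abs_le_abs_sub (y (Fin.last d)) (x (Fin.last d))
  rw [abs_sub_comm] at h2
  exact rpow_le_of_comparable _ (by linarith) (by linarith) (by linarith)

/-- This is the A₂ condition. Balls far from the thin space see two almost constant weights with
product one. A ball near it is enclosed in a ball of comparable radius centred on the thin space,
and there the scaling exponents of the two weights add up to twice the dimension. -/
theorem exists_wMeasure_ball_mul_le {d : ℕ} {s : ℝ} (hs : s ∈ Ioo (0 : ℝ) 1) :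
    ∃ C : ℝ≥0∞, C ≠ ⊤ ∧ ∀ (y : Space d) (r : ℝ), 0 < r →
      wMeasure d s (ball y r) * wMeasure d (1 - s) (ball y r) ≤
        C * volume (ball (0 : Space d) r) ^ 2 := by
  have hvol : ∀ r : ℝ, 0 < r → volume (ball (0 : Space d) r) =
      ENNReal.ofReal (r ^ (d + 1)) * volume (ball (0 : Space d) 1) := fun r hr => by
    rw [Measure.addHaar_ball_of_pos _ _ hr]; simp
  set v := volume (ball (0 : Space d) 1) with hv
  have hv0 : v ≠ 0 := (measure_ball_pos _ _ one_pos).ne'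
  have hvt : v ≠ ⊤ := measure_ball_lt_top.ne
  set K1 : ℝ≥0∞ := ENNReal.ofReal (2 ^ |1 - 2 * s| * 2 ^ |1 - 2 * s|)
  set K2 : ℝ≥0∞ := ENNReal.ofReal (3 ^ (2 * (d + 1))) *
    (wMeasure d s (ball 0 1) * wMeasure d (1 - s) (ball 0 1)) * (v ^ 2)⁻¹
  refine ⟨max K1 K2, ?_, fun y r hr => ?_⟩
  · refine (max_lt ENNReal.ofReal_lt_top ?_).ne
    refine ENNReal.mul_lt_top (ENNReal.mul_lt_top ENNReal.ofReal_lt_top (ENNReal.mul_lt_top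
      (wMeasure_ball_lt_top hs.2 1) (wMeasure_ball_lt_top (by linarith [hs.1]) 1))) ?_
    exact ENNReal.inv_lt_top.2 (pos_iff_ne_zero.2 (pow_ne_zero 2 hv0))
  rcases le_or_gt (2 * r) |y (Fin.last d)| with hy | hy
  · have hm : 0 < |y (Fin.last d)| := by linarith
    have h1 := wMeasure_ball_le_of_le s hr hy
    have h2 := wMeasure_ball_le_of_le (1 - s) hr hy
    refine (mul_le_mul' h1 h2).trans ?_
    have e : (1 - 2 * (1 - s)) = -(1 - 2 * s) := by ring
    rw [mul_mul_mul_comm, ← ENNReal.ofReal_mul (by positivity), ← sq, e, abs_neg,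
      mul_mul_mul_comm, ← Real.rpow_add hm, add_neg_cancel, Real.rpow_zero, mul_one]
    gcongr
    exact le_max_left _ _
  -- The new centre is the projection of `y` to the thin space. It is at distance `|yₙ| < 2r` from
  -- `y`, whence the radius `3r`.
  · have hsub : ball y r ⊆ ball (y - y (Fin.last d) • normalVec d) (3 * r) := by
      intro x hx
      rw [mem_ball] at hx ⊢
      have : dist y (y - y (Fin.last d) • normalVec d) = |y (Fin.last d)| := by
        rw [dist_eq_norm]; simp [norm_smul, norm_normalVec]
      linarith [dist_triangle x y (y - y (Fin.last d) • normalVec d)]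
    have hz : (y - y (Fin.last d) • normalVec d) (Fin.last d) = 0 := by simp
    refine (mul_le_mul' (measure_mono hsub) (measure_mono hsub)).trans ?_
    rw [wMeasure_ball_add _ hz, wMeasure_ball_add _ hz, wMeasure_ball_eq_rpow_mul s (by positivity),
      wMeasure_ball_eq_rpow_mul (1 - s) (by positivity), mul_mul_mul_comm,
      ← ENNReal.ofReal_mul (by positivity), ← Real.rpow_add (by positivity), hvol r hr]
    have e : (d : ℝ) + 1 + (1 - 2 * s) + ((d : ℝ) + 1 + (1 - 2 * (1 - s))) =
        ((2 * (d + 1) : ℕ) : ℝ) := by push_cast; ring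
    rw [e, Real.rpow_natCast, mul_pow, ENNReal.ofReal_mul (by positivity)]
    calc _ = K2 * (ENNReal.ofReal (r ^ (d + 1)) * v) ^ 2 := by
          have : (v ^ 2)⁻¹ * v ^ 2 = 1 := ENNReal.inv_mul_cancel (by simp [hv0]) (by simp [hvt])
          rw [mul_pow, ← ENNReal.ofReal_pow (by positivity), ← pow_mul, mul_comm (d + 1) 2]
          calc _ = ENNReal.ofReal (3 ^ (2 * (d + 1))) *
                (wMeasure d s (ball 0 1) * wMeasure d (1 - s) (ball 0 1)) *
                ENNReal.ofReal (r ^ (2 * (d + 1))) * 1 := by ring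
            _ = _ := by rw [← this]; simp only [K2]; ring
      _ ≤ _ := by gcongr; exact le_max_right _ _

/-- Cauchy-Schwarz for the splitting `g = (W g²)^(1/2) V^(1/2)`; it is the source of all passages
from weighted `L²` to `L¹`. -/
theorem sq_lintegral_le_of_mul_eq_one {α : Type*} [MeasurableSpace α] {ν : Measure α}
    {g W V : α → ℝ≥0∞} (hg : AEMeasurable g ν) (hW : AEMeasurable W ν) (hV : AEMeasurable V ν)
    (h : ∀ᵐ x ∂ν, W x * V x = 1) :
    (∫⁻ x, g x ∂ν) ^ 2 ≤ (∫⁻ x, W x * g x ^ 2 ∂ν) * ∫⁻ x, V x ∂ν := by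
  have h1 := ENNReal.lintegral_mul_norm_pow_le (hW.mul (hg.pow_const 2)) hV
    (p := 1 / 2) (q := 1 / 2) (by norm_num) (by norm_num) (by norm_num)
  have h2 : ∫⁻ x, g x ∂ν = ∫⁻ x, (W * fun x => g x ^ 2) x ^ (1 / 2 : ℝ) * V x ^ (1 / 2 : ℝ) ∂ν := by
    refine lintegral_congr_ae ?_
    filter_upwards [h] with x hx
    rw [← ENNReal.mul_rpow_of_nonneg _ _ (by norm_num), Pi.mul_apply,
      mul_right_comm, hx, one_mul, ← ENNReal.rpow_natCast, ← ENNReal.rpow_mul]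
    norm_num
  rw [← h2] at h1
  calc _ ≤ _ := pow_le_pow_left' h1 2
    _ = _ := by
      rw [mul_pow, ← ENNReal.rpow_natCast, ← ENNReal.rpow_mul, ← ENNReal.rpow_natCast,
        ← ENNReal.rpow_mul]
      norm_num

theorem ofReal_weight_mul {d : ℕ} (s : ℝ) {x : Space d} (hx : x (Fin.last d) ≠ 0) :
    ENNReal.ofReal (weight s x) * ENNReal.ofReal (weight (1 - s) x) = 1 := by
  rw [weight_one_sub, ← ENNReal.ofReal_mul (weight_nonneg _ _),
    mul_inv_cancel₀ (weight_pos s hx).ne', ENNReal.ofReal_one]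

end ThinReaction

/-! ### Mollification is bounded on the weighted L² space -/

namespace ThinReaction
open Filter Topology
open scoped ENNReal Convolution

theorem wMeasure_apply {d : ℕ} (s : ℝ) {A : Set (Space d)} (hA : MeasurableSet A) :
    wMeasure d s A = ∫⁻ x in A, ENNReal.ofReal (weight s x) := withDensity_apply _ hA

/-- Weighted `L²` bound for averages over balls of a fixed radius. -/
theorem lintegral_weight_mul_sq_average_le {d : ℕ} {s : ℝ} {C : ℝ≥0∞}
    (hC : ∀ (y : Space d) (r : ℝ), 0 < r →
      wMeasure d s (ball y r) * wMeasure d (1 - s) (ball y r) ≤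
        C * volume (ball (0 : Space d) r) ^ 2)
    {g : Space d → ℝ≥0∞} (hg : Measurable g) {h : ℝ} (hh : 0 < h) :
    ∫⁻ x, (∫⁻ y in ball x h, g y) ^ 2 ∂wMeasure d s ≤
      C * volume (ball (0 : Space d) (2 * h)) ^ 2 * ∫⁻ x, g x ^ 2 ∂wMeasure d s := by
  set W : Space d → ℝ≥0∞ := fun x => ENNReal.ofReal (weight s x) with hWdef
  have hW : Measurable W := (measurable_weight s).ennreal_ofReal
  have hV : Measurable fun x : Space d => ENNReal.ofReal (weight (1 - s) x) :=
    (measurable_weight _).ennreal_ofReal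
  have hset : MeasurableSet {p : Space d × Space d | dist p.2 p.1 < h} :=
    measurableSet_lt (measurable_snd.dist measurable_fst) measurable_const
  set F : Space d → Space d → ℝ≥0∞ := fun x y =>
    {p : Space d × Space d | dist p.2 p.1 < h}.indicator (fun p => W p.2 * g p.2 ^ 2 *
      wMeasure d (1 - s) (ball p.2 (2 * h))) (x, y) with hF
  have hmeasV : Measurable fun y : Space d => wMeasure d (1 - s) (ball y (2 * h)) := by
    have h2 : MeasurableSet {p : Space d × Space d | dist p.2 p.1 < 2 * h} :=
      measurableSet_lt (measurable_snd.dist measurable_fst) measurable_const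
    have : SFinite (wMeasure d (1 - s)) := by unfold wMeasure; infer_instance
    have h3 := measurable_measure_prodMk_left (ν := wMeasure d (1 - s)) h2
    have e : ∀ y : Space d, Prod.mk y ⁻¹' {p : Space d × Space d | dist p.2 p.1 < 2 * h} =
        ball y (2 * h) := fun y => by ext z; simp
    simpa only [e] using h3
  have hFm : Measurable (Function.uncurry F) := by
    refine Measurable.indicator ?_ hset
    exact (((hW.mul (hg.pow_const 2)).mul hmeasV).comp measurable_snd)
  -- Cauchy-Schwarz on `ball x h` produces the mass of the inverse weight on that ball. Replacing it
  -- by the mass on `ball y (2h)`, for `y` in the ball, makes the factor depend on `y` alone, so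
  -- that the order of integration can be exchanged.
  have hpt : ∀ x, (∫⁻ y in ball x h, g y) ^ 2 ≤ ∫⁻ y, F x y := by
    intro x
    have h1 := sq_lintegral_le_of_mul_eq_one (ν := volume.restrict (ball x h)) hg.aemeasurable
      hW.aemeasurable hV.aemeasurable
      (ae_restrict_of_ae ((ae_last_ne_zero d).mono fun y hy => ofReal_weight_mul s hy))
    refine h1.trans ?_
    rw [← wMeasure_apply _ measurableSet_ball,
      ← lintegral_mul_const (f := fun y => W y * g y ^ 2) _ (hW.mul (hg.pow_const 2)), ← lintegral_indicator measurableSet_ball]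
    refine lintegral_mono fun y => ?_
    by_cases hy : y ∈ ball x h
    · rw [indicator_of_mem hy]
      simp only [hF]
      rw [indicator_of_mem (by simpa using hy)]
      gcongr
      intro z hz
      rw [mem_ball] at *
      have := dist_triangle_right z y x
      linarith
    · simp [indicator_of_notMem hy]
  calc _ ≤ ∫⁻ x, ∫⁻ y, F x y ∂volume ∂wMeasure d s := lintegral_mono hpt
    _ = ∫⁻ x, W x * ∫⁻ y, F x y := lintegral_wMeasure s hFm.lintegral_prod_right'
    _ = ∫⁻ x, ∫⁻ y, W x * F x y :=
        lintegral_congr fun x => (lintegral_const_mul _ (hFm.comp measurable_prodMk_left)).symm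
    _ = ∫⁻ y, ∫⁻ x, W x * F x y :=
        lintegral_lintegral_swap ((hW.comp measurable_fst).mul hFm).aemeasurable
    _ ≤ ∫⁻ y, C * volume (ball (0 : Space d) (2 * h)) ^ 2 * (W y * g y ^ 2) := by
        refine lintegral_mono fun y => ?_
        have e : ∀ x, W x * F x y = (ball y h).indicator (fun x => W x * (W y * g y ^ 2 *
            wMeasure d (1 - s) (ball y (2 * h)))) x := by
          intro x
          simp only [hF, indicator, mem_ofPred_eq, mem_ball, dist_comm y x]
          split_ifs <;> simp
        simp_rw [e]
        rw [lintegral_indicator measurableSet_ball, lintegral_mul_const _ hW,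
          ← wMeasure_apply _ measurableSet_ball]
        -- The integration in `x` has produced the mass of `ball y h`. It is enlarged to the radius
        -- `2h` so that the A₂ condition applies to both masses on the same ball.
        calc _ ≤ wMeasure d s (ball y (2 * h)) * (W y * g y ^ 2 *
              wMeasure d (1 - s) (ball y (2 * h))) := by
              refine mul_le_mul_left (measure_mono (ball_subset_ball ?_)) _
              linarith
          _ = wMeasure d s (ball y (2 * h)) * wMeasure d (1 - s) (ball y (2 * h)) *
              (W y * g y ^ 2) := by ring
          _ ≤ _ := mul_le_mul_left (hC y _ (by positivity)) _
    _ = _ := by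
        rw [lintegral_const_mul (f := fun y => W y * g y ^ 2) _ (hW.mul (hg.pow_const 2)), lintegral_wMeasure s (hg.pow_const 2)]

theorem eLpNorm_two_eq {α E : Type*} [MeasurableSpace α] [NormedAddCommGroup E] (f : α → E)
    (μ : Measure α) : eLpNorm f 2 μ = (∫⁻ x, ‖f x‖ₑ ^ 2 ∂μ) ^ (1 / 2 : ℝ) := by
  rw [eLpNorm_eq_lintegral_rpow_enorm_toReal (by norm_num) (by norm_num)]
  simp

variable {F : Type*} [NormedAddCommGroup F] [NormedSpace ℝ F]

/-- The mollification of `f` by a smooth bump function. -/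
def mollify {d : ℕ} (φ : ContDiffBump (0 : Space d)) (f : Space d → F) : Space d → F :=
  φ.normed volume ⋆[ContinuousLinearMap.lsmul ℝ ℝ, volume] f

/-- The normalized bump is supported in the ball of radius `rOut` and is at most the inverse volume
of the ball of radius `rIn`. -/
theorem enorm_mollify_le {d : ℕ} (φ : ContDiffBump (0 : Space d)) (f : Space d → F) (x : Space d) :
    ‖mollify φ f x‖ₑ ≤ (volume (ball (0 : Space d) φ.rIn))⁻¹ * ∫⁻ y in ball x φ.rOut, ‖f y‖ₑ := by
  have hv0 : volume (ball (0 : Space d) φ.rIn) ≠ 0 := (measure_ball_pos _ _ φ.rIn_pos).ne'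
  rw [mollify, convolution_eq_swap]
  refine (enorm_integral_le_lintegral_enorm _).trans ?_
  rw [← lintegral_indicator measurableSet_ball,
    ← lintegral_const_mul' _ _ (ENNReal.inv_ne_top.2 hv0)]
  refine lintegral_mono fun y => ?_
  by_cases hy : y ∈ ball x φ.rOut
  · rw [indicator_of_mem hy, ContinuousLinearMap.lsmul_apply, enorm_smul]
    gcongr
    rw [Real.enorm_eq_ofReal (φ.nonneg_normed _)]
    refine (ENNReal.ofReal_le_ofReal (φ.normed_le_div_measure_closedBall_rIn volume _)).trans ?_
    rw [one_div, Measure.real, ENNReal.ofReal_inv_of_pos (ENNReal.toReal_pos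
      (measure_closedBall_pos _ _ φ.rIn_pos).ne' measure_closedBall_lt_top.ne),
      ENNReal.ofReal_toReal measure_closedBall_lt_top.ne, Measure.addHaar_closedBall_eq_addHaar_ball]
  · have : φ.normed volume (x - y) = 0 := by
      rw [← Function.notMem_support, φ.support_normed_eq]
      simpa [dist_eq_norm, norm_sub_rev] using hy
    simp [this]

/-- The mollification is dominated by averages over balls, which the A₂ condition controls. Fixing
the ratio of the two radii keeps the ratio of volumes, and with it the constant, independent of the
scale. -/
theorem exists_eLpNorm_mollify_le {d : ℕ} {s : ℝ} (hs : s ∈ Ioo (0 : ℝ) 1) :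
    ∃ K : ℝ≥0∞, K ≠ ⊤ ∧ ∀ (φ : ContDiffBump (0 : Space d)), φ.rOut = 2 * φ.rIn →
      ∀ f : Space d → F, StronglyMeasurable f →
        eLpNorm (mollify φ f) 2 (wMeasure d s) ≤ K * eLpNorm f 2 (wMeasure d s) := by
  obtain ⟨C, hCt, hC⟩ := exists_wMeasure_ball_mul_le (d := d) hs
  refine ⟨(C * ENNReal.ofReal (4 ^ (d + 1)) ^ 2) ^ (1 / 2 : ℝ), ?_, fun φ hφ f hf => ?_⟩
  · exact ENNReal.rpow_ne_top_of_nonneg (by norm_num)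
      (ENNReal.mul_ne_top hCt (ENNReal.pow_ne_top ENNReal.ofReal_ne_top))
  rw [eLpNorm_two_eq, eLpNorm_two_eq, ← ENNReal.mul_rpow_of_nonneg _ _ (by norm_num)]
  refine ENNReal.rpow_le_rpow ?_ (by norm_num)
  set v := volume (ball (0 : Space d) φ.rIn) with hv
  have hv0 : v ≠ 0 := (measure_ball_pos _ _ φ.rIn_pos).ne'
  have hvt : v ≠ ⊤ := measure_ball_lt_top.ne
  have hbig : volume (ball (0 : Space d) (2 * φ.rOut)) = ENNReal.ofReal (4 ^ (d + 1)) * v := by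
    rw [hφ, ← mul_assoc, hv, Measure.addHaar_ball_mul_of_pos _ _ (by norm_num)]
    norm_num
  have hm : Measurable fun x => ‖f x‖ₑ := hf.enorm
  calc ∫⁻ x, ‖mollify φ f x‖ₑ ^ 2 ∂wMeasure d s
      ≤ ∫⁻ x, (v⁻¹) ^ 2 * (∫⁻ y in ball x φ.rOut, ‖f y‖ₑ) ^ 2 ∂wMeasure d s := by
        refine lintegral_mono fun x => ?_
        rw [← mul_pow]
        exact pow_le_pow_left' (enorm_mollify_le φ f x) 2
    _ = (v⁻¹) ^ 2 * ∫⁻ x, (∫⁻ y in ball x φ.rOut, ‖f y‖ₑ) ^ 2 ∂wMeasure d s :=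
        lintegral_const_mul' _ _ (ENNReal.pow_ne_top (ENNReal.inv_ne_top.2 hv0))
    _ ≤ (v⁻¹) ^ 2 * (C * (ENNReal.ofReal (4 ^ (d + 1)) * v) ^ 2 *
          ∫⁻ x, ‖f x‖ₑ ^ 2 ∂wMeasure d s) := by
        gcongr
        rw [← hbig]
        exact lintegral_weight_mul_sq_average_le hC hm φ.rOut_pos
    _ = (v⁻¹ * v) ^ 2 * (C * ENNReal.ofReal (4 ^ (d + 1)) ^ 2 *
          ∫⁻ x, ‖f x‖ₑ ^ 2 ∂wMeasure d s) := by ring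
    _ = _ := by rw [ENNReal.inv_mul_cancel hv0 hvt, one_pow, one_mul]

end ThinReaction

/-! ### Convergence of mollifications and of their gradients -/

namespace ThinReaction
open Filter Topology
open scoped ENNReal Convolution

/-- Cauchy-Schwarz against the inverse weight, which is locally integrable because `s > 0`. -/
theorem locallyIntegrable_of_memLp_wMeasure {F : Type*} [NormedAddCommGroup F] {d : ℕ} {s : ℝ} (hs : s ∈ Ioo (0 : ℝ) 1)
    {f : Space d → F} (hf : MemLp f 2 (wMeasure d s)) : LocallyIntegrable f := by
  rw [locallyIntegrable_iff]
  intro K hK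
  obtain ⟨R, hR⟩ := hK.isBounded.subset_ball 0
  have hsm : AEStronglyMeasurable f volume :=
    hf.aestronglyMeasurable.mono_ac (volume_absolutelyContinuous_wMeasure d s)
  refine IntegrableOn.mono_set ⟨hsm.restrict, ?_⟩ hR
  have h1 := sq_lintegral_le_of_mul_eq_one (ν := volume.restrict (ball (0 : Space d) R))
      (g := fun x => ‖f x‖ₑ) hsm.enorm.restrict
      (measurable_weight s).ennreal_ofReal.aemeasurable
      (measurable_weight (1 - s)).ennreal_ofReal.aemeasurable
      (ae_restrict_of_ae ((ae_last_ne_zero d).mono fun y hy => ofReal_weight_mul s hy))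
  have h2 : ∫⁻ x in ball (0 : Space d) R, ENNReal.ofReal (weight s x) * ‖f x‖ₑ ^ 2 < ⊤ := by
    refine (setLIntegral_le_lintegral _ _).trans_lt ?_
    have h3 := hf.eLpNorm_lt_top
    rw [eLpNorm_two_eq] at h3
    have h4 : ∫⁻ x, ‖f x‖ₑ ^ 2 ∂wMeasure d s < ⊤ := by
      by_contra h
      rw [not_lt, top_le_iff] at h
      simp [h] at h3
    rw [wMeasure, lintegral_withDensity_eq_lintegral_mul₀
      (measurable_weight s).ennreal_ofReal.aemeasurable (hsm.enorm.pow_const 2)] at h4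
    exact h4
  have h5 : (∫⁻ x in ball (0 : Space d) R, ‖f x‖ₑ) ^ 2 < ⊤ := by
    refine h1.trans_lt (ENNReal.mul_lt_top h2 ?_)
    rw [← wMeasure_apply _ measurableSet_ball]
    exact wMeasure_ball_lt_top (by linarith [hs.1]) R
  rw [HasFiniteIntegral]
  by_contra h
  rw [not_lt, top_le_iff] at h
  simp [h] at h5

variable {F : Type*} [NormedAddCommGroup F] [NormedSpace ℝ F]

theorem convolutionExists_normed {d : ℕ} (φ : ContDiffBump (0 : Space d)) {f : Space d → F}
    (hf : LocallyIntegrable f) :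
    ConvolutionExists (φ.normed volume) f (ContinuousLinearMap.lsmul ℝ ℝ) volume :=
  φ.hasCompactSupport_normed.convolutionExists_left _ φ.continuous_normed hf

theorem mollify_sub {d : ℕ} (φ : ContDiffBump (0 : Space d)) {f g : Space d → F}
    (hf : LocallyIntegrable f) (hg : LocallyIntegrable g) :
    mollify φ (f - g) = mollify φ f - mollify φ g := by
  ext x
  simp only [mollify, convolution, Pi.sub_apply]
  rw [← integral_sub]
  · simp [smul_sub]
  · exact convolutionExists_normed φ hf x
  · exact convolutionExists_normed φ hg x

theorem tendsto_mollify_of_continuous {d : ℕ} [CompleteSpace F] {s : ℝ} (hs : s ∈ Ioo (0 : ℝ) 1)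
    {φ : ℕ → ContDiffBump (0 : Space d)} (hφ : Tendsto (fun k => (φ k).rOut) atTop (𝓝 0))
    {g : Space d → F} (hg : Continuous g) (hgc : HasCompactSupport g) :
    Tendsto (fun k => eLpNorm (mollify (φ k) g - g) 2 (wMeasure d s)) atTop (𝓝 0) := by
  obtain ⟨R, hR⟩ := hgc.isCompact.isBounded.subset_ball 0
  set B := ball (0 : Space d) (R + 1) with hB
  set c := wMeasure d s B ^ (2⁻¹ : ℝ) with hc
  have hct : c ≠ ⊤ := ENNReal.rpow_ne_top_of_nonneg (by norm_num) (wMeasure_ball_lt_top hs.2 _).ne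
  have key : ∀ ε : ℝ, 0 < ε → ∀ᶠ k in atTop,
      eLpNorm (mollify (φ k) g - g) 2 (wMeasure d s) ≤ c * ENNReal.ofReal ε := by
    intro ε hε
    obtain ⟨δ, hδ, hδg⟩ := Metric.uniformContinuous_iff.1
      (hgc.uniformContinuous_of_continuous hg) ε hε
    filter_upwards [hφ.eventually (gt_mem_nhds (lt_min hδ one_pos))] with k hk
    have hpt : ∀ x, dist (mollify (φ k) g x) (g x) ≤ ε := fun x =>
      dist_convolution_le hε.le ((φ k).support_normed_eq (μ := volume)).subset
        (φ k).nonneg_normed (φ k).integral_normed hg.aestronglyMeasurable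
        (fun y hy => (hδg ((mem_ball.1 hy).trans (hk.trans_le (min_le_left _ _)))).le)
    have hsupp : Function.support (mollify (φ k) g - g) ⊆ B := by
      intro x hx
      by_contra hxB
      have hxR : R + 1 ≤ ‖x‖ := by simpa [hB] using hxB
      have hz : ∀ y ∈ ball x 1, g y = 0 := by
        intro y hy
        by_contra hgy
        have h1 := hR (subset_tsupport g hgy)
        rw [mem_ball_zero_iff] at h1
        rw [mem_ball, dist_comm, dist_eq_norm] at hy
        linarith [norm_sub_norm_le x y]
      apply hx
      -- Once the mollification radius is below one, the mollification at a point outside `B` only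
      -- sees points where `g` vanishes.
      have h2 : dist (mollify (φ k) g x) 0 ≤ 0 :=
        dist_convolution_le le_rfl ((φ k).support_normed_eq (μ := volume)).subset
          (φ k).nonneg_normed (φ k).integral_normed hg.aestronglyMeasurable
          (fun y hy => by
            rw [hz y (ball_subset_ball (hk.trans_le (min_le_right _ _)).le hy), dist_self])
      rw [dist_le_zero] at h2
      simp [h2, hz x (mem_ball_self one_pos)]
    rw [← eLpNorm_restrict_eq_of_support_subset hsupp]
    refine (eLpNorm_le_of_ae_bound (C := ε) (ae_of_all _ fun x => ?_)).trans ?_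
    · simpa [dist_eq_norm] using hpt x
    · simp [hc]
  rw [ENNReal.tendsto_nhds_zero]
  intro ε hε
  rcases eq_or_ne ε ⊤ with rfl | hεt
  · simp
  have hpos : 0 < (ε / (c + 1)).toReal := by
    refine ENNReal.toReal_pos (ENNReal.div_pos hε.ne' (by simp [hct])).ne' ?_
    exact ENNReal.div_ne_top hεt (by simp)
  filter_upwards [key _ hpos] with k hk
  refine hk.trans ?_
  rw [ENNReal.ofReal_toReal (ENNReal.div_ne_top hεt (by simp))]
  calc c * (ε / (c + 1)) ≤ (c + 1) * (ε / (c + 1)) := by gcongr; simp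
    _ ≤ ε := ENNReal.mul_div_le

/-- Density of continuous compactly supported functions, combined with the scale-independent bound
on mollification, reduces the claim to uniform convergence on a set of finite measure. -/
theorem tendsto_mollify {d : ℕ} [CompleteSpace F] {s : ℝ} (hs : s ∈ Ioo (0 : ℝ) 1)
    {φ : ℕ → ContDiffBump (0 : Space d)} (hφ : Tendsto (fun k => (φ k).rOut) atTop (𝓝 0))
    (hφ2 : ∀ k, (φ k).rOut = 2 * (φ k).rIn)
    {f : Space d → F} (hf : StronglyMeasurable f) (hf2 : MemLp f 2 (wMeasure d s)) :
    Tendsto (fun k => eLpNorm (mollify (φ k) f - f) 2 (wMeasure d s)) atTop (𝓝 0) := by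
  obtain ⟨K, hK, hKb⟩ := exists_eLpNorm_mollify_le (d := d) (F := F) hs
  have := isFiniteMeasureOnCompacts_wMeasure (d := d) hs.2
  rw [ENNReal.tendsto_nhds_zero]
  intro ε hε
  rcases eq_or_ne ε ⊤ with rfl | hεt
  · simp
  -- Approximating `f` by `g` with error `η` costs `K η` after mollification and `η` before it, in
  -- total at most `ε / 2`.
  set η := ε / 2 / (K + 1) with hη
  have hη0 : η ≠ 0 := (ENNReal.div_pos (ENNReal.half_pos hε.ne').ne' (by simp [hK])).ne'
  obtain ⟨g, hgc, hfg, hg, hg2⟩ :=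
    hf2.exists_hasCompactSupport_eLpNorm_sub_le (by norm_num) hη0
  have hfl := locallyIntegrable_of_memLp_wMeasure hs hf2
  have hgl : LocallyIntegrable g volume := hg.locallyIntegrable
  have hgs : StronglyMeasurable g := hg.stronglyMeasurable_of_hasCompactSupport hgc
  filter_upwards [(ENNReal.tendsto_nhds_zero.1 (tendsto_mollify_of_continuous hs hφ hg hgc))
    (ε / 2) (ENNReal.half_pos hε.ne')] with k hk
  have hmc : ∀ h : Space d → F, LocallyIntegrable h → Continuous (mollify (φ k) h) := fun h hh =>
    (φ k).hasCompactSupport_normed.continuous_convolution_left _ (φ k).continuous_normed hh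
  have e : mollify (φ k) f - f = mollify (φ k) (f - g) + (mollify (φ k) g - g) - (f - g) := by
    rw [mollify_sub _ hfl hgl]; abel
  have hm1 : AEStronglyMeasurable (mollify (φ k) (f - g)) (wMeasure d s) :=
    (hmc _ (hfl.sub hgl)).aestronglyMeasurable
  have hm2 : AEStronglyMeasurable (mollify (φ k) g - g) (wMeasure d s) :=
    ((hmc _ hgl).sub hg).aestronglyMeasurable
  have hm3 : AEStronglyMeasurable (f - g) (wMeasure d s) := (hf.sub hgs).aestronglyMeasurable
  calc eLpNorm (mollify (φ k) f - f) 2 (wMeasure d s)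
      ≤ (eLpNorm (mollify (φ k) (f - g)) 2 (wMeasure d s) +
          eLpNorm (mollify (φ k) g - g) 2 (wMeasure d s)) + eLpNorm (f - g) 2 (wMeasure d s) := by
        rw [e]
        exact (eLpNorm_sub_le (hm1.add hm2) hm3 (by norm_num)).trans
          (add_le_add_left (eLpNorm_add_le hm1 hm2 (by norm_num)) _)
    _ ≤ (K * η + ε / 2) + η := by
        gcongr
        exact (hKb _ (hφ2 k) _ (hf.sub hgs)).trans (by gcongr)
    _ = (K + 1) * η + ε / 2 := by ring
    _ ≤ ε / 2 + ε / 2 := by gcongr; exact ENNReal.mul_div_le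
    _ = ε := ENNReal.add_halves ε

theorem contDiff_mollify {d : ℕ} (φ : ContDiffBump (0 : Space d)) {f : Space d → ℝ}
    (hf : LocallyIntegrable f) : ContDiff ℝ ∞ (mollify φ f) :=
  φ.hasCompactSupport_normed.contDiff_convolution_left _ φ.contDiff_normed hf

theorem hasCompactSupport_mollify {d : ℕ} (φ : ContDiffBump (0 : Space d)) {f : Space d → ℝ}
    (hf : HasCompactSupport f) : HasCompactSupport (mollify φ f) :=
  (φ.hasCompactSupport_normed (μ := volume)).convolution _ hf

/-- The derivative falls on the kernel, and the definition of the weak gradient is applied to the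
translated and reflected kernel, which is itself a test function. -/
theorem gradient_mollify {d : ℕ} (φ : ContDiffBump (0 : Space d)) {f : Space d → ℝ}
    {G : Space d → Space d} (hf : LocallyIntegrable f) (hG : LocallyIntegrable G)
    (h : ∀ ψ : Space d → ℝ, ContDiff ℝ ∞ ψ → HasCompactSupport ψ → ∀ e : Space d,
      ∫ x, f x * fderiv ℝ ψ x e = -∫ x, inner ℝ (G x) e * ψ x) :
    gradient (mollify φ f) = mollify φ G := by
  ext1 x
  refine ext_inner_right ℝ fun e => ?_
  have h1 := (φ.hasCompactSupport_normed (μ := volume)).hasFDerivAt_convolution_left (μ := volume)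
    (ContinuousLinearMap.lsmul ℝ ℝ) (φ.contDiff_normed (n := 1)) hf x
  have hc : ContDiff ℝ ∞ (φ.normed (volume : Measure (Space d))) := φ.contDiff_normed
  set ψ : Space d → ℝ := fun y => φ.normed volume (x - y) with hψ
  have hψs : ContDiff ℝ ∞ ψ := hc.comp (contDiff_const.sub contDiff_id)
  have hψc : HasCompactSupport ψ :=
    φ.hasCompactSupport_normed.comp_homeomorph (Homeomorph.subLeft x)
  have hψd : ∀ y, fderiv ℝ ψ y e = -fderiv ℝ (φ.normed (volume : Measure (Space d))) (x - y) e := by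
    intro y
    have h2 : HasFDerivAt ψ ((fderiv ℝ (φ.normed (volume : Measure (Space d))) (x - y)).comp
        (-ContinuousLinearMap.id ℝ (Space d))) y :=
      HasFDerivAt.comp y (hc.differentiable (by simp) (x - y)).hasFDerivAt
        ((hasFDerivAt_id y).const_sub x)
    rw [h2.fderiv]; simp
  have h3 := h ψ hψs hψc e
  have hgr : inner ℝ (gradient (mollify φ f) x) e = fderiv ℝ (mollify φ f) x e := by
    rw [gradient, InnerProductSpace.toDual_symm_apply]
  rw [hgr, mollify, h1.fderiv, convolution_eq_swap, ContinuousLinearMap.integral_apply]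
  · have e1 : ∀ y, ((ContinuousLinearMap.lsmul ℝ ℝ).precompL (Space d)
        (fderiv ℝ (φ.normed (volume : Measure (Space d))) (x - y)) (f y)) e =
        -(f y * fderiv ℝ ψ y e) := fun y => by
      simp [ContinuousLinearMap.precompL_apply, hψd, mul_comm]
    simp_rw [e1]
    rw [integral_neg, h3, neg_neg, mollify, convolution_eq_swap, real_inner_comm]
    have hint : Integrable (fun y => φ.normed volume (x - y) • G y) := by
      have := (convolutionExists_normed φ hG x).integrable_swap
      simpa using this
    have h4 := integral_inner (𝕜 := ℝ) hint e
    simp only [ContinuousLinearMap.lsmul_apply]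
    rw [← h4]
    refine integral_congr_ae (ae_of_all _ fun y => ?_)
    simp only [hψ, inner_smul_right]
    rw [real_inner_comm, mul_comm]
  · have hex : ConvolutionExistsAt (fderiv ℝ (φ.normed (volume : Measure (Space d)))) f x
        ((ContinuousLinearMap.lsmul ℝ ℝ).precompL (Space d)) volume :=
      (φ.hasCompactSupport_normed.fderiv ℝ).convolutionExists_left _
        (hc.continuous_fderiv (by simp)) hf x
    exact hex.integrable_swap

end ThinReaction

/-! ### The trace inequality on the thin space -/

namespace ThinReaction
open Filter Topology
open scoped ENNReal Convolution

theorem inner_gradient_left {d : ℕ} (f : Space d → ℝ) (x e : Space d) :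
    inner ℝ (gradient f x) e = fderiv ℝ f x e := by
  rw [gradient, InnerProductSpace.toDual_symm_apply]

theorem continuous_gradient {d : ℕ} {f : Space d → ℝ} (hf : ContDiff ℝ 1 f) :
    Continuous (gradient f) :=
  (InnerProductSpace.toDual ℝ (Space d)).symm.continuous.comp (hf.continuous_fderiv (by simp))

theorem hasCompactSupport_gradient {d : ℕ} {f : Space d → ℝ} (hf : HasCompactSupport f) :
    HasCompactSupport (gradient f) :=
  (hf.fderiv ℝ).comp_left (g := (InnerProductSpace.toDual ℝ (Space d)).symm) (map_zero _)

theorem lintegral_thinMeasure {d : ℕ} {f : Space d → ℝ≥0∞} (hf : Measurable f) :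
    ∫⁻ x, f x ∂thinMeasure d = ∫⁻ y, f (thinEmbed y) :=
  lintegral_map hf continuous_thinEmbed.measurable

theorem ENNReal_add_sq_le (a b : ℝ≥0∞) : (a + b) ^ 2 ≤ 2 * a ^ 2 + 2 * b ^ 2 := by
  have := ENNReal.rpow_add_le_mul_rpow_add_rpow a b (p := 2) (by norm_num)
  rw [← mul_add]
  convert this using 2 <;> norm_num

theorem hasDerivAt_slice {d : ℕ} {v : Space d → ℝ} (hv : ContDiff ℝ 1 v)
    (y : EuclideanSpace ℝ (Fin d)) (t : ℝ) :
    HasDerivAt (fun t => v (sliceMap (y, t))) (fderiv ℝ v (sliceMap (y, t)) (normalVec d)) t := by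
  have h1 : HasDerivAt (fun t => sliceMap (y, t)) (normalVec d) t := by
    simpa [sliceMap] using ((hasDerivAt_id t).smul_const (normalVec d)).const_add (thinEmbed y)
  exact ((hv.differentiable (by simp) _).hasFDerivAt.comp_hasDerivAt t h1)

theorem continuous_slice {d : ℕ} (y : EuclideanSpace ℝ (Fin d)) :
    Continuous fun t : ℝ => sliceMap (y, t) :=
  continuous_sliceMap.comp (by fun_prop)

/-- The fundamental theorem of calculus on the vertical segment from `(y, 0)` to `(y, t)`, followed
by Cauchy-Schwarz with the weight and its inverse. -/
theorem sq_enorm_slice_zero_le {d : ℕ} (s : ℝ) {v : Space d → ℝ} (hv : ContDiff ℝ 1 v)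
    (y : EuclideanSpace ℝ (Fin d)) {h t : ℝ} (ht : t ∈ Ioo 0 h) :
    ‖v (thinEmbed y)‖ₑ ^ 2 ≤ 2 * ‖v (sliceMap (y, t))‖ₑ ^ 2 +
      2 * ((∫⁻ r in Ioo 0 h, ENNReal.ofReal (|r| ^ (1 - 2 * s)) *
        ‖gradient v (sliceMap (y, r))‖ₑ ^ 2) *
        ∫⁻ r in Ioo 0 h, ENNReal.ofReal (|r| ^ (1 - 2 * (1 - s)))) := by
  set p' : ℝ → ℝ := fun t => fderiv ℝ v (sliceMap (y, t)) (normalVec d)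
  have hp'c : Continuous p' :=
    ((hv.continuous_fderiv (by simp)).comp (continuous_slice y)).clm_apply continuous_const
  have hftc : ∫ r in (0 : ℝ)..t, p' r = v (sliceMap (y, t)) - v (sliceMap (y, 0)) :=
    intervalIntegral.integral_eq_sub_of_hasDerivAt (fun r _ => hasDerivAt_slice hv y r)
      (hp'c.intervalIntegrable _ _)
  have h0 : sliceMap (y, (0 : ℝ)) = thinEmbed y := by simp [sliceMap]
  have h1 : ‖v (thinEmbed y)‖ₑ ≤ ‖v (sliceMap (y, t))‖ₑ +
      ∫⁻ r in Ioo 0 h, ‖gradient v (sliceMap (y, r))‖ₑ := by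
    have e : v (thinEmbed y) = v (sliceMap (y, t)) - ∫ r in (0 : ℝ)..t, p' r := by
      rw [hftc, h0]; ring
    rw [e]
    refine enorm_sub_le.trans (add_le_add_right ?_ _)
    rw [intervalIntegral.integral_of_le ht.1.le]
    refine (enorm_integral_le_lintegral_enorm _).trans ?_
    have hsub : Ioc 0 t ⊆ Ioo 0 h := fun r hr => ⟨hr.1, hr.2.trans_lt ht.2⟩
    refine (lintegral_mono_set hsub).trans
      (lintegral_mono fun r => ?_)
    rw [enorm_le_iff_norm_le]
    simp only [p']
    rw [← inner_gradient_left]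
    simpa [norm_normalVec] using norm_inner_le_norm (𝕜 := ℝ) (gradient v (sliceMap (y, r)))
      (normalVec d)
  refine (pow_le_pow_left' h1 2).trans ((ENNReal_add_sq_le _ _).trans ?_)
  gcongr
  refine sq_lintegral_le_of_mul_eq_one ?_ (by fun_prop) (by fun_prop) ?_
  · exact ((continuous_gradient hv).comp (continuous_slice y)).enorm.measurable.aemeasurable
  · filter_upwards [ae_restrict_mem measurableSet_Ioo] with r hr
    rw [← ENNReal.ofReal_mul (Real.rpow_nonneg (abs_nonneg _) _),
      ← Real.rpow_add (abs_pos.2 hr.1.ne')]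
    ring_nf
    simp

theorem lintegral_abs_rpow_Ioo {a h : ℝ} (ha : -1 < a) (hh : 0 < h) :
    ∫⁻ t in Ioo 0 h, ENNReal.ofReal (|t| ^ a) = ENNReal.ofReal (h ^ (a + 1) / (a + 1)) := by
  have h1 : ∫ t in (0 : ℝ)..h, t ^ a = h ^ (a + 1) / (a + 1) := by
    rw [integral_rpow (Or.inl ha), Real.zero_rpow (by linarith), sub_zero]
  rw [← h1, intervalIntegral.integral_of_le hh.le, integral_Ioc_eq_integral_Ioo,
    ofReal_integral_eq_lintegral_ofReal]
  · refine setLIntegral_congr_fun measurableSet_Ioo fun t ht => ?_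
    simp [abs_of_pos ht.1]
  · exact (intervalIntegral.integrableOn_Ioo_rpow_iff hh).2 ha
  · filter_upwards [ae_restrict_mem measurableSet_Ioo] with t ht
    exact Real.rpow_nonneg ht.1.le _

/-- The pointwise bound is averaged over heights `0 < t < h` with the weight and then integrated in
`y`. The factor of the energy is the integral of the inverse weight over `(0, h)`, which tends to
zero with `h`. -/
theorem lintegral_thinMeasure_mul_le {d : ℕ} (s : ℝ) {v : Space d → ℝ} (hv : ContDiff ℝ 1 v)
    (h : ℝ) :
    (∫⁻ t in Ioo 0 h, ENNReal.ofReal (|t| ^ (1 - 2 * s))) * ∫⁻ x, ‖v x‖ₑ ^ 2 ∂thinMeasure d ≤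
      2 * ∫⁻ x, ‖v x‖ₑ ^ 2 ∂wMeasure d s +
      (∫⁻ t in Ioo 0 h, ENNReal.ofReal (|t| ^ (1 - 2 * s))) *
        (2 * ((∫⁻ x, ‖gradient v x‖ₑ ^ 2 ∂wMeasure d s) *
          ∫⁻ t in Ioo 0 h, ENNReal.ofReal (|t| ^ (1 - 2 * (1 - s))))) := by
  set c := ∫⁻ t in Ioo 0 h, ENNReal.ofReal (|t| ^ (1 - 2 * s))
  set b := ∫⁻ t in Ioo 0 h, ENNReal.ofReal (|t| ^ (1 - 2 * (1 - s)))
  have hvm : Measurable fun x => ‖v x‖ₑ ^ 2 := hv.continuous.enorm.measurable.pow_const 2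
  have hgm : Measurable fun x => ‖gradient v x‖ₑ ^ 2 :=
    (continuous_gradient hv).enorm.measurable.pow_const 2
  have hwm : Measurable fun t : ℝ => ENNReal.ofReal (|t| ^ (1 - 2 * s)) := by fun_prop
  have hslice : ∀ f : Space d → ℝ≥0∞, Measurable f →
      ∫⁻ x, f x ∂wMeasure d s =
        ∫⁻ y, ∫⁻ t, ENNReal.ofReal (|t| ^ (1 - 2 * s)) * f (sliceMap (y, t)) := by
    intro f hf
    rw [lintegral_wMeasure s hf, lintegral_slice (f := fun x => ENNReal.ofReal (weight s x) * f x)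
      ((measurable_weight s).ennreal_ofReal.mul hf)]
    simp [weight]
  have hsm : ∀ f : Space d → ℝ≥0∞, Measurable f → Measurable fun y =>
      ∫⁻ t, ENNReal.ofReal (|t| ^ (1 - 2 * s)) * f (sliceMap (y, t)) := fun f hf =>
    Measurable.lintegral_prod_right' (f := fun p : EuclideanSpace ℝ (Fin d) × ℝ =>
      ENNReal.ofReal (|p.2| ^ (1 - 2 * s)) * f (sliceMap p))
      ((hwm.comp measurable_snd).mul (hf.comp continuous_sliceMap.measurable))
  rw [lintegral_thinMeasure hvm, hslice _ hvm, hslice _ hgm,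
    ← lintegral_const_mul (f := fun y => ‖v (thinEmbed y)‖ₑ ^ 2) _
      (hvm.comp continuous_thinEmbed.measurable),
    ← lintegral_const_mul _ (hsm _ hvm), ← lintegral_mul_const _ (hsm _ hgm),
    ← lintegral_const_mul _ ((hsm _ hgm).mul_const _),
    ← lintegral_const_mul _ (((hsm _ hgm).mul_const _).const_mul _),
    ← lintegral_add_left ((hsm _ hvm).const_mul _)]
  refine lintegral_mono fun y => ?_
  have hvy : Measurable fun t : ℝ => ‖v (sliceMap (y, t))‖ₑ ^ 2 :=
    hvm.comp (continuous_slice y).measurable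
  calc c * ‖v (thinEmbed y)‖ₑ ^ 2
      = ∫⁻ t in Ioo 0 h, ENNReal.ofReal (|t| ^ (1 - 2 * s)) * ‖v (thinEmbed y)‖ₑ ^ 2 :=
        (lintegral_mul_const _ hwm).symm
    _ ≤ ∫⁻ t in Ioo 0 h, (2 * (ENNReal.ofReal (|t| ^ (1 - 2 * s)) * ‖v (sliceMap (y, t))‖ₑ ^ 2) +
          ENNReal.ofReal (|t| ^ (1 - 2 * s)) * (2 * ((∫⁻ r in Ioo 0 h,
            ENNReal.ofReal (|r| ^ (1 - 2 * s)) * ‖gradient v (sliceMap (y, r))‖ₑ ^ 2) * b))) := by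
        refine setLIntegral_mono' measurableSet_Ioo fun t ht => ?_
        calc _ ≤ _ := mul_le_mul_right (sq_enorm_slice_zero_le s hv y ht) _
          _ = _ := by ring
    _ = 2 * (∫⁻ t in Ioo 0 h, ENNReal.ofReal (|t| ^ (1 - 2 * s)) * ‖v (sliceMap (y, t))‖ₑ ^ 2) +
          c * (2 * ((∫⁻ r in Ioo 0 h,
            ENNReal.ofReal (|r| ^ (1 - 2 * s)) * ‖gradient v (sliceMap (y, r))‖ₑ ^ 2) * b)) := by
        rw [lintegral_add_left (f := fun t : ℝ => 2 * (ENNReal.ofReal (|t| ^ (1 - 2 * s)) *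
            ‖v (sliceMap (y, t))‖ₑ ^ 2)) ((hwm.mul hvy).const_mul 2),
          lintegral_const_mul (f := fun t : ℝ => ENNReal.ofReal (|t| ^ (1 - 2 * s)) *
            ‖v (sliceMap (y, t))‖ₑ ^ 2) _ (hwm.mul hvy), lintegral_mul_const _ hwm]
    _ ≤ _ := by
        gcongr <;> exact Measure.restrict_le_self

/-- The trace inequality on the thin space, with an arbitrarily small factor of the energy. -/
theorem exists_lintegral_thinMeasure_le {d : ℕ} {s : ℝ} (hs : s ∈ Ioo (0 : ℝ) 1) {δ : ℝ}
    (hδ : 0 < δ) :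
    ∃ C : ℝ≥0∞, C ≠ ⊤ ∧ ∀ v : Space d → ℝ, ContDiff ℝ 1 v →
      ∫⁻ x, ‖v x‖ₑ ^ 2 ∂thinMeasure d ≤
        ENNReal.ofReal δ * ∫⁻ x, ‖gradient v x‖ₑ ^ 2 ∂wMeasure d s +
        C * ∫⁻ x, ‖v x‖ₑ ^ 2 ∂wMeasure d s := by
  -- The exponent `1 - 2(1 - s) + 1` equals `2s > 0`, so twice the integral of the inverse weight
  -- over `(0, h)` is `h^(2s) / s`, and `h` is chosen to make it equal to `δ`.
  obtain ⟨h, hh, hhδ⟩ : ∃ h : ℝ, 0 < h ∧ 2 * (h ^ (1 - 2 * (1 - s) + 1) /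
      (1 - 2 * (1 - s) + 1)) ≤ δ := by
    have hs1 : 0 < 1 - 2 * (1 - s) + 1 := by linarith [hs.1]
    refine ⟨(δ * (1 - 2 * (1 - s) + 1) / 2) ^ (1 - 2 * (1 - s) + 1)⁻¹,
      Real.rpow_pos_of_pos (by positivity) _, ?_⟩
    rw [Real.rpow_inv_rpow (by positivity) hs1.ne']
    field_simp
    exact le_rfl
  set c := ∫⁻ t in Ioo 0 h, ENNReal.ofReal (|t| ^ (1 - 2 * s)) with hc
  have hce : c = ENNReal.ofReal (h ^ (1 - 2 * s + 1) / (1 - 2 * s + 1)) :=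
    lintegral_abs_rpow_Ioo (by linarith [hs.2]) hh
  have hc0 : c ≠ 0 := by
    rw [hce]
    have : 0 < 1 - 2 * s + 1 := by linarith [hs.2]
    have : 0 < h ^ (1 - 2 * s + 1) / (1 - 2 * s + 1) := by positivity
    simpa using this
  have hct : c ≠ ⊤ := by rw [hce]; exact ENNReal.ofReal_ne_top
  refine ⟨c⁻¹ * 2, ENNReal.mul_ne_top (ENNReal.inv_ne_top.2 hc0) (by norm_num), fun v hv => ?_⟩
  have key := lintegral_thinMeasure_mul_le s hv h
  rw [← hc, lintegral_abs_rpow_Ioo (a := 1 - 2 * (1 - s)) (by linarith [hs.1]) hh] at key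
  have h1 : ∀ z : ℝ≥0∞, c⁻¹ * (c * z) = z := fun z => by
    rw [← mul_assoc, ENNReal.inv_mul_cancel hc0 hct, one_mul]
  rw [← h1 (∫⁻ x, ‖v x‖ₑ ^ 2 ∂thinMeasure d)]
  refine (mul_le_mul_right key _).trans ?_
  rw [mul_add, h1, add_comm, mul_assoc]
  refine add_le_add_left ?_ _
  calc _ = 2 * ENNReal.ofReal (h ^ (1 - 2 * (1 - s) + 1) / (1 - 2 * (1 - s) + 1)) *
        ∫⁻ x, ‖gradient v x‖ₑ ^ 2 ∂wMeasure d s := by ring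
    _ ≤ _ := by
        refine mul_le_mul_left ?_ _
        have h2 : (2 : ℝ≥0∞) = ENNReal.ofReal 2 := by norm_num
        rw [h2, ← ENNReal.ofReal_mul (by norm_num)]
        exact ENNReal.ofReal_le_ofReal hhδ

/-- Fubini in the slice coordinates, and the fundamental theorem of calculus on each vertical
half-line. -/
theorem integral_halfspace_fderiv {d : ℕ} {f : Space d → ℝ} (hf : ContDiff ℝ 1 f)
    (hfc : HasCompactSupport f) :
    ∫ x in {x : Space d | 0 < x (Fin.last d)}, fderiv ℝ f x (normalVec d) =
      -∫ x, f x ∂thinMeasure d := by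
  have hms : MeasurableSet {x : Space d | 0 < x (Fin.last d)} :=
    measurableSet_lt measurable_const measurable_last
  have hfd : Continuous fun x => fderiv ℝ f x (normalVec d) :=
    (hf.continuous_fderiv (by simp)).clm_apply continuous_const
  have hfdc : HasCompactSupport fun x => fderiv ℝ f x (normalVec d) :=
    (hfc.fderiv ℝ).comp_left (g := fun L : Space d →L[ℝ] ℝ => L (normalVec d)) (by simp)
  set g := {x : Space d | 0 < x (Fin.last d)}.indicator fun x => fderiv ℝ f x (normalVec d)
  have hgi : Integrable g := (hfd.integrable_of_hasCompactSupport hfdc).indicator hms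
  have hmp := measurePreserving_sliceMap d
  rw [← integral_indicator hms]
  change ∫ x, g x = _
  rw [← hmp.map_eq, integral_map hmp.measurable.aemeasurable
    (by rw [hmp.map_eq]; exact hgi.aestronglyMeasurable), integral_prod (fun p => g (sliceMap p))
    (hmp.integrable_comp_of_integrable hgi), thinMeasure, integral_map
    continuous_thinEmbed.measurable.aemeasurable hf.continuous.aestronglyMeasurable,
    ← integral_neg]
  refine integral_congr_ae (ae_of_all _ fun y => ?_)
  have hcl : Topology.IsClosedEmbedding fun t : ℝ => sliceMap (y, t) := by
    have : Isometry fun t : ℝ => sliceMap (y, t) := Isometry.of_dist_eq fun t r => by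
      simp [sliceMap, dist_eq_norm, ← sub_smul, norm_smul, norm_normalVec]
    exact this.isClosedEmbedding
  have hpc : HasCompactSupport fun t : ℝ => f (sliceMap (y, t)) :=
    hfc.comp_isClosedEmbedding hcl
  have hpd : deriv (fun t : ℝ => f (sliceMap (y, t))) =
      fun t => fderiv ℝ f (sliceMap (y, t)) (normalVec d) :=
    funext fun t => (hasDerivAt_slice hf y t).deriv
  have hp1 : ContDiff ℝ 1 fun t : ℝ => f (sliceMap (y, t)) := by
    rw [contDiff_one_iff_deriv, hpd]
    exact ⟨fun t => (hasDerivAt_slice hf y t).differentiableAt, hfd.comp (continuous_slice y)⟩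
  have := hpc.integral_Ioi_deriv_eq hp1 0
  rw [hpd] at this
  have h0 : sliceMap (y, (0 : ℝ)) = thinEmbed y := by simp [sliceMap]
  simp only [h0] at this
  change ∫ t, g (sliceMap (y, t)) = -f (thinEmbed y)
  rw [← this, ← integral_indicator measurableSet_Ioi]
  refine integral_congr_ae (ae_of_all _ fun t => ?_)
  simp [g, indicator]

theorem lintegral_enorm_le_eLpNorm {α F : Type*} [MeasurableSpace α] [NormedAddCommGroup F]
    {ν : Measure α} {W V : α → ℝ≥0∞} (hW : Measurable W) (hV : Measurable V)
    (h : ∀ᵐ x ∂ν, W x * V x = 1) {f : α → F} (hf : AEStronglyMeasurable f ν) :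
    ∫⁻ x, ‖f x‖ₑ ∂ν ≤ eLpNorm f 2 (ν.withDensity W) * (∫⁻ x, V x ∂ν) ^ (1 / 2 : ℝ) := by
  have h1 := sq_lintegral_le_of_mul_eq_one hf.enorm hW.aemeasurable hV.aemeasurable h
  have h2 : ∫⁻ x, W x * ‖f x‖ₑ ^ 2 ∂ν = ∫⁻ x, ‖f x‖ₑ ^ 2 ∂ν.withDensity W :=
    (lintegral_withDensity_eq_lintegral_mul₀ hW.aemeasurable (hf.enorm.pow_const 2)).symm
  rw [h2] at h1
  rw [eLpNorm_two_eq, ← ENNReal.mul_rpow_of_nonneg _ _ (by norm_num)]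
  calc _ = ((∫⁻ x, ‖f x‖ₑ ∂ν) ^ 2) ^ (1 / 2 : ℝ) := by
        rw [← ENNReal.rpow_natCast, ← ENNReal.rpow_mul]; norm_num
    _ ≤ _ := ENNReal.rpow_le_rpow h1 (by norm_num)

end ThinReaction

/-! ### Measures homogeneous in polar coordinates, and radial maps -/

namespace ThinReaction
open Filter Topology
open scoped ENNReal

/-- `μ` is the image of `σ × r^κ dr` under `(θ, r) ↦ r θ`, with `σ` a finite measure carried by the
unit sphere. -/
structure IsPolar {d : ℕ} (μ σ : Measure (Space d)) (κ : ℝ) : Prop where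
  lintegral_eq : ∀ f : Space d → ℝ≥0∞, Measurable f →
    ∫⁻ x, f x ∂μ = ∫⁻ θ, (∫⁻ r in Ioi (0 : ℝ), ENNReal.ofReal (r ^ κ) * f (r • θ)) ∂σ
  norm_eq : ∀ᵐ θ ∂σ, ‖θ‖ = 1
  finite : IsFiniteMeasure σ

/-- The surface measure of the unit sphere, as a measure on the ambient space. -/
def unitSphereMeasure (E : Type*) [NormedAddCommGroup E] [NormedSpace ℝ E] [MeasureSpace E] :
    Measure E := Measure.map ((↑) : sphere (0 : E) 1 → E) (volume : Measure E).toSphere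

theorem lintegral_polar {E : Type*} [NormedAddCommGroup E] [NormedSpace ℝ E] [MeasureSpace E]
    [BorelSpace E] [FiniteDimensional ℝ E] [Nontrivial E] [(volume : Measure E).IsAddHaarMeasure]
    {f : E → ℝ≥0∞} (hf : Measurable f) :
    ∫⁻ x, f x = ∫⁻ θ, (∫⁻ r in Ioi (0 : ℝ),
      ENNReal.ofReal (r ^ (Module.finrank ℝ E - 1)) * f (r • θ)) ∂unitSphereMeasure E := by
  have hms : MeasurableSet ({0}ᶜ : Set E) := (measurableSet_singleton _).compl
  have hmp := (volume : Measure E).measurePreserving_homeomorphUnitSphereProd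
  have hin : Measurable fun p : E × ℝ =>
      ENNReal.ofReal (p.2 ^ (Module.finrank ℝ E - 1)) * f (p.2 • p.1) :=
    ((measurable_snd.pow_const _).ennreal_ofReal).mul
      (hf.comp (measurable_snd.smul measurable_fst))
  have e : ∫⁻ x, f x = ∫⁻ x : ({0}ᶜ : Set E), f x ∂(Measure.comap Subtype.val volume) := by
    rw [lintegral_subtype_comap hms, restrict_compl_singleton]
  have hsymm := hmp.symm (homeomorphUnitSphereProd E).toMeasurableEquiv
  rw [unitSphereMeasure, lintegral_map hin.lintegral_prod_right' measurable_subtype_coe, e,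
    ← hsymm.lintegral_comp (f := fun x : ({0}ᶜ : Set E) => f x)
      (hf.comp measurable_subtype_coe), lintegral_prod
    (fun p => f ((homeomorphUnitSphereProd E).toMeasurableEquiv.symm p : ({0}ᶜ : Set E)))
    ((hf.comp measurable_subtype_coe).comp hsymm.measurable).aemeasurable]
  refine lintegral_congr fun θ => ?_
  rw [Measure.volumeIoiPow, lintegral_withDensity_eq_lintegral_mul _ (by fun_prop)
    (g := fun r => f ((homeomorphUnitSphereProd E).toMeasurableEquiv.symm (θ, r) : ({0}ᶜ : Set E)))
    (((hf.comp measurable_subtype_coe).comp hsymm.measurable).comp measurable_prodMk_left),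
    ← lintegral_subtype_comap measurableSet_Ioi]
  rfl

theorem ae_norm_unitSphereMeasure (E : Type*) [NormedAddCommGroup E] [NormedSpace ℝ E]
    [MeasureSpace E] [BorelSpace E] : ∀ᵐ θ ∂unitSphereMeasure E, ‖θ‖ = 1 := by
  rw [unitSphereMeasure, ae_map_iff measurable_subtype_coe.aemeasurable
    (measurableSet_eq_fun measurable_norm measurable_const)]
  exact ae_of_all _ fun θ => by simp

instance {E : Type*} [NormedAddCommGroup E] [NormedSpace ℝ E] [MeasureSpace E]
    [BorelSpace E] [FiniteDimensional ℝ E] [(volume : Measure E).IsAddHaarMeasure] :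
    IsFiniteMeasure (unitSphereMeasure E) := by
  unfold unitSphereMeasure; infer_instance

theorem isPolar_volume (d : ℕ) : IsPolar (volume : Measure (Space d)) (unitSphereMeasure (Space d)) d where
  lintegral_eq f hf := by
    rw [lintegral_polar hf]
    simp
  norm_eq := ae_norm_unitSphereMeasure _
  finite := inferInstance

/-- Polar coordinates of the thin space itself, whose unit sphere is embedded in the ambient one.
For `d = 0` the thin space is a point and has no such description. -/
theorem isPolar_thinMeasure {d : ℕ} (hd : 1 ≤ d) :
    IsPolar (thinMeasure d)
      (Measure.map thinEmbed (unitSphereMeasure (EuclideanSpace ℝ (Fin d)))) ((d : ℝ) - 1) where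
  lintegral_eq f hf := by
    have : Nonempty (Fin d) := ⟨⟨0, hd⟩⟩
    rw [lintegral_thinMeasure hf, lintegral_polar (f := fun y => f (thinEmbed y)) (hf.comp continuous_thinEmbed.measurable),
      lintegral_map _ continuous_thinEmbed.measurable]
    · simp only [finrank_euclideanSpace, Fintype.card_fin, thinEmbed_smul]
      refine lintegral_congr fun θ => lintegral_congr fun r => ?_
      have e : (d : ℝ) - 1 = ((d - 1 : ℕ) : ℝ) := by rw [Nat.cast_sub hd, Nat.cast_one]
      rw [e, Real.rpow_natCast]
    · exact Measurable.lintegral_prod_right' (f := fun p : Space d × ℝ =>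
        ENNReal.ofReal (p.2 ^ ((d : ℝ) - 1)) * f (p.2 • p.1)) (((measurable_snd.pow_const _).ennreal_ofReal).mul
          (hf.comp (measurable_snd.smul measurable_fst)))
  norm_eq := by
    rw [ae_map_iff continuous_thinEmbed.measurable.aemeasurable
      (measurableSet_eq_fun measurable_norm measurable_const)]
    simpa only [norm_thinEmbed] using ae_norm_unitSphereMeasure (EuclideanSpace ℝ (Fin d))
  finite := inferInstance

variable {d : ℕ} {μ σ : Measure (Space d)} {κ : ℝ}

theorem IsPolar.measurable_inner (κ : ℝ) {f : Space d → ℝ≥0∞} (hf : Measurable f) :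
    Measurable fun p : Space d × ℝ => ENNReal.ofReal (p.2 ^ κ) * f (p.2 • p.1) :=
  ((measurable_snd.pow_const _).ennreal_ofReal).mul (hf.comp (measurable_snd.smul measurable_fst))

/-- The weighted surface measure of the unit sphere. -/
def wSphereMeasure (d : ℕ) (s : ℝ) : Measure (Space d) :=
  (unitSphereMeasure (Space d)).withDensity fun θ => ENNReal.ofReal (weight s θ)

theorem lintegral_wMeasure_polar (s : ℝ) {f : Space d → ℝ≥0∞} (hf : Measurable f) :
    ∫⁻ x, f x ∂wMeasure d s = ∫⁻ θ, (∫⁻ r in Ioi (0 : ℝ),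
      ENNReal.ofReal (r ^ ((d : ℝ) + (1 - 2 * s))) * f (r • θ)) ∂wSphereMeasure d s := by
  have hw : Measurable fun x : Space d => ENNReal.ofReal (weight s x) :=
    (measurable_weight s).ennreal_ofReal
  rw [lintegral_wMeasure s hf, (isPolar_volume d).lintegral_eq
    (fun x => ENNReal.ofReal (weight s x) * f x) (hw.mul hf), wSphereMeasure,
    lintegral_withDensity_eq_lintegral_mul _ hw (IsPolar.measurable_inner _ hf).lintegral_prod_right']
  refine lintegral_congr fun θ => ?_
  rw [Pi.mul_apply, ← lintegral_const_mul]
  · refine setLIntegral_congr_fun measurableSet_Ioi fun r hr => ?_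
    simp only
    rw [weight_smul s (le_of_lt hr), ENNReal.ofReal_mul (Real.rpow_nonneg (le_of_lt hr) _),
      Real.rpow_add hr, ENNReal.ofReal_mul (Real.rpow_nonneg (le_of_lt hr) _)]
    ring
  · exact (IsPolar.measurable_inner _ hf).comp measurable_prodMk_left

/-- In polar coordinates the finite mass of the unit ball is the mass of the sphere times a positive
radial integral. -/
theorem isFiniteMeasure_wSphereMeasure {s : ℝ} (hs : s ∈ Ioo (0 : ℝ) 1) :
    IsFiniteMeasure (wSphereMeasure d s) := by
  have hκ : -1 < (d : ℝ) + (1 - 2 * s) := by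
    have : (0 : ℝ) ≤ d := d.cast_nonneg
    linarith [hs.2]
  have hnorm : ∀ᵐ θ ∂wSphereMeasure d s, ‖θ‖ = 1 :=
    (withDensity_absolutelyContinuous _ _).ae_le (ae_norm_unitSphereMeasure (Space d))
  have h1 : wMeasure d s (ball 0 1) = wSphereMeasure d s univ *
      ENNReal.ofReal (1 ^ ((d : ℝ) + (1 - 2 * s) + 1) / ((d : ℝ) + (1 - 2 * s) + 1)) := by
    rw [← lintegral_indicator_one measurableSet_ball,
      lintegral_wMeasure_polar s (measurable_one.indicator measurableSet_ball),
      ← lintegral_abs_rpow_Ioo hκ one_pos,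
      mul_comm (wSphereMeasure d s univ), ← lintegral_const]
    refine lintegral_congr_ae ?_
    filter_upwards [hnorm] with θ hθ
    rw [← lintegral_indicator measurableSet_Ioi, ← lintegral_indicator measurableSet_Ioo]
    refine lintegral_congr fun r => ?_
    by_cases hr : 0 < r
    · by_cases hr1 : r < 1
      · simp [indicator, hr, hr1, norm_smul, hθ, abs_of_pos hr]
      · simp [indicator, hr, hr1, norm_smul, hθ, abs_of_pos hr]
    · simp [indicator, hr]
  refine ⟨lt_top_iff_ne_top.2 fun h => ?_⟩
  have hpos : 0 < (1 : ℝ) ^ ((d : ℝ) + (1 - 2 * s) + 1) / ((d : ℝ) + (1 - 2 * s) + 1) := by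
    have : 0 < (d : ℝ) + (1 - 2 * s) + 1 := by linarith
    positivity
  rw [h, ENNReal.top_mul (by simpa using hpos)] at h1
  exact (wMeasure_ball_lt_top hs.2 1).ne h1

theorem isPolar_wMeasure {s : ℝ} (hs : s ∈ Ioo (0 : ℝ) 1) :
    IsPolar (wMeasure d s) (wSphereMeasure d s) ((d : ℝ) + (1 - 2 * s)) where
  lintegral_eq _ hf := lintegral_wMeasure_polar s hf
  norm_eq := (withDensity_absolutelyContinuous _ _).ae_le (ae_norm_unitSphereMeasure (Space d))
  finite := isFiniteMeasure_wSphereMeasure hs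

/-- The measure `r^κ dr` on the half-line. -/
def radialMeasure (κ : ℝ) : Measure ℝ :=
  (volume.restrict (Ioi (0 : ℝ))).withDensity fun r => ENNReal.ofReal (r ^ κ)

instance (κ : ℝ) : SFinite (radialMeasure κ) := by unfold radialMeasure; infer_instance

theorem IsPolar.measurePreserving (h : IsPolar μ σ κ) :
    MeasurePreserving (fun p : Space d × ℝ => p.2 • p.1) (σ.prod (radialMeasure κ)) μ := by
  have := h.finite
  have hm : Measurable fun p : Space d × ℝ => p.2 • p.1 := measurable_snd.smul measurable_fst
  refine ⟨hm, ?_⟩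
  refine Measure.ext_of_lintegral _ fun f hf => ?_
  rw [lintegral_map hf hm, h.lintegral_eq f hf,
    lintegral_prod (fun p : Space d × ℝ => f (p.2 • p.1)) (hf.comp hm).aemeasurable]
  refine lintegral_congr fun θ => ?_
  rw [radialMeasure, lintegral_withDensity_eq_lintegral_mul _ (by fun_prop)
    (g := fun r => f (r • θ)) ((hf.comp hm).comp measurable_prodMk_left)]
  rfl

theorem integral_radialMeasure (κ : ℝ) (f : ℝ → ℝ) :
    ∫ r, f r ∂radialMeasure κ = ∫ r in Ioi (0 : ℝ), r ^ κ * f r := by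
  rw [radialMeasure, integral_withDensity_eq_integral_toReal_smul (by fun_prop) (by simp)]
  refine setIntegral_congr_fun measurableSet_Ioi fun r hr => ?_
  simp [ENNReal.toReal_ofReal (Real.rpow_nonneg (le_of_lt hr) κ)]

theorem IsPolar.integral_eq (h : IsPolar μ σ κ) {f : Space d → ℝ} (hf : Integrable f μ) :
    ∫ x, f x ∂μ = ∫ θ, (∫ r in Ioi (0 : ℝ), r ^ κ * f (r • θ)) ∂σ := by
  have := h.finite
  have hmp := h.measurePreserving
  rw [← hmp.map_eq, integral_map hmp.measurable.aemeasurable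
    (by rw [hmp.map_eq]; exact hf.aestronglyMeasurable),
    integral_prod (fun p : Space d × ℝ => f (p.2 • p.1)) (hmp.integrable_comp_of_integrable hf)]
  simp_rw [integral_radialMeasure]

theorem IsPolar.integral_eq_swap (h : IsPolar μ σ κ) {f : Space d → ℝ} (hf : Integrable f μ) :
    ∫ x, f x ∂μ = ∫ r in Ioi (0 : ℝ), r ^ κ * ∫ θ, f (r • θ) ∂σ := by
  have := h.finite
  have hmp := h.measurePreserving
  rw [← hmp.map_eq, integral_map hmp.measurable.aemeasurable
    (by rw [hmp.map_eq]; exact hf.aestronglyMeasurable),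
    integral_prod_symm (fun p : Space d × ℝ => f (p.2 • p.1)) (hmp.integrable_comp_of_integrable hf), integral_radialMeasure]

/-- The radial map `x ↦ exp(m(|x|)) x`. -/
def radialMap (m : ℝ → ℝ) (x : Space d) : Space d := Real.exp (m ‖x‖) • x

/-- The Jacobian of `radialMap m` for a measure with polar exponent `κ`. -/
def radialJacobian (κ : ℝ) (m : ℝ → ℝ) (r : ℝ) : ℝ :=
  Real.exp ((κ + 1) * m r) * (1 + r * deriv m r)

theorem continuous_radialMap {m : ℝ → ℝ} (hm : Continuous m) :
    Continuous (radialMap m : Space d → Space d) := by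
  unfold radialMap; fun_prop

/-- A radial map preserves every ray and acts on it by the increasing bijection `r ↦ exp(m(r)) r` of
the half-line. The change of variables is thus one-dimensional, and the measures in play differ only
through the exponent `κ`. -/
theorem lintegral_comp_radialMap (h : IsPolar μ σ κ) {m : ℝ → ℝ} (hm : ContDiff ℝ 1 m)
    (hmc : HasCompactSupport m) (hpos : ∀ r, 0 < r → 0 < 1 + r * deriv m r)
    {f : Space d → ℝ≥0∞} (hf : Measurable f) :
    ∫⁻ x, ENNReal.ofReal (radialJacobian κ m ‖x‖) * f (radialMap m x) ∂μ = ∫⁻ x, f x ∂μ := by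
  have hmd : Continuous (deriv m) := hm.continuous_deriv le_rfl
  set S : ℝ → ℝ := fun r => Real.exp (m r) * r with hS
  have hSd : ∀ r, HasDerivAt S (Real.exp (m r) * (1 + r * deriv m r)) r := fun r => by
    have h1 := ((hm.differentiable (by simp) r).hasDerivAt.exp).mul (hasDerivAt_id r)
    refine h1.congr_deriv ?_
    simp only [id]; ring
  have hSc : Continuous S := by fun_prop
  have hmono : StrictMonoOn S (Ici 0) := by
    refine strictMonoOn_of_deriv_pos (convex_Ici 0) hSc.continuousOn fun r hr => ?_
    rw [interior_Ici] at hr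
    rw [(hSd r).deriv]
    exact mul_pos (Real.exp_pos _) (hpos r hr)
  have himg : S '' Ioi 0 = Ioi 0 := by
    ext y
    constructor
    · rintro ⟨r, hr, rfl⟩
      exact mul_pos (Real.exp_pos _) hr
    · intro hy
      obtain ⟨R, hR⟩ := hmc.isCompact.isBounded.subset_closedBall 0
      -- Beyond the support of `m` the map on rays is the identity, so its value at `R'` is at least
      -- `y` and the intermediate value theorem gives surjectivity.
      set R' := max (max R 0 + 1) y
      have hR' : m R' = 0 := by
        by_contra hne
        have h1 := hR (subset_tsupport m hne)
        rw [mem_closedBall_zero_iff, Real.norm_eq_abs] at h1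
        have h2 : max R 0 + 1 ≤ R' := le_max_left _ _
        linarith [le_abs_self R', le_max_left R 0]
      have h0 : (0 : ℝ) ≤ R' := (le_of_lt hy).trans (le_max_right _ _)
      have hy' : y ∈ Icc (S 0) (S R') := by
        simp only [hS, hR', mul_zero, Real.exp_zero, one_mul]
        exact ⟨le_of_lt hy, le_max_right _ _⟩
      obtain ⟨r, hr, rfl⟩ := intermediate_value_Icc h0 hSc.continuousOn hy'
      refine ⟨r, lt_of_le_of_ne hr.1 ?_, rfl⟩
      rintro rfl
      simp [hS] at hy
  have hJm : Measurable fun x : Space d => ENNReal.ofReal (radialJacobian κ m ‖x‖) := by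
    have := hm.continuous
    unfold radialJacobian
    refine Measurable.ennreal_ofReal (Continuous.measurable ?_)
    fun_prop
  rw [h.lintegral_eq f hf, h.lintegral_eq
    (fun x => ENNReal.ofReal (radialJacobian κ m ‖x‖) * f (radialMap m x))
    (hJm.mul (hf.comp (continuous_radialMap hm.continuous).measurable))]
  refine lintegral_congr_ae ?_
  filter_upwards [h.norm_eq] with θ hθ
  conv_rhs => rw [← himg]
  rw [lintegral_image_eq_lintegral_abs_deriv_mul measurableSet_Ioi
    (fun r _ => (hSd r).hasDerivWithinAt) (hmono.injOn.mono Ioi_subset_Ici_self)]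
  refine setLIntegral_congr_fun measurableSet_Ioi fun r hr => ?_
  have hr' : (0 : ℝ) < r := hr
  have hn : ‖r • θ‖ = r := by rw [norm_smul, hθ, mul_one, Real.norm_eq_abs, abs_of_pos hr']
  simp only [radialMap, hn, smul_smul, hS]
  rw [← mul_assoc, ← mul_assoc, ← ENNReal.ofReal_mul (Real.rpow_nonneg hr'.le _),
    ← ENNReal.ofReal_mul (abs_nonneg _),
    abs_of_pos (mul_pos (Real.exp_pos _) (hpos r hr')), radialJacobian,
    Real.mul_rpow (Real.exp_pos _).le hr'.le, ← Real.exp_mul, add_mul, one_mul, Real.exp_add,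
    mul_comm κ]
  congr 2
  ring

end ThinReaction

/-! ### One-parameter families of radial maps and first-order expansions -/

namespace ThinReaction
open Filter Topology
open scoped ENNReal

/-- Smooth radial profiles: compactly supported, supported in `r < ρ`, constant near `0`. -/
structure IsRadialProfile (ρ : ℝ) (η : ℝ → ℝ) : Prop where
  smooth : ContDiff ℝ ∞ η
  compact : HasCompactSupport η
  const : ∃ r₀ > 0, ∀ r, |r| < r₀ → deriv η r = 0
  supp : ∃ r₁, 0 < r₁ ∧ r₁ < ρ ∧ ∀ r, r₁ ≤ r → η r = 0

namespace IsRadialProfile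
variable {ρ : ℝ} {η : ℝ → ℝ}

theorem contDiff_deriv (h : IsRadialProfile ρ η) : ContDiff ℝ ∞ (deriv η) :=
  h.smooth.deriv' 

theorem contDiff_mul_deriv (h : IsRadialProfile ρ η) : ContDiff ℝ ∞ fun r => r * deriv η r :=
  contDiff_id.mul h.contDiff_deriv

theorem hasCompactSupport_mul_deriv (h : IsRadialProfile ρ η) :
    HasCompactSupport fun r => r * deriv η r := h.compact.deriv.mul_left

theorem contDiff_deriv_div (h : IsRadialProfile ρ η) : ContDiff ℝ ∞ fun r => deriv η r / r := by
  obtain ⟨r₀, hr₀, hc⟩ := h.const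
  rw [contDiff_iff_contDiffAt]
  intro r
  rcases eq_or_ne r 0 with rfl | hr
  · have : (fun r => deriv η r / r) =ᶠ[𝓝 0] fun _ => 0 := by
      filter_upwards [ball_mem_nhds (0 : ℝ) hr₀] with r hr
      rw [hc r (by simpa using hr), zero_div]
    exact contDiffAt_const.congr_of_eventuallyEq this
  · exact h.contDiff_deriv.contDiffAt.div contDiffAt_id hr

theorem hasCompactSupport_deriv_div (h : IsRadialProfile ρ η) :
    HasCompactSupport fun r => deriv η r / r := by
  simp only [div_eq_mul_inv]
  exact h.compact.deriv.mul_right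

end IsRadialProfile

theorem exists_bound_of_hasCompactSupport {c : ℝ → ℝ} (hc : Continuous c)
    (hcc : HasCompactSupport c) : ∃ B, 0 ≤ B ∧ ∀ r, |c r| ≤ B := by
  obtain ⟨B, hB⟩ := hc.bounded_above_of_compact_support hcc
  exact ⟨B, (norm_nonneg _).trans (hB 0), hB⟩

theorem radialJacobian_const_mul (κ t : ℝ) (η : ℝ → ℝ) (r : ℝ) :
    radialJacobian κ (fun r => t * η r) r =
      Real.exp (t * ((κ + 1) * η r)) * (1 + t * (r * deriv η r)) := by
  rw [radialJacobian, deriv_const_mul_field]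
  ring_nf

theorem abs_exp_mul_one_add_sub_le {t a b B : ℝ} (ha : |a| ≤ B) (hb : |b| ≤ B)
    (htB : |t| * B ≤ 1) :
    |Real.exp (t * a) * (1 + t * b) - 1 - t * (a + b)| ≤ 3 * B ^ 2 * t ^ 2 := by
  have hB : 0 ≤ B := (abs_nonneg _).trans ha
  have hta : |t * a| ≤ 1 := by rw [abs_mul]; exact (by gcongr : |t| * |a| ≤ |t| * B).trans htB
  have hR := Real.abs_exp_sub_one_sub_id_le hta
  have htb : |t * b| ≤ 1 := by rw [abs_mul]; exact (by gcongr : |t| * |b| ≤ |t| * B).trans htB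
  have ha2 : a ^ 2 ≤ B ^ 2 := by rw [← sq_abs a]; gcongr
  have hab : |a * b| ≤ B ^ 2 := by rw [abs_mul, sq]; gcongr
  have e : Real.exp (t * a) * (1 + t * b) - 1 - t * (a + b) =
      (Real.exp (t * a) - 1 - t * a) * (1 + t * b) + t ^ 2 * (a * b) := by ring
  rw [e]
  have h1 : |(Real.exp (t * a) - 1 - t * a) * (1 + t * b)| ≤ (t * a) ^ 2 * 2 := by
    rw [abs_mul]
    gcongr
    have := abs_add_le 1 (t * b)
    rw [abs_one] at this
    linarith
  have h2 : |t ^ 2 * (a * b)| ≤ t ^ 2 * B ^ 2 := by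
    rw [abs_mul, abs_of_nonneg (sq_nonneg t)]
    gcongr
  have h3 : (t * a) ^ 2 ≤ t ^ 2 * B ^ 2 := by rw [mul_pow]; gcongr
  linarith [abs_add_le ((Real.exp (t * a) - 1 - t * a) * (1 + t * b)) (t ^ 2 * (a * b))]

/-- Smallness of the parameter of a family of radial maps `radialMap (t η)`, for the
exponent `κ`. -/
structure IsSmallParam (κ : ℝ) (η : ℝ → ℝ) (C t : ℝ) : Prop where
  pos : ∀ r, 0 < 1 + t * (r * deriv η r)
  half_le : ∀ r, 1 / 2 ≤ radialJacobian κ (fun r => t * η r) r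
  sub_one : ∀ r, |radialJacobian κ (fun r => t * η r) r - 1| ≤ C * |t|
  expand : ∀ r, |radialJacobian κ (fun r => t * η r) r - 1 -
    t * ((κ + 1) * η r + r * deriv η r)| ≤ C * t ^ 2
  abs_mul_le : ∀ r, |t * η r| ≤ 1 / 2

theorem exists_isSmallParam {ρ : ℝ} {η : ℝ → ℝ} (h : IsRadialProfile ρ η) (κ : ℝ) :
    ∃ t₀ C : ℝ, 0 < t₀ ∧ t₀ ≤ 1 ∧ 0 ≤ C ∧ ∀ t, |t| ≤ t₀ → IsSmallParam κ η C t := by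
  obtain ⟨B₁, hB₁, h1⟩ := exists_bound_of_hasCompactSupport h.smooth.continuous h.compact
  obtain ⟨B₂, hB₂, h2⟩ := exists_bound_of_hasCompactSupport h.contDiff_mul_deriv.continuous
    h.hasCompactSupport_mul_deriv
  set B := max (|κ + 1| * B₁) B₂ with hB
  have hB0 : 0 ≤ B := hB₂.trans (le_max_right _ _)
  have ha : ∀ r, |(κ + 1) * η r| ≤ B := fun r => by
    rw [abs_mul]
    exact (mul_le_mul_of_nonneg_left (h1 r) (abs_nonneg _)).trans (le_max_left _ _)
  have hb : ∀ r, |r * deriv η r| ≤ B := fun r => (h2 r).trans (le_max_right _ _)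
  set C := 3 * B ^ 2 + 2 * B with hC
  have hC0 : 0 ≤ C := by positivity
  -- With this choice `|t| B`, `|t| B₁` and `|t| C` are all at most `1/2`, which gives the
  -- positivity, the bound on `t η` and the lower bound on the Jacobian.
  set t₀ := (2 * (B + B₁ + C + 1))⁻¹ with ht₀
  have hpos : 0 < 2 * (B + B₁ + C + 1) := by positivity
  refine ⟨t₀, C, inv_pos.2 hpos, inv_le_one_of_one_le₀ (by linarith), hC0, fun t ht => ?_⟩
  have hm : |t| * (2 * (B + B₁ + C + 1)) ≤ 1 := by
    calc _ ≤ t₀ * (2 * (B + B₁ + C + 1)) := by gcongr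
      _ = 1 := inv_mul_cancel₀ hpos.ne'
  have ht0 := abs_nonneg t
  have ht1 : |t| ≤ 1 := by nlinarith
  have htB : |t| * B ≤ 1 / 2 := by nlinarith [mul_nonneg ht0 hB₁, mul_nonneg ht0 hC0]
  have htC : |t| * C ≤ 1 / 2 := by nlinarith [mul_nonneg ht0 hB₁, mul_nonneg ht0 hB0]
  have htB1 : |t| * B₁ ≤ 1 / 2 := by nlinarith [mul_nonneg ht0 hC0, mul_nonneg ht0 hB0]
  have hexp : ∀ r, |radialJacobian κ (fun r => t * η r) r - 1 -
      t * ((κ + 1) * η r + r * deriv η r)| ≤ 3 * B ^ 2 * t ^ 2 := fun r => by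
    rw [radialJacobian_const_mul]
    exact abs_exp_mul_one_add_sub_le (ha r) (hb r) (htB.trans (by norm_num))
  have htt : t ^ 2 ≤ |t| := by rw [← sq_abs, sq]; nlinarith
  have hsub : ∀ r, |radialJacobian κ (fun r => t * η r) r - 1| ≤ C * |t| := fun r => by
    have h3 := hexp r
    have h4 : |t * ((κ + 1) * η r + r * deriv η r)| ≤ |t| * (2 * B) := by
      rw [abs_mul]
      gcongr
      linarith [abs_add_le ((κ + 1) * η r) (r * deriv η r), ha r, hb r]
    have h5 := abs_add_le (radialJacobian κ (fun r => t * η r) r - 1 -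
      t * ((κ + 1) * η r + r * deriv η r)) (t * ((κ + 1) * η r + r * deriv η r))
    rw [sub_add_cancel] at h5
    have h6 : 3 * B ^ 2 * t ^ 2 ≤ 3 * B ^ 2 * |t| := by gcongr
    rw [hC]
    linarith
  refine ⟨fun r => ?_, fun r => ?_, hsub, fun r => ?_, fun r => ?_⟩
  · have : |t * (r * deriv η r)| ≤ 1 / 2 := by
      rw [abs_mul]; exact (by gcongr; exact hb r : |t| * |r * deriv η r| ≤ |t| * B).trans htB
    linarith [neg_abs_le (t * (r * deriv η r))]
  · linarith [hsub r, neg_abs_le (radialJacobian κ (fun r => t * η r) r - 1)]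
  · refine (hexp r).trans ?_
    gcongr
    linarith
  · rw [abs_mul]
    exact (by gcongr; exact h1 r : |t| * |η r| ≤ |t| * B₁).trans htB1

variable {d : ℕ} {μ σ : Measure (Space d)} {κ ρ C t : ℝ} {η : ℝ → ℝ}

theorem continuous_radialJacobian (h : IsRadialProfile ρ η) (κ t : ℝ) :
    Continuous (radialJacobian κ fun r => t * η r) := by
  have h1 := h.smooth.continuous
  have h2 := h.contDiff_mul_deriv.continuous
  simp only [funext (radialJacobian_const_mul κ t η)]
  fun_prop

theorem measurable_radialJacobian_norm (h : IsRadialProfile ρ η) (κ t : ℝ) :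
    Measurable fun x : Space d =>
      ENNReal.ofReal (radialJacobian κ (fun r => t * η r) ‖x‖) :=
  ((continuous_radialJacobian h κ t).comp continuous_norm).measurable.ennreal_ofReal

theorem map_radialMap (hμ : IsPolar μ σ κ) (h : IsRadialProfile ρ η) (ht : IsSmallParam κ η C t) :
    Measure.map (radialMap fun r => t * η r)
      (μ.withDensity fun x => ENNReal.ofReal (radialJacobian κ (fun r => t * η r) ‖x‖)) = μ := by
  have hΦ : Measurable (radialMap fun r => t * η r : Space d → Space d) :=
    (continuous_radialMap (continuous_const.mul h.smooth.continuous)).measurable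
  refine Measure.ext_of_lintegral _ fun f hf => ?_
  rw [lintegral_map hf hΦ, lintegral_withDensity_eq_lintegral_mul _
    (measurable_radialJacobian_norm h κ t)
    (g := fun x => f (radialMap (fun r => t * η r) x)) (hf.comp hΦ)]
  refine lintegral_comp_radialMap hμ (contDiff_const.mul (h.smooth.of_le (by simp)))
    h.compact.mul_left (fun r _ => ?_) hf
  rw [deriv_const_mul_field]
  convert ht.pos r using 2
  ring

theorem integral_radialJacobian_mul (hμ : IsPolar μ σ κ) (h : IsRadialProfile ρ η)
    (ht : IsSmallParam κ η C t) {f : Space d → ℝ} (hf : Measurable f) :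
    ∫ x, radialJacobian κ (fun r => t * η r) ‖x‖ * f (radialMap (fun r => t * η r) x) ∂μ =
      ∫ x, f x ∂μ := by
  have hΦ : Measurable (radialMap fun r => t * η r : Space d → Space d) :=
    (continuous_radialMap (continuous_const.mul h.smooth.continuous)).measurable
  conv_rhs => rw [← map_radialMap hμ h ht]
  rw [integral_map hΦ.aemeasurable hf.aestronglyMeasurable,
    integral_withDensity_eq_integral_toReal_smul
      (measurable_radialJacobian_norm h κ t) (by simp)]
  refine integral_congr_ae (ae_of_all _ fun x => ?_)
  simp only [smul_eq_mul]
  rw [ENNReal.toReal_ofReal (by linarith [ht.half_le ‖x‖])]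

/-- The Jacobian is at least `1/2`, so dropping it costs a factor two. -/
theorem lintegral_comp_radialMap_le (hμ : IsPolar μ σ κ) (h : IsRadialProfile ρ η)
    (ht : IsSmallParam κ η C t) {f : Space d → ℝ≥0∞} (hf : Measurable f) :
    ∫⁻ x, f (radialMap (fun r => t * η r) x) ∂μ ≤ 2 * ∫⁻ x, f x ∂μ := by
  have hΦ : Measurable (radialMap fun r => t * η r : Space d → Space d) :=
    (continuous_radialMap (continuous_const.mul h.smooth.continuous)).measurable
  conv_rhs => rw [← map_radialMap hμ h ht]
  rw [lintegral_map hf hΦ, lintegral_withDensity_eq_lintegral_mul _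
    (measurable_radialJacobian_norm h κ t)
    (g := fun x => f (radialMap (fun r => t * η r) x)) (hf.comp hΦ),
    ← lintegral_const_mul' _ _ (by norm_num)]
  refine lintegral_mono fun x => ?_
  rw [Pi.mul_apply, ← mul_assoc]
  have hJ : ∀ J : ℝ, 1 / 2 ≤ J → (1 : ℝ≥0∞) ≤ 2 * ENNReal.ofReal J := fun J hJ => by
    have h2 : (2 : ℝ≥0∞) = ENNReal.ofReal 2 := by norm_num
    rw [h2, ← ENNReal.ofReal_mul (by norm_num), ENNReal.one_le_ofReal]
    linarith
  have := hJ _ (ht.half_le ‖x‖)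
  simpa using mul_le_mul_left this (f (radialMap (fun r => t * η r) x))

theorem integrable_comp_radialMap (hμ : IsPolar μ σ κ) (h : IsRadialProfile ρ η)
    (ht : IsSmallParam κ η C t) {f : Space d → ℝ} (hf : Measurable f) (hfi : Integrable f μ) :
    Integrable (fun x => f (radialMap (fun r => t * η r) x)) μ := by
  have hΦ : Measurable (radialMap fun r => t * η r : Space d → Space d) :=
    (continuous_radialMap (continuous_const.mul h.smooth.continuous)).measurable
  refine ⟨(hf.comp hΦ).aestronglyMeasurable, ?_⟩
  refine (lintegral_comp_radialMap_le hμ h ht hf.enorm).trans_lt ?_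
  exact ENNReal.mul_lt_top (by norm_num) hfi.2

theorem eLpNorm_comp_radialMap_le {F : Type*} [NormedAddCommGroup F] [MeasurableSpace F]
    [BorelSpace F] (hμ : IsPolar μ σ κ)
    (h : IsRadialProfile ρ η) (ht : IsSmallParam κ η C t) {f : Space d → F} (hf : Measurable f) :
    eLpNorm (fun x => f (radialMap (fun r => t * η r) x)) 2 μ ≤ 2 * eLpNorm f 2 μ := by
  rw [eLpNorm_two_eq, eLpNorm_two_eq]
  calc _ ≤ (2 * ∫⁻ x, ‖f x‖ₑ ^ 2 ∂μ) ^ (1 / 2 : ℝ) :=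
        ENNReal.rpow_le_rpow
          (lintegral_comp_radialMap_le hμ h ht (hf.enorm.pow_const 2)) (by norm_num)
    _ ≤ (2 ^ (2 : ℝ) * ∫⁻ x, ‖f x‖ₑ ^ 2 ∂μ) ^ (1 / 2 : ℝ) := by
        refine ENNReal.rpow_le_rpow (mul_le_mul_left ?_ _) (by norm_num)
        norm_num
    _ = _ := by
        rw [ENNReal.mul_rpow_of_nonneg _ _ (by norm_num), ← ENNReal.rpow_mul]
        norm_num

/-- For a merely integrable `f` the difference `f ∘ Φ - f` has no rate. The change of variables
writes both integrals with the same factor `f ∘ Φ` and transfers the difference to the coefficients: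
`c` is Lipschitz and the Jacobian is `1 + O(t)`. -/
theorem abs_integral_comp_radialMap_sub_le (hμ : IsPolar μ σ κ) (h : IsRadialProfile ρ η)
    {t₀ : ℝ} (hC : 0 ≤ C) (ht : ∀ t, |t| ≤ t₀ → IsSmallParam κ η C t) {f : Space d → ℝ}
    (hf : Measurable f) (hfi : Integrable f μ) {c : ℝ → ℝ} (hc : ContDiff ℝ 1 c)
    (hcc : HasCompactSupport c) :
    ∃ K, ∀ t, |t| ≤ t₀ →
      |∫ x, c ‖x‖ * f (radialMap (fun r => t * η r) x) ∂μ - ∫ x, c ‖x‖ * f x ∂μ| ≤ K * |t| := by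
  obtain ⟨Lc, hLc⟩ := hc.lipschitzWith_of_hasCompactSupport hcc (by simp)
  obtain ⟨B, hB, hcB⟩ := exists_bound_of_hasCompactSupport hc.continuous hcc
  obtain ⟨D, hD, hηD⟩ := exists_bound_of_hasCompactSupport
    (c := fun r => r * η r) (continuous_id.mul h.smooth.continuous) h.compact.mul_left
  set A := Lc * (2 * D) + C * B with hA
  have hA0 : 0 ≤ A := by positivity
  refine ⟨A * (2 * ∫ x, |f x| ∂μ), fun t htt => ?_⟩
  have hs := ht t htt
  set Φ : Space d → Space d := radialMap fun r => t * η r with hΦdef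
  have hΦc : Continuous Φ := continuous_radialMap (continuous_const.mul h.smooth.continuous)
  set J := radialJacobian κ fun r => t * η r with hJ
  have hJc : Continuous J := continuous_radialJacobian h κ t
  have h1 : ∫ x, c ‖x‖ * f x ∂μ = ∫ x, J ‖x‖ * (c ‖Φ x‖ * f (Φ x)) ∂μ :=
    (integral_radialJacobian_mul hμ h hs
      ((hc.continuous.comp continuous_norm).measurable.mul hf)).symm
  have hfΦ : Integrable (fun x => f (Φ x)) μ := integrable_comp_radialMap hμ h hs hf hfi
  have hcoef : ∀ x : Space d, |c ‖x‖ - J ‖x‖ * c ‖Φ x‖| ≤ A * |t| := by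
    intro x
    -- The displacement `|Φ(x)| - |x|` is bounded by a multiple of `|t| · ||x| η(|x|)|`, which is
    -- uniform in `x` because `η` has compact support.
    have hn : ‖Φ x‖ = Real.exp (t * η ‖x‖) * ‖x‖ := by
      rw [hΦdef, radialMap, norm_smul, Real.norm_eq_abs, Real.abs_exp]
    have h2 : |c ‖x‖ - c ‖Φ x‖| ≤ Lc * (2 * D) * |t| := by
      have h3 := hLc.dist_le_mul ‖x‖ ‖Φ x‖
      rw [Real.dist_eq, Real.dist_eq] at h3
      refine h3.trans ?_
      rw [mul_assoc]
      gcongr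
      have h4 : ‖x‖ - ‖Φ x‖ = -((Real.exp (t * η ‖x‖) - 1) * ‖x‖) := by rw [hn]; ring
      rw [h4, abs_neg, abs_mul, abs_of_nonneg (norm_nonneg x)]
      have h5 := Real.abs_exp_sub_one_le ((hs.abs_mul_le ‖x‖).trans (by norm_num))
      calc _ ≤ 2 * |t * η ‖x‖| * ‖x‖ := by gcongr
        _ = 2 * (|t| * |‖x‖ * η ‖x‖|) := by
          rw [abs_mul, abs_mul, abs_of_nonneg (norm_nonneg x)]; ring
        _ ≤ 2 * (|t| * D) := by gcongr; exact hηD ‖x‖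
        _ = _ := by ring
    have h6 : |(1 - J ‖x‖) * c ‖Φ x‖| ≤ C * |t| * B := by
      rw [abs_mul, abs_sub_comm]
      exact mul_le_mul (hs.sub_one _) (hcB _) (abs_nonneg _) (by positivity)
    have e : c ‖x‖ - J ‖x‖ * c ‖Φ x‖ = (c ‖x‖ - c ‖Φ x‖) + (1 - J ‖x‖) * c ‖Φ x‖ := by ring
    rw [e, hA]
    calc _ ≤ _ := abs_add_le _ _
      _ ≤ _ := add_le_add h2 h6
      _ = _ := by ring
  have hi1 : Integrable (fun x => c ‖x‖ * f (Φ x)) μ :=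
    hfΦ.bdd_mul (c := B) (hc.continuous.comp continuous_norm).aestronglyMeasurable
      (ae_of_all _ fun x => hcB _)
  have hi3 : Integrable (fun x => (c ‖x‖ - J ‖x‖ * c ‖Φ x‖) * f (Φ x)) μ := by
    refine hfΦ.bdd_mul (c := A * |t|) (Continuous.aestronglyMeasurable ?_)
      (ae_of_all _ fun x => hcoef x)
    exact (hc.continuous.comp continuous_norm).sub ((hJc.comp continuous_norm).mul
      (hc.continuous.comp (continuous_norm.comp hΦc)))
  have hi2 : Integrable (fun x => J ‖x‖ * (c ‖Φ x‖ * f (Φ x))) μ :=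
    (hi1.sub hi3).congr (ae_of_all _ fun x => by simp only [Pi.sub_apply]; ring)
  rw [h1, ← integral_sub hi1 hi2]
  calc |∫ x, (c ‖x‖ * f (Φ x) - J ‖x‖ * (c ‖Φ x‖ * f (Φ x))) ∂μ|
      ≤ ∫ x, |c ‖x‖ * f (Φ x) - J ‖x‖ * (c ‖Φ x‖ * f (Φ x))| ∂μ := abs_integral_le_integral_abs
    _ ≤ ∫ x, A * |t| * |f (Φ x)| ∂μ := by
        refine integral_mono (hi1.sub hi2).abs (hfΦ.abs.const_mul _) fun x => ?_
        have e : c ‖x‖ * f (Φ x) - J ‖x‖ * (c ‖Φ x‖ * f (Φ x)) =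
          (c ‖x‖ - J ‖x‖ * c ‖Φ x‖) * f (Φ x) := by ring
        simp only [e, abs_mul]
        exact mul_le_mul_of_nonneg_right (hcoef x) (abs_nonneg _)
    _ = A * |t| * ∫ x, |f (Φ x)| ∂μ := integral_const_mul _ _
    _ ≤ A * |t| * (2 * ∫ x, |f x| ∂μ) := by
        gcongr
        rw [← integral_radialJacobian_mul hμ h hs hf.abs, ← integral_const_mul]
        have hJi : Integrable (fun x => J ‖x‖ * |f (Φ x)|) μ := by
          refine hfΦ.abs.bdd_mul (c := 1 + C * |t|) (hJc.comp continuous_norm).aestronglyMeasurable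
            (ae_of_all _ fun x => ?_)
          have h2 := hs.sub_one ‖x‖
          have h3 := abs_add_le (J ‖x‖ - 1) 1
          rw [sub_add_cancel, abs_one] at h3
          rw [Real.norm_eq_abs]
          linarith
        refine integral_mono hfΦ.abs (hJi.const_mul 2) fun x => ?_
        have h2 := mul_le_mul_of_nonneg_right (hs.half_le ‖x‖) (abs_nonneg (f (Φ x)))
        simp only
        change |f (Φ x)| ≤ 2 * (J ‖x‖ * |f (Φ x)|)
        linarith
    _ = _ := by ring

/-- First-order expansion in `t` of integrals along a family of radial maps. -/
theorem abs_integral_comp_radialMap_sub_mul_le (hμ : IsPolar μ σ κ) (h : IsRadialProfile ρ η)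
    {t₀ : ℝ} (hC : 0 ≤ C) (ht : ∀ t, |t| ≤ t₀ → IsSmallParam κ η C t) {f : Space d → ℝ}
    (hf : Measurable f) (hfi : Integrable f μ) {c : ℝ → ℝ} (hc : ContDiff ℝ 1 c)
    (hcc : HasCompactSupport c) {p : ℝ → ℝ → ℝ} (hp : ∀ t, Continuous (p t)) {D : ℝ}
    (hpc : ∀ t, |t| ≤ t₀ → ∀ r, |p t r - t * c r| ≤ D * t ^ 2) :
    ∃ K, ∀ t, |t| ≤ t₀ →
      |∫ x, p t ‖x‖ * f (radialMap (fun r => t * η r) x) ∂μ - t * ∫ x, c ‖x‖ * f x ∂μ|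
        ≤ K * t ^ 2 := by
  obtain ⟨K, hK⟩ := abs_integral_comp_radialMap_sub_le hμ h hC ht hf hfi hc hcc
  obtain ⟨B, hB, hcB⟩ := exists_bound_of_hasCompactSupport hc.continuous hcc
  refine ⟨D * (2 * ∫⁻ x, ‖f x‖ₑ ∂μ).toReal + K, fun t htt => ?_⟩
  have hs := ht t htt
  set Φ : Space d → Space d := radialMap fun r => t * η r with hΦdef
  have hfΦ : Integrable (fun x => f (Φ x)) μ := integrable_comp_radialMap hμ h hs hf hfi
  have hi1 : Integrable (fun x => c ‖x‖ * f (Φ x)) μ :=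
    hfΦ.bdd_mul (c := B) (hc.continuous.comp continuous_norm).aestronglyMeasurable
      (ae_of_all _ fun x => hcB _)
  have hi2 : Integrable (fun x => (p t ‖x‖ - t * c ‖x‖) * f (Φ x)) μ := by
    refine hfΦ.bdd_mul (c := D * t ^ 2) (Continuous.aestronglyMeasurable ?_)
      (ae_of_all _ fun x => hpc t htt _)
    have := hp t
    have := hc.continuous
    fun_prop
  -- The coefficient is split into its linear part `t c` and a quadratic remainder. Replacing `f ∘
  -- Φ` by `f` in the linear part makes an error `O(t)`, which the prefactor `t` turns into `O(t²)`.
  have e : ∫ x, p t ‖x‖ * f (Φ x) ∂μ =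
      ∫ x, (p t ‖x‖ - t * c ‖x‖) * f (Φ x) ∂μ + t * ∫ x, c ‖x‖ * f (Φ x) ∂μ := by
    rw [← integral_const_mul, ← integral_add hi2 (hi1.const_mul t)]
    refine integral_congr_ae (ae_of_all _ fun x => ?_)
    simp only
    ring
  have h1 : |∫ x, (p t ‖x‖ - t * c ‖x‖) * f (Φ x) ∂μ| ≤
      D * t ^ 2 * (2 * ∫⁻ x, ‖f x‖ₑ ∂μ).toReal := by
    have hD : 0 ≤ D * t ^ 2 := (abs_nonneg _).trans (hpc t htt 0)
    calc _ ≤ ∫ x, |(p t ‖x‖ - t * c ‖x‖) * f (Φ x)| ∂μ := abs_integral_le_integral_abs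
      _ ≤ ∫ x, D * t ^ 2 * |f (Φ x)| ∂μ := by
          refine integral_mono hi2.abs (hfΦ.abs.const_mul _) fun x => ?_
          simp only [abs_mul]
          exact mul_le_mul_of_nonneg_right (by simpa using hpc t htt ‖x‖) (abs_nonneg _)
      _ = D * t ^ 2 * ∫ x, |f (Φ x)| ∂μ := integral_const_mul _ _
      _ ≤ _ := by
          gcongr
          have h2 : ∫ x, |f (Φ x)| ∂μ = (∫⁻ x, ‖f (Φ x)‖ₑ ∂μ).toReal :=
            integral_norm_eq_lintegral_enorm hfΦ.aestronglyMeasurable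
          rw [h2]
          refine ENNReal.toReal_mono ?_ (lintegral_comp_radialMap_le hμ h hs hf.enorm)
          exact ENNReal.mul_ne_top (by norm_num) hfi.2.ne
  have h2 := hK t htt
  rw [e]
  calc _ = |∫ x, (p t ‖x‖ - t * c ‖x‖) * f (Φ x) ∂μ +
        t * (∫ x, c ‖x‖ * f (Φ x) ∂μ - ∫ x, c ‖x‖ * f x ∂μ)| := by congr 1; ring
    _ ≤ _ := abs_add_le _ _
    _ ≤ D * t ^ 2 * (2 * ∫⁻ x, ‖f x‖ₑ ∂μ).toReal + |t| * (K * |t|) := by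
        rw [abs_mul t]
        gcongr
    _ = _ := by
        have := sq_abs t
        linear_combination K * this

end ThinReaction

/-! ### Action of radial maps on functions and gradients -/

namespace ThinReaction
open Filter Topology
open scoped ENNReal

variable {d : ℕ} {μ σ : Measure (Space d)} {κ ρ C t : ℝ} {η : ℝ → ℝ}

namespace IsRadialProfile

theorem exists_eq_const (h : IsRadialProfile ρ η) : ∃ r₀ > 0, ∀ r, |r| < r₀ → η r = η 0 := by
  obtain ⟨r₀, hr₀, hc⟩ := h.const
  refine ⟨r₀, hr₀, fun r hr => ?_⟩
  have := Convex.norm_image_sub_le_of_norm_deriv_le (f := η) (s := ball (0 : ℝ) r₀) (C := 0)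
    (fun x _ => h.smooth.differentiable (by simp) x)
    (fun x hx => by rw [hc x (by simpa using hx), norm_zero]) (convex_ball 0 r₀)
    (mem_ball_self hr₀) (show r ∈ ball (0 : ℝ) r₀ by simpa using hr)
  rw [zero_mul, norm_le_zero_iff, sub_eq_zero] at this
  exact this

theorem contDiff_comp_norm (h : IsRadialProfile ρ η) : ContDiff ℝ ∞ fun x : Space d => η ‖x‖ := by
  obtain ⟨r₀, hr₀, hc⟩ := h.exists_eq_const
  rw [contDiff_iff_contDiffAt]
  intro x
  rcases eq_or_ne x 0 with rfl | hx
  · have : (fun x : Space d => η ‖x‖) =ᶠ[𝓝 0] fun _ => η 0 := by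
      filter_upwards [ball_mem_nhds (0 : Space d) hr₀] with x hx
      exact hc _ (by simpa using hx)
    exact contDiffAt_const.congr_of_eventuallyEq this
  · exact h.smooth.contDiffAt.comp x (contDiffAt_norm ℝ hx)

theorem hasFDerivAt_comp_norm (h : IsRadialProfile ρ η) (x : Space d) :
    HasFDerivAt (fun x : Space d => η ‖x‖) ((deriv η ‖x‖ / ‖x‖) • innerSL ℝ x) x := by
  rcases eq_or_ne x 0 with rfl | hx
  · obtain ⟨r₀, hr₀, hc⟩ := h.exists_eq_const
    have : (fun x : Space d => η ‖x‖) =ᶠ[𝓝 0] fun _ => η 0 := by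
      filter_upwards [ball_mem_nhds (0 : Space d) hr₀] with x hx
      exact hc _ (by simpa using hx)
    simpa using (hasFDerivAt_const (η 0) (0 : Space d)).congr_of_eventuallyEq this
  · have hn : ‖x‖ ≠ 0 := norm_ne_zero_iff.2 hx
    have h1 : HasFDerivAt (fun x : Space d => ‖x‖) (‖x‖⁻¹ • innerSL ℝ x) x := by
      have h2 := (hasStrictFDerivAt_norm_sq x).hasFDerivAt.sqrt (pow_ne_zero 2 hn)
      have e : (fun y : Space d => √(‖y‖ ^ 2)) = fun y => ‖y‖ :=
        funext fun y => Real.sqrt_sq (norm_nonneg y)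
      rw [e, Real.sqrt_sq (norm_nonneg x)] at h2
      refine h2.congr_fderiv ?_
      ext e
      simp
      field_simp
    have h3 := (h.smooth.differentiable (by simp) ‖x‖).hasDerivAt.comp_hasFDerivAt x h1
    refine h3.congr_fderiv ?_
    rw [smul_smul, div_eq_mul_inv]

end IsRadialProfile

/-- The action of the differential of `radialMap (t η)` on gradients. -/
def pullGrad (η : ℝ → ℝ) (t : ℝ) (F : Space d → Space d) (x : Space d) : Space d :=
  Real.exp (t * η ‖x‖) • (F (radialMap (fun r => t * η r) x) +
    (t * (deriv η ‖x‖ / ‖x‖) * inner ℝ x (F (radialMap (fun r => t * η r) x))) • x)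

theorem hasFDerivAt_radialMap (h : IsRadialProfile ρ η) (t : ℝ) (x : Space d) :
    HasFDerivAt (radialMap fun r => t * η r)
      (Real.exp (t * η ‖x‖) • ContinuousLinearMap.id ℝ (Space d) +
        (Real.exp (t * η ‖x‖) • (t • ((deriv η ‖x‖ / ‖x‖) • innerSL ℝ x))).smulRight x) x :=
  ((h.hasFDerivAt_comp_norm x).const_mul t).exp.smul (hasFDerivAt_id x)

theorem contDiff_radialMap (h : IsRadialProfile ρ η) (t : ℝ) :
    ContDiff ℝ ∞ (radialMap (fun r => t * η r) : Space d → Space d) :=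
  (contDiff_const.mul h.contDiff_comp_norm).exp.smul contDiff_id

/-- The differential of the map is `exp(tη) (I + t (η'/|x|) x ⊗ x)`. It is symmetric, so no
transpose appears when it acts on gradients. -/
theorem gradient_comp_radialMap (h : IsRadialProfile ρ η) (t : ℝ) {v : Space d → ℝ}
    (hv : ContDiff ℝ 1 v) :
    gradient (fun x => v (radialMap (fun r => t * η r) x)) = pullGrad η t (gradient v) := by
  ext1 x
  refine ext_inner_right ℝ fun e => ?_
  have h1 := ((hv.differentiable (by simp) _).hasFDerivAt).comp x (hasFDerivAt_radialMap h t x)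
  rw [inner_gradient_left]
  change fderiv ℝ (v ∘ radialMap fun r => t * η r) x e = _
  rw [h1.fderiv]
  simp only [pullGrad, inner_smul_left, inner_add_left, ContinuousLinearMap.comp_apply,
    add_apply, smul_apply,
    ContinuousLinearMap.smulRight_apply, ContinuousLinearMap.id_apply, innerSL_apply_apply, map_add,
    map_smul, smul_eq_mul]
  simp only [← inner_gradient_left, real_inner_comm x, RCLike.conj_to_real]
  ring

theorem pullGrad_sub (η : ℝ → ℝ) (t : ℝ) (F F' : Space d → Space d) :
    pullGrad η t (F - F') = pullGrad η t F - pullGrad η t F' := by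
  ext1 x
  simp only [pullGrad, Pi.sub_apply, inner_sub_right, mul_sub, sub_smul, smul_add, smul_sub]
  abel

/-- Writing the radial component through the pairing of `F` with the position, both taken at the
image point, absorbs the factor `exp(2tη)` of the second term. Each term is then a radial
coefficient times a fixed function composed with the radial map, as the expansion lemmas require. -/
theorem norm_pullGrad_sq (η : ℝ → ℝ) (t : ℝ) (F : Space d → Space d) (x : Space d) :
    ‖pullGrad η t F x‖ ^ 2 =
      Real.exp (2 * (t * η ‖x‖)) * ‖F (radialMap (fun r => t * η r) x)‖ ^ 2 +
      (2 * t * (deriv η ‖x‖ / ‖x‖) + t ^ 2 * ((deriv η ‖x‖ / ‖x‖) * (‖x‖ * (‖x‖ * (deriv η ‖x‖ / ‖x‖))))) *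
        inner ℝ (F (radialMap (fun r => t * η r) x)) (radialMap (fun r => t * η r) x) ^ 2 := by
  set g := F (radialMap (fun r => t * η r) x)
  have e : inner ℝ g (radialMap (fun r => t * η r) x) = Real.exp (t * η ‖x‖) * inner ℝ x g := by
    rw [radialMap, inner_smul_right, real_inner_comm]
  rw [e, pullGrad, norm_smul, mul_pow, norm_add_sq_real, norm_smul, inner_smul_right,
    real_inner_comm, Real.norm_eq_abs, Real.norm_eq_abs, sq_abs, mul_pow, sq_abs,
    two_mul (t * η ‖x‖), Real.exp_add]
  simp only [g]
  ring

theorem norm_radialMap (m : ℝ → ℝ) (x : Space d) : ‖radialMap m x‖ = Real.exp (m ‖x‖) * ‖x‖ := by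
  rw [radialMap, norm_smul, Real.norm_eq_abs, Real.abs_exp]

theorem exists_norm_pullGrad_le (h : IsRadialProfile ρ η) :
    ∃ B : ℝ, 0 ≤ B ∧ ∀ t, |t| ≤ 1 → (∀ r, |t * η r| ≤ 1 / 2) → ∀ (F : Space d → Space d) x,
      ‖pullGrad η t F x‖ ≤ B * ‖F (radialMap (fun r => t * η r) x)‖ := by
  obtain ⟨B, hB, hb⟩ := exists_bound_of_hasCompactSupport h.contDiff_mul_deriv.continuous
    h.hasCompactSupport_mul_deriv
  refine ⟨Real.exp 1 * (1 + B), by positivity, fun t ht htη F x => ?_⟩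
  set g := F (radialMap (fun r => t * η r) x)
  rw [pullGrad, norm_smul, Real.norm_eq_abs, Real.abs_exp, mul_assoc (Real.exp 1)]
  have h1 : Real.exp (t * η ‖x‖) ≤ Real.exp 1 :=
    Real.exp_le_exp.2 (by linarith [le_abs_self (t * η ‖x‖), htη ‖x‖])
  refine mul_le_mul h1 ?_ (norm_nonneg _) (Real.exp_pos _).le
  rw [add_mul, one_mul]
  refine (norm_add_le _ _).trans (add_le_add_right ?_ _)
  rw [norm_smul, norm_mul, norm_mul, Real.norm_eq_abs, Real.norm_eq_abs]
  have h2 : ‖(inner ℝ x g : ℝ)‖ ≤ ‖x‖ * ‖g‖ := norm_inner_le_norm x g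
  have h3 : |deriv η ‖x‖ / ‖x‖| * (‖x‖ * ‖x‖) ≤ B := by
    rcases eq_or_ne ‖x‖ 0 with h0 | h0
    · simp [h0, hB]
    · refine le_trans (le_of_eq ?_) (hb ‖x‖)
      rw [abs_div, abs_mul, abs_of_nonneg (norm_nonneg x)]
      field_simp
  calc |t| * |deriv η ‖x‖ / ‖x‖| * ‖(inner ℝ x g : ℝ)‖ * ‖x‖
      ≤ 1 * |deriv η ‖x‖ / ‖x‖| * (‖x‖ * ‖g‖) * ‖x‖ := by gcongr
    _ = |deriv η ‖x‖ / ‖x‖| * (‖x‖ * ‖x‖) * ‖g‖ := by ring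
    _ ≤ B * ‖g‖ := by gcongr

theorem measurable_pullGrad (h : IsRadialProfile ρ η) (t : ℝ) {F : Space d → Space d}
    (hF : Measurable F) : Measurable (pullGrad η t F) := by
  have h1 := h.smooth.continuous.measurable
  have h2 := h.contDiff_deriv_div.continuous.measurable.comp (measurable_norm (α := Space d))
  have h3 : Measurable fun x : Space d => F (radialMap (fun r => t * η r) x) :=
    hF.comp (contDiff_radialMap h t).continuous.measurable
  have h4 : Measurable fun x : Space d => Real.exp (t * η ‖x‖) :=
    ((h1.comp measurable_norm).const_mul t).exp
  exact h4.smul (h3.add (((h2.const_mul t).mul (measurable_id.inner h3)).smul measurable_id))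

/-- Where the profile vanishes the map is the identity, so the variation is compactly supported in
the ball and admissible in the weak equation. -/
theorem isTest_comp_radialMap_sub (h : IsRadialProfile ρ η) (t : ℝ) {v : Space d → ℝ}
    (hv : ContDiff ℝ ∞ v) :
    IsTest (ball 0 ρ) (fun x => v (radialMap (fun r => t * η r) x) - v x) := by
  obtain ⟨r₁, h0, h1, h2⟩ := h.supp
  have hsub : tsupport (fun x => v (radialMap (fun r => t * η r) x) - v x) ⊆ closedBall 0 r₁ := by
    refine closure_minimal (fun x hx => ?_) isClosed_closedBall
    by_contra hxr
    apply hx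
    have : r₁ ≤ ‖x‖ := by simp at hxr; exact hxr.le
    simp [radialMap, h2 _ this]
  exact ⟨(hv.comp (contDiff_radialMap h t)).sub hv,
    (isCompact_closedBall 0 r₁).of_isClosed_subset (isClosed_tsupport _) hsub,
    hsub.trans (closedBall_subset_ball h1)⟩

/-- The identity is joined to the map by the family with parameters `τ t`, `0 ≤ τ ≤ 1`. The
derivative of `v` along this path is `t η` times the pairing of the gradient with the position, and
the Jacobian bound for the intermediate maps returns the integral to `|∇v|²`. Thus one derivative in
`L²` makes the variation of size `t` in `L²`. -/
theorem exists_lintegral_comp_radialMap_sub_le (hμ : IsPolar μ σ κ) (h : IsRadialProfile ρ η)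
    {t₀ : ℝ} (ht : ∀ t, |t| ≤ t₀ → IsSmallParam κ η C t) :
    ∃ D : ℝ, ∀ t, |t| ≤ t₀ → ∀ v : Space d → ℝ, ContDiff ℝ 1 v →
      ∫⁻ x, ‖v (radialMap (fun r => t * η r) x) - v x‖ₑ ^ 2 ∂μ ≤
        ENNReal.ofReal (D * t ^ 2) * ∫⁻ x, ‖gradient v x‖ₑ ^ 2 ∂μ := by
  obtain ⟨B, hB, hb⟩ := exists_bound_of_hasCompactSupport
    (c := fun r => r * η r) (continuous_id.mul h.smooth.continuous) h.compact.mul_left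
  have := hμ.finite
  have hμs : SFinite μ := by rw [← hμ.measurePreserving.map_eq]; infer_instance
  refine ⟨(Real.exp 1 * B) ^ 2 * 2, fun t htt v hv => ?_⟩
  have hs := ht t htt
  set Φ : ℝ → Space d → Space d := fun τ => radialMap fun r => (τ * t) * η r with hΦ
  have hΦ1 : Φ 1 = radialMap fun r => t * η r := by simp [hΦ]
  have hΦ0 : ∀ x, Φ 0 x = x := by simp [hΦ, radialMap]
  have hgm := continuous_gradient hv
  have hΦc : Continuous fun p : Space d × ℝ => Φ p.2 p.1 := by
    have := h.smooth.continuous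
    simp only [hΦ, radialMap]
    fun_prop
  set A : ℝ≥0∞ := ENNReal.ofReal ((Real.exp 1 * B) ^ 2 * t ^ 2) with hA
  have hpt : ∀ x, ‖v (Φ 1 x) - v x‖ₑ ^ 2 ≤
      A * ∫⁻ τ in Ioc (0 : ℝ) 1, ‖gradient v (Φ τ x)‖ₑ ^ 2 := by
    intro x
    have hd : ∀ τ : ℝ, HasDerivAt (fun τ => v (Φ τ x))
        (t * η ‖x‖ * inner ℝ (gradient v (Φ τ x)) (Φ τ x)) τ := by
      intro τ
      have h1 : HasDerivAt (fun τ => Φ τ x) ((t * η ‖x‖) • Φ τ x) τ := by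
        have h2 : HasDerivAt (fun τ : ℝ => τ * t * η ‖x‖) (t * η ‖x‖) τ := by
          simpa [mul_assoc] using (hasDerivAt_id τ).mul_const (t * η ‖x‖)
        have h3 := h2.exp.smul_const x
        refine h3.congr_deriv ?_
        simp only [hΦ, radialMap, smul_smul]
        rw [mul_comm]
      have h4 := (hv.differentiable (by simp) (Φ τ x)).hasFDerivAt.comp_hasDerivAt τ h1
      refine h4.congr_deriv ?_
      rw [map_smul, inner_gradient_left, smul_eq_mul]
    have hdc : Continuous fun τ : ℝ => t * η ‖x‖ * inner ℝ (gradient v (Φ τ x)) (Φ τ x) := by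
      have h5 : Continuous fun τ : ℝ => Φ τ x :=
        hΦc.comp (continuous_const.prodMk continuous_id)
      exact continuous_const.mul ((hgm.comp h5).inner h5)
    have hftc := intervalIntegral.integral_eq_sub_of_hasDerivAt (a := 0) (b := 1)
      (fun τ _ => hd τ) (hdc.intervalIntegrable _ _)
    rw [hΦ0] at hftc
    have h6 : ∀ τ ∈ Ioc (0 : ℝ) 1, ‖t * η ‖x‖ * inner ℝ (gradient v (Φ τ x)) (Φ τ x)‖ₑ ≤
        ENNReal.ofReal (Real.exp 1 * B * |t|) * ‖gradient v (Φ τ x)‖ₑ := by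
      intro τ hτ
      rw [← ofReal_norm, ← ofReal_norm, ← ENNReal.ofReal_mul (by positivity)]
      refine ENNReal.ofReal_le_ofReal ?_
      rw [norm_mul, norm_mul]
      have h7 := norm_inner_le_norm (𝕜 := ℝ) (gradient v (Φ τ x)) (Φ τ x)
      have h8 : ‖Φ τ x‖ ≤ Real.exp 1 * ‖x‖ := by
        rw [hΦ, norm_radialMap]
        gcongr
        have h9 : |τ * t * η ‖x‖| ≤ 1 := by
          rw [mul_assoc, abs_mul, abs_of_pos hτ.1]
          calc τ * |t * η ‖x‖| ≤ 1 * (1 / 2) := by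
                gcongr
                exacts [hτ.2, hs.abs_mul_le _]
            _ ≤ 1 := by norm_num
        exact (le_abs_self _).trans h9
      calc ‖t‖ * ‖η ‖x‖‖ * ‖(inner ℝ (gradient v (Φ τ x)) (Φ τ x) : ℝ)‖
          ≤ ‖t‖ * ‖η ‖x‖‖ * (‖gradient v (Φ τ x)‖ * (Real.exp 1 * ‖x‖)) := by
            gcongr
            exact h7.trans (by gcongr)
        _ = Real.exp 1 * |‖x‖ * η ‖x‖| * |t| * ‖gradient v (Φ τ x)‖ := by
            rw [abs_mul, abs_of_nonneg (norm_nonneg x), Real.norm_eq_abs, Real.norm_eq_abs]; ring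
        _ ≤ _ := by gcongr; exact hb ‖x‖
    have hgτ : Continuous fun τ : ℝ => gradient v (Φ τ x) :=
      hgm.comp (hΦc.comp (continuous_const.prodMk continuous_id))
    have h10 : ‖v (Φ 1 x) - v x‖ₑ ≤ ENNReal.ofReal (Real.exp 1 * B * |t|) *
        ∫⁻ τ in Ioc (0 : ℝ) 1, ‖gradient v (Φ τ x)‖ₑ := by
      rw [← hftc, intervalIntegral.integral_of_le zero_le_one,
        ← lintegral_const_mul _ hgτ.enorm.measurable]
      exact (enorm_integral_le_lintegral_enorm _).trans (setLIntegral_mono' measurableSet_Ioc h6)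
    have h11 := sq_lintegral_le_of_mul_eq_one (ν := volume.restrict (Ioc (0 : ℝ) 1))
      hgτ.enorm.measurable.aemeasurable (W := fun _ => 1) (V := fun _ => 1)
      aemeasurable_const aemeasurable_const (ae_of_all _ fun _ => by simp)
    simp only [one_mul, lintegral_const, Measure.restrict_apply_univ, Real.volume_Ioc, sub_zero,
      ENNReal.ofReal_one, mul_one] at h11
    calc _ ≤ _ := pow_le_pow_left' h10 2
      _ ≤ _ := by
        rw [mul_pow, ← ENNReal.ofReal_pow (by positivity), mul_pow _ |t|, sq_abs]
        exact mul_le_mul_right h11 _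
  rw [← hΦ1]
  have hjm : Measurable fun p : Space d × ℝ => ‖gradient v (Φ p.2 p.1)‖ₑ ^ 2 :=
    ((hgm.comp hΦc).enorm.measurable).pow_const 2
  calc ∫⁻ x, ‖v (Φ 1 x) - v x‖ₑ ^ 2 ∂μ
      ≤ ∫⁻ x, A * (∫⁻ τ in Ioc (0 : ℝ) 1, ‖gradient v (Φ τ x)‖ₑ ^ 2) ∂μ := lintegral_mono hpt
    _ = A * ∫⁻ x, (∫⁻ τ in Ioc (0 : ℝ) 1, ‖gradient v (Φ τ x)‖ₑ ^ 2) ∂μ :=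
        lintegral_const_mul _ hjm.lintegral_prod_right'
    _ = A * ∫⁻ τ in Ioc (0 : ℝ) 1, (∫⁻ x, ‖gradient v (Φ τ x)‖ₑ ^ 2 ∂μ) := by
        rw [lintegral_lintegral_swap hjm.aemeasurable]
    _ ≤ A * ∫⁻ τ in Ioc (0 : ℝ) 1, 2 * ∫⁻ x, ‖gradient v x‖ₑ ^ 2 ∂μ := by
        refine mul_le_mul_right ?_ _
        refine setLIntegral_mono' measurableSet_Ioc fun τ hτ => ?_
        refine lintegral_comp_radialMap_le hμ h (ht (τ * t) ?_)
          (f := fun x => ‖gradient v x‖ₑ ^ 2) (hgm.enorm.measurable.pow_const 2)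
        rw [abs_mul, abs_of_pos hτ.1]
        exact (mul_le_of_le_one_left (abs_nonneg t) hτ.2).trans htt
    _ = _ := by
        rw [lintegral_const, Measure.restrict_apply_univ, Real.volume_Ioc, sub_zero,
          ENNReal.ofReal_one, mul_one, ← mul_assoc, hA]
        congr 1
        have h2 : (2 : ℝ≥0∞) = ENNReal.ofReal 2 := by norm_num
        rw [h2, ← ENNReal.ofReal_mul (by positivity)]
        congr 1
        ring

end ThinReaction

/-! ### Almost-minimality of weak solutions under radial reparametrization -/

namespace ThinReaction
open Filter Topology
open scoped ENNReal

theorem tendsto_integral_inner {α E : Type*} [MeasurableSpace α] [NormedAddCommGroup E]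
    [InnerProductSpace ℝ E] {μ : Measure α} {f g : α → E} {f' g' : ℕ → α → E}
    (hf : MemLp f 2 μ) (hg : MemLp g 2 μ) (hf' : ∀ k, MemLp (f' k) 2 μ)
    (hg' : ∀ k, MemLp (g' k) 2 μ)
    (h1 : Tendsto (fun k => eLpNorm (f' k - f) 2 μ) atTop (𝓝 0))
    (h2 : Tendsto (fun k => eLpNorm (g' k - g) 2 μ) atTop (𝓝 0)) :
    Tendsto (fun k => ∫ x, inner ℝ (f' k x) (g' k x) ∂μ) atTop (𝓝 (∫ x, inner ℝ (f x) (g x) ∂μ)) := by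
  have e : ∀ (a b : α → E) (ha : MemLp a 2 μ) (hb : MemLp b 2 μ),
      ∫ x, inner ℝ (a x) (b x) ∂μ = inner ℝ (ha.toLp a) (hb.toLp b) := by
    intro a b ha hb
    rw [L2.inner_def]
    refine integral_congr_ae ?_
    filter_upwards [ha.coeFn_toLp, hb.coeFn_toLp] with x hx hy
    rw [hx, hy]
  rw [e f g hf hg]
  simp_rw [fun k => e _ _ (hf' k) (hg' k)]
  exact ((Lp.tendsto_Lp_iff_tendsto_eLpNorm'' _ hf' _ hf).2 h1).inner
    ((Lp.tendsto_Lp_iff_tendsto_eLpNorm'' _ hg' _ hg).2 h2)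

theorem tendsto_integral_mul {α : Type*} [MeasurableSpace α] {μ : Measure α} {f g : α → ℝ}
    {f' g' : ℕ → α → ℝ} (hf : MemLp f 2 μ) (hg : MemLp g 2 μ) (hf' : ∀ k, MemLp (f' k) 2 μ)
    (hg' : ∀ k, MemLp (g' k) 2 μ)
    (h1 : Tendsto (fun k => eLpNorm (f' k - f) 2 μ) atTop (𝓝 0))
    (h2 : Tendsto (fun k => eLpNorm (g' k - g) 2 μ) atTop (𝓝 0)) :
    Tendsto (fun k => ∫ x, f' k x * g' k x ∂μ) atTop (𝓝 (∫ x, f x * g x ∂μ)) := by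
  simpa only [real_inner_eq_re_inner, RCLike.inner_apply, conj_trivial, RCLike.re_to_real,
    mul_comm] using tendsto_integral_inner hf hg hf' hg' h1 h2

theorem tendsto_integral_norm_sq {α E : Type*} [MeasurableSpace α] [NormedAddCommGroup E]
    [InnerProductSpace ℝ E] {μ : Measure α} {f : α → E} {f' : ℕ → α → E}
    (hf : MemLp f 2 μ) (hf' : ∀ k, MemLp (f' k) 2 μ)
    (h1 : Tendsto (fun k => eLpNorm (f' k - f) 2 μ) atTop (𝓝 0)) :
    Tendsto (fun k => ∫ x, ‖f' k x‖ ^ 2 ∂μ) atTop (𝓝 (∫ x, ‖f x‖ ^ 2 ∂μ)) := by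
  simpa only [real_inner_self_eq_norm_sq] using tendsto_integral_inner hf hf hf' hf' h1 h1

theorem integral_norm_sq_eq_toReal {α E : Type*} [MeasurableSpace α] [NormedAddCommGroup E]
    {μ : Measure α} {f : α → E} (hf : AEStronglyMeasurable f μ) :
    ∫ x, ‖f x‖ ^ 2 ∂μ = (∫⁻ x, ‖f x‖ₑ ^ 2 ∂μ).toReal := by
  rw [integral_eq_lintegral_of_nonneg_ae (ae_of_all _ fun x => sq_nonneg _) (hf.norm.pow 2)]
  congr 1
  refine lintegral_congr fun x => ?_
  rw [ENNReal.ofReal_pow (norm_nonneg _), ofReal_norm]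

theorem lintegral_enorm_sq_ne_top {α E : Type*} [MeasurableSpace α] [NormedAddCommGroup E]
    {μ : Measure α} {f : α → E} (hf : MemLp f 2 μ) : ∫⁻ x, ‖f x‖ₑ ^ 2 ∂μ ≠ ⊤ := by
  have h := hf.eLpNorm_ne_top
  rw [eLpNorm_two_eq] at h
  contrapose! h
  simp [h]

theorem integrable_norm_sq {α E : Type*} [MeasurableSpace α] [NormedAddCommGroup E]
    {μ : Measure α} {f : α → E} (hf : MemLp f 2 μ) : Integrable (fun x => ‖f x‖ ^ 2) μ :=
  (memLp_two_iff_integrable_sq_norm hf.aestronglyMeasurable).1 hf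

theorem integrable_inner {α E : Type*} [MeasurableSpace α] [NormedAddCommGroup E]
    [InnerProductSpace ℝ E] {μ : Measure α} {f g : α → E} (hf : MemLp f 2 μ) (hg : MemLp g 2 μ) :
    Integrable (fun x => inner ℝ (f x) (g x)) μ := by
  refine ((integrable_norm_sq hf).add (integrable_norm_sq hg)).mono'
    (hf.aestronglyMeasurable.inner hg.aestronglyMeasurable) (ae_of_all _ fun x => ?_)
  have := norm_inner_le_norm (𝕜 := ℝ) (f x) (g x)
  simp only [Pi.add_apply]
  nlinarith [sq_nonneg (‖f x‖ - ‖g x‖), sq_nonneg (‖f x‖), sq_nonneg (‖g x‖)]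

theorem isFiniteMeasureOnCompacts_thinMeasure (d : ℕ) :
    IsFiniteMeasureOnCompacts (thinMeasure d) where
  lt_top_of_isCompact K hK := by
    obtain ⟨R, hR⟩ := hK.isBounded.subset_ball 0
    refine (measure_mono hR).trans_lt ?_
    rw [thinMeasure, Measure.map_apply continuous_thinEmbed.measurable measurableSet_ball]
    refine (measure_mono fun y hy => ?_ : _ ≤ volume (ball (0 : EuclideanSpace ℝ (Fin d)) R)).trans_lt
      measure_ball_lt_top
    simpa [norm_thinEmbed] using hy

/-- A reaction term `b` with primitive `P`. -/
structure IsReaction (b P : ℝ → ℝ) (K : ℝ≥0) : Prop where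
  lipschitz : LipschitzWith K b
  mul_nonneg : ∀ t, 0 ≤ t * b t
  zero : b 0 = 0
  hasDerivAt : ∀ t, HasDerivAt P (b t) t
  prim_zero : P 0 = 0

namespace IsReaction
variable {b P : ℝ → ℝ} {K : ℝ≥0}

theorem abs_sub_sub_le (h : IsReaction b P K) (x y : ℝ) :
    |P y - P x - b x * (y - x)| ≤ K * (y - x) ^ 2 := by
  have h1 := Convex.norm_image_sub_le_of_norm_hasDerivWithin_le (f := fun z => P z - b x * z)
    (f' := fun z => b z - b x) (s := uIcc x y) (C := K * |y - x|) (x := x) (y := y)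
    (fun z _ => ((h.hasDerivAt z).sub (by simpa using (hasDerivAt_id z).const_mul (b x))).hasDerivWithinAt)
    (fun z hz => by
      have h2 := h.lipschitz.dist_le_mul z x
      rw [Real.dist_eq, Real.dist_eq] at h2
      exact h2.trans (mul_le_mul_of_nonneg_left (abs_sub_left_of_mem_uIcc hz) K.coe_nonneg))
    (convex_uIcc x y) left_mem_uIcc right_mem_uIcc
  rw [Real.norm_eq_abs, Real.norm_eq_abs, mul_assoc, ← sq, sq_abs] at h1
  convert h1 using 2
  ring

theorem abs_le (h : IsReaction b P K) (x : ℝ) : |b x| ≤ K * |x| := by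
  simpa [Real.dist_eq, h.zero] using h.lipschitz.dist_le_mul x 0

theorem abs_prim_le (h : IsReaction b P K) (x : ℝ) : |P x| ≤ K * x ^ 2 := by
  simpa [h.zero, h.prim_zero] using h.abs_sub_sub_le 0 x

theorem continuous_prim (h : IsReaction b P K) : Continuous P :=
  continuous_iff_continuousAt.2 fun x => (h.hasDerivAt x).continuousAt

end IsReaction

/-- A weak solution near the origin, together with smooth approximations converging in the
weighted Sobolev space and on the thin space. -/
structure ApproxSolution {d : ℕ} (s ρ : ℝ) (b : ℝ → ℝ) (u : Space d → ℝ)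
    (G : Space d → Space d) (τ : Space d → ℝ) (v : ℕ → Space d → ℝ) : Prop where
  meas_u : Measurable u
  meas_G : Measurable G
  meas_τ : Measurable τ
  memLp_u : MemLp u 2 (wMeasure d s)
  memLp_G : MemLp G 2 (wMeasure d s)
  memLp_τ : MemLp τ 2 (thinMeasure d)
  supp_G : ∃ R, ∀ x, R ≤ ‖x‖ → G x = 0
  smooth : ∀ k, ContDiff ℝ ∞ (v k)
  compact : ∀ k, HasCompactSupport (v k)
  tendsto_u : Tendsto (fun k => eLpNorm (v k - u) 2 (wMeasure d s)) atTop (𝓝 0)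
  tendsto_G : Tendsto (fun k => eLpNorm (gradient (v k) - G) 2 (wMeasure d s)) atTop (𝓝 0)
  tendsto_τ : Tendsto (fun k => eLpNorm (v k - τ) 2 (thinMeasure d)) atTop (𝓝 0)
  eq : ∀ φ : Space d → ℝ, IsTest (ball 0 ρ) φ →
    ∫ x, inner ℝ (G x) (gradient φ x) ∂wMeasure d s + ∫ x, 2 * b (τ x) * φ x ∂thinMeasure d = 0

theorem exists_integral_thinMeasure_le {d : ℕ} {s : ℝ} (hs : s ∈ Ioo (0 : ℝ) 1) {δ : ℝ}
    (hδ : 0 < δ) :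
    ∃ C : ℝ, 0 ≤ C ∧ ∀ v : Space d → ℝ, ContDiff ℝ 1 v → HasCompactSupport v →
      ∫ x, ‖v x‖ ^ 2 ∂thinMeasure d ≤
        δ * ∫ x, ‖gradient v x‖ ^ 2 ∂wMeasure d s + C * (∫⁻ x, ‖v x‖ₑ ^ 2 ∂wMeasure d s).toReal := by
  obtain ⟨C, hC, h⟩ := exists_lintegral_thinMeasure_le (d := d) hs hδ
  have := isFiniteMeasureOnCompacts_wMeasure (d := d) hs.2
  refine ⟨C.toReal, ENNReal.toReal_nonneg, fun v hv hvc => ?_⟩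
  have h1 : MemLp v 2 (wMeasure d s) := hv.continuous.memLp_of_hasCompactSupport hvc
  have h2 : MemLp (gradient v) 2 (wMeasure d s) :=
    (continuous_gradient hv).memLp_of_hasCompactSupport (hasCompactSupport_gradient hvc)
  rw [integral_norm_sq_eq_toReal hv.continuous.aestronglyMeasurable,
    integral_norm_sq_eq_toReal h2.aestronglyMeasurable]
  have h3 := ENNReal.mul_ne_top (a := ENNReal.ofReal δ) ENNReal.ofReal_ne_top
    (lintegral_enorm_sq_ne_top h2)
  have h4 := ENNReal.mul_ne_top hC (lintegral_enorm_sq_ne_top h1)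
  have h5 := ENNReal.toReal_mono (ENNReal.add_ne_top.2 ⟨h3, h4⟩) (h v hv)
  rwa [ENNReal.toReal_add h3 h4, ENNReal.toReal_mul, ENNReal.toReal_mul,
    ENNReal.toReal_ofReal hδ.le] at h5

variable {d : ℕ} {s ρ : ℝ} {b P : ℝ → ℝ} {K : ℝ≥0} {u : Space d → ℝ} {G : Space d → Space d}
  {τ : Space d → ℝ} {v : ℕ → Space d → ℝ} {η : ℝ → ℝ} {κ C t : ℝ} {μ σ : Measure (Space d)}

theorem memLp_comp_radialMap {F : Type*} [NormedAddCommGroup F] [MeasurableSpace F]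
    [BorelSpace F] [SecondCountableTopology F] (hμ : IsPolar μ σ κ) (h : IsRadialProfile ρ η)
    (ht : IsSmallParam κ η C t) {f : Space d → F} (hf : Measurable f) (hf2 : MemLp f 2 μ) :
    MemLp (fun x => f (radialMap (fun r => t * η r) x)) 2 μ :=
  ⟨(hf.comp (contDiff_radialMap h t).continuous.measurable).aestronglyMeasurable,
    (eLpNorm_comp_radialMap_le hμ h ht hf).trans_lt
      (ENNReal.mul_lt_top (by norm_num) hf2.eLpNorm_lt_top)⟩

theorem eLpNorm_pullGrad_le {B : ℝ} (hμ : IsPolar μ σ κ) (h : IsRadialProfile ρ η)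
    (ht : IsSmallParam κ η C t) (ht1 : |t| ≤ 1) (hB : ∀ t, |t| ≤ 1 → (∀ r, |t * η r| ≤ 1 / 2) →
      ∀ (F : Space d → Space d) x,
      ‖pullGrad η t F x‖ ≤ B * ‖F (radialMap (fun r => t * η r) x)‖) {F : Space d → Space d}
    (hF : Measurable F) :
    eLpNorm (pullGrad η t F) 2 μ ≤ ENNReal.ofReal B * (2 * eLpNorm F 2 μ) := by
  refine (eLpNorm_le_mul_eLpNorm_of_ae_le_mul (ae_of_all _ (hB t ht1 ht.abs_mul_le F)) 2).trans ?_
  gcongr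
  exact eLpNorm_comp_radialMap_le hμ h ht hF

theorem tendsto_eLpNorm_of_le {α F F' : Type*} [MeasurableSpace α] [NormedAddCommGroup F]
    [NormedAddCommGroup F'] {μ ν : Measure α} {f : ℕ → α → F} {g : ℕ → α → F'} {A : ℝ≥0∞}
    (hA : A ≠ ⊤) (h : ∀ k, eLpNorm (f k) 2 μ ≤ A * eLpNorm (g k) 2 ν)
    (hg : Tendsto (fun k => eLpNorm (g k) 2 ν) atTop (𝓝 0)) :
    Tendsto (fun k => eLpNorm (f k) 2 μ) atTop (𝓝 0) := by
  refine tendsto_of_tendsto_of_tendsto_of_le_of_le tendsto_const_nhds ?_ (fun _ => zero_le)  h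
  simpa using ENNReal.Tendsto.const_mul hg (Or.inr hA)

/-- Critical points of the energy increase the energy at most quadratically less along radial
reparametrizations. -/
theorem ApproxSolution.exists_energy_lower_bound (S : ApproxSolution s ρ b u G τ v)
    (hs : s ∈ Ioo (0 : ℝ) 1) (hb : IsReaction b P K) (h : IsRadialProfile ρ η) {κ' C' t₀ : ℝ}
    {σ' : Measure (Space d)} (hμ : IsPolar (wMeasure d s) σ κ)
    (hμ' : IsPolar (thinMeasure d) σ' κ')
    (ht₀ : t₀ ≤ 1) (ht : ∀ t, |t| ≤ t₀ → IsSmallParam κ η C t)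
    (ht' : ∀ t, |t| ≤ t₀ → IsSmallParam κ' η C' t) :
    ∃ D : ℝ, ∀ t, |t| ≤ t₀ → -(D * t ^ 2) ≤
      ∫ x, ‖pullGrad η t G x‖ ^ 2 ∂wMeasure d s - ∫ x, ‖G x‖ ^ 2 ∂wMeasure d s +
      4 * (∫ x, P (τ (radialMap (fun r => t * η r) x)) ∂thinMeasure d -
        ∫ x, P (τ x) ∂thinMeasure d) := by
  have hfin := isFiniteMeasureOnCompacts_wMeasure (d := d) hs.2
  have hfin' := isFiniteMeasureOnCompacts_thinMeasure d
  obtain ⟨B, hB, hBb⟩ := exists_norm_pullGrad_le (d := d) h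
  -- The factor `δ = 1 / (4K + 1)` satisfies `4K δ ≤ 1`, so the gradient of the variation absorbs
  -- the loss `4K ∫ W²` caused by the nonconvexity of the potential.
  obtain ⟨C₁, hC₁, htr⟩ := exists_integral_thinMeasure_le (d := d) hs
    (δ := (4 * K + 1 : ℝ)⁻¹) (by positivity)
  obtain ⟨D, hD⟩ := exists_lintegral_comp_radialMap_sub_le hμ h ht
  set I := ∫ x, ‖G x‖ ^ 2 ∂wMeasure d s with hI
  refine ⟨4 * K * (C₁ * (max D 0 * I)), fun t htt => ?_⟩
  have hst := ht t htt
  have hst' := ht' t htt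
  set Φ : Space d → Space d := radialMap fun r => t * η r with hΦdef
  have hΦ : Measurable Φ := (contDiff_radialMap h t).continuous.measurable
  have ht1 : |t| ≤ 1 := htt.trans ht₀
  have hv1 : ∀ k, ContDiff ℝ 1 (v k) := fun k => (S.smooth k).of_le (by simp)
  have hgm : ∀ k, Measurable (gradient (v k)) := fun k => (continuous_gradient (hv1 k)).measurable
  have hgL : ∀ k, MemLp (gradient (v k)) 2 (wMeasure d s) := fun k =>
    (continuous_gradient (hv1 k)).memLp_of_hasCompactSupport
      (hasCompactSupport_gradient (S.compact k))
  -- the variations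
  set w : ℕ → Space d → ℝ := fun k x => v k (Φ x) - v k x with hw
  have hwt : ∀ k, IsTest (ball 0 ρ) (w k) := fun k => isTest_comp_radialMap_sub h t (S.smooth k)
  have hwg : ∀ k, gradient (w k) = pullGrad η t (gradient (v k)) - gradient (v k) := by
    intro k
    rw [← gradient_comp_radialMap h t (hv1 k)]
    ext1 x
    refine ext_inner_right ℝ fun e => ?_
    have hd1 : DifferentiableAt ℝ (fun x => v k (Φ x)) x :=
      ((S.smooth k).comp (contDiff_radialMap h t)).differentiable (by simp) x
    have hd2 : DifferentiableAt ℝ (v k) x := (S.smooth k).differentiable (by simp) x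
    rw [Pi.sub_apply, inner_sub_left, inner_gradient_left, inner_gradient_left,
      inner_gradient_left, hw]
    simp only
    rw [fderiv_fun_sub hd1 hd2]
    rfl
  set V := pullGrad η t G - G with hV
  set W : Space d → ℝ := fun x => τ (Φ x) - τ x with hW
  have hPG : MemLp (pullGrad η t G) 2 (wMeasure d s) :=
    ⟨(measurable_pullGrad h t S.meas_G).aestronglyMeasurable,
      (eLpNorm_pullGrad_le hμ h hst ht1 hBb S.meas_G).trans_lt (ENNReal.mul_lt_top
        ENNReal.ofReal_lt_top (ENNReal.mul_lt_top (by norm_num) S.memLp_G.eLpNorm_lt_top))⟩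
  have hVL : MemLp V 2 (wMeasure d s) := hPG.sub S.memLp_G
  have hτΦ : MemLp (fun x => τ (Φ x)) 2 (thinMeasure d) :=
    memLp_comp_radialMap hμ' h hst' S.meas_τ S.memLp_τ
  have hWL : MemLp W 2 (thinMeasure d) := hτΦ.sub S.memLp_τ
  have hwL : ∀ k, MemLp (w k) 2 (thinMeasure d) := fun k =>
    (hwt k).smooth.continuous.memLp_of_hasCompactSupport (hwt k).compact
  have hwc1 : ∀ k, ContDiff ℝ 1 (w k) := fun k => (hwt k).smooth.of_le (by simp)
  have hgwL : ∀ k, MemLp (gradient (w k)) 2 (wMeasure d s) := fun k =>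
    (continuous_gradient (hwc1 k)).memLp_of_hasCompactSupport
      (hasCompactSupport_gradient (hwt k).compact)
  have hVt : Tendsto (fun k => eLpNorm (gradient (w k) - V) 2 (wMeasure d s)) atTop (𝓝 0) := by
    refine tendsto_eLpNorm_of_le (A := ENNReal.ofReal B * 2 + 1)
      (ENNReal.add_ne_top.2 ⟨ENNReal.mul_ne_top ENNReal.ofReal_ne_top (by norm_num), by norm_num⟩)
      (fun k => ?_) S.tendsto_G
    have e : gradient (w k) - V =
        pullGrad η t (gradient (v k) - G) - (gradient (v k) - G) := by
      rw [hwg, pullGrad_sub, hV]; abel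
    have hm : Measurable (gradient (v k) - G) := (hgm k).sub S.meas_G
    rw [e, add_mul, one_mul, mul_assoc]
    exact (eLpNorm_sub_le (measurable_pullGrad h t hm).aestronglyMeasurable
      hm.aestronglyMeasurable (by norm_num)).trans
      (add_le_add_left (eLpNorm_pullGrad_le hμ h hst ht1 hBb hm) _)
  have hWt : Tendsto (fun k => eLpNorm (w k - W) 2 (thinMeasure d)) atTop (𝓝 0) := by
    refine tendsto_eLpNorm_of_le (A := 2 + 1) (by norm_num) (fun k => ?_) S.tendsto_τ
    have hm : Measurable (v k - τ) := (S.smooth k).continuous.measurable.sub S.meas_τ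
    have e : w k - W = (fun x => (v k - τ) (Φ x)) - (v k - τ) := by
      ext x; simp only [hw, hW, Pi.sub_apply]; ring
    rw [e, add_mul, one_mul]
    exact (eLpNorm_sub_le (hm.comp hΦ).aestronglyMeasurable
      hm.aestronglyMeasurable (by norm_num)).trans
      (add_le_add_left (eLpNorm_comp_radialMap_le hμ' h hst' hm) _)
  -- the equation in the limit
  have hbL : MemLp (fun x => 2 * b (τ x)) 2 (thinMeasure d) := by
    refine MemLp.of_le_mul (c := 2 * K) S.memLp_τ
      ((hb.lipschitz.continuous.measurable.comp S.meas_τ).const_mul 2).aestronglyMeasurable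
      (ae_of_all _ fun x => ?_)
    rw [norm_mul, Real.norm_eq_abs, Real.norm_eq_abs, Real.norm_eq_abs, abs_two, mul_assoc]
    gcongr
    exact hb.abs_le _
  have hself : Tendsto (fun _ : ℕ => eLpNorm (G - G) 2 (wMeasure d s)) atTop (𝓝 0) := by simp
  have hself' : Tendsto (fun _ : ℕ => eLpNorm ((fun x => 2 * b (τ x)) - fun x => 2 * b (τ x)) 2
    (thinMeasure d)) atTop (𝓝 0) := by simp
  have heq : ∫ x, inner ℝ (G x) (V x) ∂wMeasure d s + ∫ x, 2 * b (τ x) * W x ∂thinMeasure d = 0 := by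
    have l1 := tendsto_integral_inner S.memLp_G hVL (fun _ => S.memLp_G) hgwL hself hVt
    have l2 := tendsto_integral_mul hbL hWL (fun _ => hbL) hwL hself' hWt
    have l3 := l1.add l2
    refine tendsto_nhds_unique l3 ?_
    simp_rw [fun k => S.eq (w k) (hwt k)]
    exact tendsto_const_nhds
  -- the trace inequality in the limit
  have hineq : ∫ x, ‖W x‖ ^ 2 ∂thinMeasure d ≤ (4 * K + 1 : ℝ)⁻¹ * ∫ x, ‖V x‖ ^ 2 ∂wMeasure d s +
      C₁ * (max D 0 * t ^ 2 * I) := by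
    refine le_of_tendsto_of_tendsto' (tendsto_integral_norm_sq hWL hwL hWt)
      (((tendsto_integral_norm_sq hVL hgwL hVt).const_mul _).add
      (((tendsto_integral_norm_sq S.memLp_G hgL S.tendsto_G).const_mul (max D 0 * t ^ 2)).const_mul
        C₁)) fun k => ?_
    refine (htr (w k) (hwc1 k) (hwt k).compact).trans ?_
    gcongr
    have hle := ENNReal.toReal_mono (ENNReal.mul_ne_top ENNReal.ofReal_ne_top
      (lintegral_enorm_sq_ne_top (hgL k))) (hD t htt (v k) (hv1 k))
    refine hle.trans ?_
    rw [ENNReal.toReal_mul, integral_norm_sq_eq_toReal (hgL k).aestronglyMeasurable]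
    gcongr
    rw [← ENNReal.toReal_ofReal (r := max D 0 * t ^ 2) (by positivity)]
    refine ENNReal.toReal_mono ENNReal.ofReal_ne_top (ENNReal.ofReal_le_ofReal ?_)
    gcongr
    exact le_max_left _ _
  -- The Dirichlet part is exactly quadratic: its linear term is twice the pairing in `heq`, and the
  -- square of `V` remains available for absorption.
  have hE1 : ∫ x, ‖pullGrad η t G x‖ ^ 2 ∂wMeasure d s =
      I + 2 * ∫ x, inner ℝ (G x) (V x) ∂wMeasure d s + ∫ x, ‖V x‖ ^ 2 ∂wMeasure d s := by
    rw [hI, ← integral_const_mul, ← integral_add (integrable_norm_sq S.memLp_G)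
      ((integrable_inner S.memLp_G hVL).const_mul 2), ← integral_add _ (integrable_norm_sq hVL)]
    · refine integral_congr_ae (ae_of_all _ fun x => ?_)
      have : pullGrad η t G x = G x + V x := by simp [hV]
      simp only
      rw [this, norm_add_sq_real]
    · exact (integrable_norm_sq S.memLp_G).add ((integrable_inner S.memLp_G hVL).const_mul 2)
  have hPi : ∀ f : Space d → ℝ, Measurable f → MemLp f 2 (thinMeasure d) →
      Integrable (fun x => P (f x)) (thinMeasure d) := by
    intro f hf hfL
    refine ((integrable_norm_sq hfL).const_mul K).mono'
      (hb.continuous_prim.measurable.comp hf).aestronglyMeasurable (ae_of_all _ fun x => ?_)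
    simpa using hb.abs_prim_le (f x)
  have hP1 : Integrable (fun x => P (τ (Φ x))) (thinMeasure d) := hPi _ (S.meas_τ.comp hΦ) hτΦ
  have hP2 := hPi _ S.meas_τ S.memLp_τ
  have hbW : Integrable (fun x => 2 * b (τ x) * W x) (thinMeasure d) := by
    simpa [mul_comm] using integrable_inner hbL hWL
  have hW2 := integrable_norm_sq hWL
  -- Taylor's formula with Lipschitz derivative, integrated. The linear term is twice the boundary
  -- term of the equation, so the two linear terms cancel in the sum.
  have hE2 : 2 * ∫ x, 2 * b (τ x) * W x ∂thinMeasure d -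
      4 * K * ∫ x, ‖W x‖ ^ 2 ∂thinMeasure d ≤
      4 * (∫ x, P (τ (Φ x)) ∂thinMeasure d - ∫ x, P (τ x) ∂thinMeasure d) := by
    rw [← integral_sub hP1 hP2, ← integral_const_mul, ← integral_const_mul, ← integral_const_mul,
      ← integral_sub (hbW.const_mul 2) (hW2.const_mul _)]
    refine integral_mono ((hbW.const_mul 2).sub (hW2.const_mul _)) ((hP1.sub hP2).const_mul 4)
      fun x => ?_
    have h1 := hb.abs_sub_sub_le (τ x) (τ (Φ x))
    have h2 := neg_abs_le (P (τ (Φ x)) - P (τ x) - b (τ x) * (τ (Φ x) - τ x))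
    simp only [Real.norm_eq_abs, sq_abs, hW]
    linarith
  have hV0 : 0 ≤ ∫ x, ‖V x‖ ^ 2 ∂wMeasure d s := integral_nonneg fun x => sq_nonneg _
  have hK : (4 * K : ℝ) * (4 * K + 1 : ℝ)⁻¹ ≤ 1 := by
    rw [mul_inv_le_iff₀ (by positivity)]; linarith
  have h3 := mul_le_mul_of_nonneg_left hineq (show (0 : ℝ) ≤ 4 * K by positivity)
  have h4 := mul_le_mul_of_nonneg_right hK hV0
  rw [hE1]
  have e : (4 * K : ℝ) * ((4 * K + 1 : ℝ)⁻¹ * ∫ x, ‖V x‖ ^ 2 ∂wMeasure d s +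
      C₁ * (max D 0 * t ^ 2 * I)) = (4 * K : ℝ) * (4 * K + 1 : ℝ)⁻¹ *
      ∫ x, ‖V x‖ ^ 2 ∂wMeasure d s + 4 * K * (C₁ * (max D 0 * I)) * t ^ 2 := by ring
  rw [e] at h3
  linarith

end ThinReaction

/-! ### Domain variation identity and energy identity -/

namespace ThinReaction
open Filter Topology
open scoped ENNReal

variable {d : ℕ} {s ρ : ℝ} {b P : ℝ → ℝ} {K : ℝ≥0} {u : Space d → ℝ} {G : Space d → Space d}
  {τ : Space d → ℝ} {v : ℕ → Space d → ℝ} {η : ℝ → ℝ} {κ C t : ℝ} {μ σ : Measure (Space d)}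

/-- Rewriting `∫ f` by the change of variables turns the difference into one integral of `f ∘ Φ`
against the coefficient `exp(αtη)` minus the Jacobian, which is smooth in `t`. The case `α = 2`
serves the Dirichlet energy and `α = 0` the potential. -/
theorem exists_abs_integral_exp_mul_comp_sub_le (hμ : IsPolar μ σ κ) (h : IsRadialProfile ρ η)
    {t₀ : ℝ} (hC : 0 ≤ C) (ht : ∀ t, |t| ≤ t₀ → IsSmallParam κ η C t) {f : Space d → ℝ}
    (hf : Measurable f) (hfi : Integrable f μ) {α : ℝ} (hα : |α| ≤ 2) :
    ∃ D, ∀ t, |t| ≤ t₀ →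
      |∫ x, Real.exp (α * (t * η ‖x‖)) * f (radialMap (fun r => t * η r) x) ∂μ - ∫ x, f x ∂μ
        - t * ∫ x, (α * η ‖x‖ - ((κ + 1) * η ‖x‖ + ‖x‖ * deriv η ‖x‖)) * f x ∂μ| ≤ D * t ^ 2 := by
  obtain ⟨B, hB, hb⟩ := exists_bound_of_hasCompactSupport h.smooth.continuous h.compact
  have hsm := h.smooth.continuous
  have hc : ContDiff ℝ 1 fun r => α * η r - ((κ + 1) * η r + r * deriv η r) :=
    ((contDiff_const.mul h.smooth).sub
      ((contDiff_const.mul h.smooth).add h.contDiff_mul_deriv)).of_le (by simp)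
  have hcc : HasCompactSupport fun r => α * η r - ((κ + 1) * η r + r * deriv η r) :=
    h.compact.mul_left.sub (h.compact.mul_left.add h.hasCompactSupport_mul_deriv)
  obtain ⟨D, hD⟩ := abs_integral_comp_radialMap_sub_mul_le hμ h hC ht hf hfi hc hcc
    (p := fun t r => Real.exp (α * (t * η r)) - radialJacobian κ (fun r => t * η r) r)
    (fun t => by have := continuous_radialJacobian h κ t; fun_prop) (D := (2 * B) ^ 2 + C)
    (fun t htt r => by
      have h1 := (ht t htt).expand r
      have h2 : |α * (t * η r)| ≤ 1 := by
        rw [abs_mul]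
        have := (ht t htt).abs_mul_le r
        nlinarith [abs_nonneg α, abs_nonneg (t * η r)]
      have h3 := Real.abs_exp_sub_one_sub_id_le h2
      have h4 : (α * (t * η r)) ^ 2 ≤ (2 * B) ^ 2 * t ^ 2 := by
        have e : (α * (t * η r)) ^ 2 = (|α| * |η r|) ^ 2 * t ^ 2 := by
          rw [mul_pow |α|, sq_abs, sq_abs]; ring
        rw [e]
        gcongr
        exact hb r
      have e : Real.exp (α * (t * η r)) - radialJacobian κ (fun r => t * η r) r -
          t * (α * η r - ((κ + 1) * η r + r * deriv η r)) =
          (Real.exp (α * (t * η r)) - 1 - α * (t * η r)) -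
          (radialJacobian κ (fun r => t * η r) r - 1 - t * ((κ + 1) * η r + r * deriv η r)) := by
        ring
      rw [e, add_mul ((2 * B) ^ 2)]
      exact (abs_sub _ _).trans (add_le_add (h3.trans h4) h1))
  refine ⟨D, fun t htt => ?_⟩
  have hs := ht t htt
  have hfΦ := integrable_comp_radialMap hμ h hs hf hfi
  have hi1 : Integrable (fun x => Real.exp (α * (t * η ‖x‖)) *
      f (radialMap (fun r => t * η r) x)) μ := by
    refine hfΦ.bdd_mul (c := Real.exp 1) (Continuous.aestronglyMeasurable (by fun_prop))
      (ae_of_all _ fun x => ?_)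
    rw [Real.norm_eq_abs, Real.abs_exp, Real.exp_le_exp]
    refine (le_abs_self _).trans ?_
    rw [abs_mul]
    have := hs.abs_mul_le ‖x‖
    nlinarith [abs_nonneg α, abs_nonneg (t * η ‖x‖)]
  have hi2 : Integrable (fun x => radialJacobian κ (fun r => t * η r) ‖x‖ *
      f (radialMap (fun r => t * η r) x)) μ := by
    refine hfΦ.bdd_mul (c := 1 + C * |t|)
      ((continuous_radialJacobian h κ t).comp continuous_norm).aestronglyMeasurable
      (ae_of_all _ fun x => ?_)
    have h2 := hs.sub_one ‖x‖
    have h3 := abs_add_le (radialJacobian κ (fun r => t * η r) ‖x‖ - 1) 1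
    rw [sub_add_cancel, abs_one] at h3
    rw [Real.norm_eq_abs]
    linarith
  rw [← integral_radialJacobian_mul hμ h hs hf, ← integral_sub hi1 hi2]
  simpa only [sub_mul] using hD t htt

/-- A quantity vanishes if it is the derivative at `0` of a function with a quadratic lower
bound. -/
theorem eq_zero_of_forall_mul_ge {ℓ t₀ D : ℝ} (ht₀ : 0 < t₀)
    (h : ∀ t, |t| ≤ t₀ → -(D * t ^ 2) ≤ t * ℓ) : ℓ = 0 := by
  by_contra hℓ
  set t := min t₀ (|ℓ| / (2 * (|D| + 1))) with ht
  have hℓ' : 0 < |ℓ| := abs_pos.2 hℓ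
  have ht0 : 0 < t := lt_min ht₀ (by positivity)
  have h1 : t ≤ |ℓ| / (2 * (|D| + 1)) := min_le_right _ _
  rw [le_div_iff₀ (by positivity)] at h1
  have h2 : |ℓ| ≤ D * t := by
    rcases abs_cases ℓ with ⟨e, _⟩ | ⟨e, _⟩
    · have := h (-t) (by rw [abs_neg, abs_of_pos ht0]; exact min_le_left _ _)
      rw [e]
      -- The sign of the parameter is chosen opposite to that of `ℓ`, so that the lower bound reads
      -- `t |ℓ| ≤ D t²`; this is impossible for the small `t` fixed above.
      refine le_of_mul_le_mul_left ?_ ht0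
      nlinarith
    · have := h t (by rw [abs_of_pos ht0]; exact min_le_left _ _)
      rw [e]
      refine le_of_mul_le_mul_left ?_ ht0
      nlinarith
  nlinarith [le_abs_self D]

theorem hasCompactSupport_fun_add {f g : ℝ → ℝ} (hf : HasCompactSupport f)
    (hg : HasCompactSupport g) : HasCompactSupport fun r => f r + g r := hf.add hg

namespace ApproxSolution

theorem memLp_inner_self (S : ApproxSolution s ρ b u G τ v) :
    MemLp (fun x => inner ℝ (G x) x) 2 (wMeasure d s) := by
  obtain ⟨R, hR⟩ := S.supp_G
  refine MemLp.of_le_mul (c := R) S.memLp_G (S.meas_G.inner measurable_id).aestronglyMeasurable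
    (ae_of_all _ fun x => ?_)
  rcases le_total R ‖x‖ with hx | hx
  · simp [hR x hx]
  · refine (norm_inner_le_norm _ _).trans ?_
    rw [mul_comm]
    gcongr

/-- The domain variation identity. -/
theorem inner_variation (S : ApproxSolution s ρ b u G τ v)
    (hs : s ∈ Ioo (0 : ℝ) 1) (hb : IsReaction b P K) (h : IsRadialProfile ρ η) (hd : 1 ≤ d) :
    -∫ x, ((d - 2 * s) * η ‖x‖ + ‖x‖ * deriv η ‖x‖) * ‖G x‖ ^ 2 ∂wMeasure d s +
      2 * ∫ x, deriv η ‖x‖ / ‖x‖ * inner ℝ (G x) x ^ 2 ∂wMeasure d s -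
      ∫ x, (d * η ‖x‖ + ‖x‖ * deriv η ‖x‖) * (4 * P (τ x)) ∂thinMeasure d = 0 := by
  have hμ := isPolar_wMeasure (d := d) hs
  have hμ' := isPolar_thinMeasure hd
  obtain ⟨t₁, C, ht₁, -, hC, hst⟩ := exists_isSmallParam h ((d : ℝ) + (1 - 2 * s))
  obtain ⟨t₂, C', ht₂, ht₂', hC', hst'⟩ := exists_isSmallParam h ((d : ℝ) - 1)
  have hst : ∀ t, |t| ≤ min t₁ t₂ → _ := fun t ht => hst t (ht.trans (min_le_left _ _))
  have hst' : ∀ t, |t| ≤ min t₁ t₂ → _ := fun t ht => hst' t (ht.trans (min_le_right _ _))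
  set t₀ := min t₁ t₂ with ht₀
  have ht₀1 : t₀ ≤ 1 := (min_le_right _ _).trans ht₂'
  obtain ⟨D₀, hD₀⟩ := S.exists_energy_lower_bound hs hb h hμ hμ' ht₀1 hst hst'
  have hm1 : Measurable fun x => ‖G x‖ ^ 2 := S.meas_G.norm.pow_const 2
  have hi1 : Integrable (fun x => ‖G x‖ ^ 2) (wMeasure d s) := integrable_norm_sq S.memLp_G
  have hm2 : Measurable fun x => (inner ℝ (G x) x : ℝ) ^ 2 :=
    (S.meas_G.inner measurable_id).pow_const 2
  have hi2 : Integrable (fun x => (inner ℝ (G x) x : ℝ) ^ 2) (wMeasure d s) := by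
    simpa using integrable_norm_sq S.memLp_inner_self
  have hm3 : Measurable fun x => P (τ x) := hb.continuous_prim.measurable.comp S.meas_τ
  have hi3 : Integrable (fun x => P (τ x)) (thinMeasure d) := by
    refine ((integrable_norm_sq S.memLp_τ).const_mul K).mono'
      hm3.aestronglyMeasurable (ae_of_all _ fun x => ?_)
    simpa using hb.abs_prim_le (τ x)
  obtain ⟨D₁, hD₁⟩ := exists_abs_integral_exp_mul_comp_sub_le hμ h hC hst hm1 hi1
    (α := 2) (by norm_num)
  obtain ⟨D₃, hD₃⟩ := exists_abs_integral_exp_mul_comp_sub_le hμ' h hC' hst' hm3 hi3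
    (α := 0) (by norm_num)
  have hcd := h.contDiff_deriv_div
  have hdc := hcd.continuous
  have hccd := h.hasCompactSupport_deriv_div
  obtain ⟨B, hB, hBb⟩ := exists_bound_of_hasCompactSupport
    (c := fun r => (deriv η r / r) * (r * (r * (deriv η r / r)))) (by fun_prop) hccd.mul_right
  -- This is the radial part of the pulled back energy. Its coefficient has no term of order zero in
  -- `t`, so it is expanded directly.
  obtain ⟨D₂, hD₂⟩ := abs_integral_comp_radialMap_sub_mul_le hμ h hC hst hm2 hi2
    (c := fun r => 2 * (deriv η r / r)) ((contDiff_const.mul hcd).of_le (by simp))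
    hccd.mul_left
    (p := fun t r => 2 * t * (deriv η r / r) +
      t ^ 2 * ((deriv η r / r) * (r * (r * (deriv η r / r)))))
    (fun t => by fun_prop) (D := B) (fun t _ r => by
      have := hBb r
      have e : 2 * t * (deriv η r / r) + t ^ 2 * ((deriv η r / r) * (r * (r * (deriv η r / r)))) -
        t * (2 * (deriv η r / r)) = t ^ 2 * ((deriv η r / r) * (r * (r * (deriv η r / r)))) := by
        ring
      rw [e, abs_mul, abs_of_nonneg (sq_nonneg t), mul_comm]
      gcongr)
  simp only [zero_mul, Real.exp_zero, one_mul, zero_sub] at hD₃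
  obtain ⟨ℓ₁, hℓ₁⟩ : ∃ l, l = ∫ x, (2 * η ‖x‖ - (((d : ℝ) + (1 - 2 * s) + 1) * η ‖x‖ +
    ‖x‖ * deriv η ‖x‖)) * ‖G x‖ ^ 2 ∂wMeasure d s := ⟨_, rfl⟩
  obtain ⟨ℓ₂, hℓ₂⟩ : ∃ l, l = ∫ x, 2 * (deriv η ‖x‖ / ‖x‖) * inner ℝ (G x) x ^ 2 ∂wMeasure d s :=
    ⟨_, rfl⟩
  obtain ⟨ℓ₃, hℓ₃⟩ : ∃ l, l = ∫ x, -(((d : ℝ) - 1 + 1) * η ‖x‖ + ‖x‖ * deriv η ‖x‖) *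
    P (τ x) ∂thinMeasure d := ⟨_, rfl⟩
  rw [← hℓ₁] at hD₁
  rw [← hℓ₂] at hD₂
  rw [← hℓ₃] at hD₃
  -- The sum is the derivative at `t = 0` of the energy along the family. The upper bounds from the
  -- three expansions and the quadratic lower bound hold for `t` of both signs and leave only the
  -- value zero.
  have key : ℓ₁ + ℓ₂ + 4 * ℓ₃ = 0 := by
    refine eq_zero_of_forall_mul_ge (t₀ := t₀) (D := D₀ + D₁ + D₂ + 4 * D₃)
      (lt_min ht₁ ht₂) fun t htt => ?_
    have hs1 := hst t htt
    have h0 := hD₀ t htt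
    have h1 := abs_le.1 (hD₁ t htt)
    have h2 := abs_le.1 (hD₂ t htt)
    have h3 := abs_le.1 (hD₃ t htt)
    have e : ∫ x, ‖pullGrad η t G x‖ ^ 2 ∂wMeasure d s =
        ∫ x, Real.exp (2 * (t * η ‖x‖)) * ‖G (radialMap (fun r => t * η r) x)‖ ^ 2 ∂wMeasure d s +
        ∫ x, (2 * t * (deriv η ‖x‖ / ‖x‖) +
          t ^ 2 * ((deriv η ‖x‖ / ‖x‖) * (‖x‖ * (‖x‖ * (deriv η ‖x‖ / ‖x‖))))) *
          inner ℝ (G (radialMap (fun r => t * η r) x)) (radialMap (fun r => t * η r) x) ^ 2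
          ∂wMeasure d s := by
      rw [← integral_add]
      · exact integral_congr_ae (ae_of_all _ fun x => norm_pullGrad_sq η t G x)
      · have hη := h.smooth.continuous
        refine (integrable_comp_radialMap hμ h hs1 hm1 hi1).bdd_mul (c := Real.exp 1)
          (Continuous.aestronglyMeasurable (by fun_prop)) (ae_of_all _ fun x => ?_)
        rw [Real.norm_eq_abs, Real.abs_exp, Real.exp_le_exp]
        linarith [le_abs_self (t * η ‖x‖), hs1.abs_mul_le ‖x‖]
      · have a1 : HasCompactSupport fun r => 2 * t * (deriv η r / r) := hccd.mul_left
        have a2 : HasCompactSupport fun r => deriv η r / r * (r * (r * (deriv η r / r))) :=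
          hccd.mul_right
        have a3 : HasCompactSupport fun r =>
          t ^ 2 * (deriv η r / r * (r * (r * (deriv η r / r)))) := a2.mul_left
        obtain ⟨B', -, hB'⟩ := exists_bound_of_hasCompactSupport (c := fun r =>
          2 * t * (deriv η r / r) + t ^ 2 * ((deriv η r / r) * (r * (r * (deriv η r / r)))))
          (by fun_prop) (hasCompactSupport_fun_add a1 a3)
        have hpc : Continuous fun r => 2 * t * (deriv η r / r) +
          t ^ 2 * ((deriv η r / r) * (r * (r * (deriv η r / r)))) := by fun_prop
        exact (integrable_comp_radialMap hμ h hs1 hm2 hi2).bdd_mul (c := B')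
          (hpc.comp continuous_norm).aestronglyMeasurable (ae_of_all _ fun x => hB' ‖x‖)
    rw [e] at h0
    replace h1 := h1.2
    replace h2 := h2.2
    replace h3 := h3.2
    generalize (∫ x, ‖G x‖ ^ 2 ∂wMeasure d s) = I₀ at h0 h1
    generalize (∫ x, P (τ x) ∂thinMeasure d) = I₁ at h0 h3
    generalize (∫ x, P (τ (radialMap (fun r => t * η r) x)) ∂thinMeasure d) = I₂ at h0 h3
    generalize (∫ x, Real.exp (2 * (t * η ‖x‖)) * ‖G (radialMap (fun r => t * η r) x)‖ ^ 2
      ∂wMeasure d s) = I₃ at h0 h1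
    generalize (∫ x, (2 * t * (deriv η ‖x‖ / ‖x‖) +
          t ^ 2 * ((deriv η ‖x‖ / ‖x‖) * (‖x‖ * (‖x‖ * (deriv η ‖x‖ / ‖x‖))))) *
          inner ℝ (G (radialMap (fun r => t * η r) x)) (radialMap (fun r => t * η r) x) ^ 2
          ∂wMeasure d s) = I₄ at h0 h2
    clear hℓ₁ hℓ₂ hℓ₃ hD₀ hD₁ hD₂ hD₃
    linarith
  have e1 : ℓ₁ = -∫ x, ((d - 2 * s) * η ‖x‖ + ‖x‖ * deriv η ‖x‖) * ‖G x‖ ^ 2 ∂wMeasure d s := by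
    rw [hℓ₁, ← integral_neg]
    exact integral_congr_ae (ae_of_all _ fun x => by simp only; ring)
  have e2 : ℓ₂ = 2 * ∫ x, deriv η ‖x‖ / ‖x‖ * inner ℝ (G x) x ^ 2 ∂wMeasure d s := by
    rw [hℓ₂, ← integral_const_mul]
    exact integral_congr_ae (ae_of_all _ fun x => by simp only; ring)
  have e3 : 4 * ℓ₃ =
      -∫ x, (d * η ‖x‖ + ‖x‖ * deriv η ‖x‖) * (4 * P (τ x)) ∂thinMeasure d := by
    rw [hℓ₃, ← integral_neg, ← integral_const_mul]
    exact integral_congr_ae (ae_of_all _ fun x => by simp only; ring)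
  rw [e1, e2, e3] at key
  linarith

theorem gradient_mul {f g : Space d → ℝ} {x : Space d} (hf : DifferentiableAt ℝ f x)
    (hg : DifferentiableAt ℝ g x) :
    gradient (fun x => f x * g x) x = f x • gradient g x + g x • gradient f x := by
  refine ext_inner_right ℝ fun e => ?_
  rw [inner_gradient_left, inner_add_left, inner_smul_left, inner_smul_left,
    inner_gradient_left, inner_gradient_left, fderiv_fun_mul hf hg]
  simp

theorem gradient_comp_norm (h : IsRadialProfile ρ η) (x : Space d) :
    gradient (fun x : Space d => η ‖x‖) x = (deriv η ‖x‖ / ‖x‖) • x := by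
  refine ext_inner_right ℝ fun e => ?_
  rw [inner_gradient_left, (h.hasFDerivAt_comp_norm x).fderiv, inner_smul_left]
  simp

/-- The energy identity: the equation tested with a radial multiple of the solution. -/
theorem energy_identity (S : ApproxSolution s ρ b u G τ v)
    (hs : s ∈ Ioo (0 : ℝ) 1) (hb : IsReaction b P K) (h : IsRadialProfile ρ η) :
    ∫ x, η ‖x‖ * ‖G x‖ ^ 2 ∂wMeasure d s +
      ∫ x, deriv η ‖x‖ / ‖x‖ * (u x * inner ℝ (G x) x) ∂wMeasure d s +
      ∫ x, η ‖x‖ * (2 * (τ x * b (τ x))) ∂thinMeasure d = 0 := by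
  have hfin := isFiniteMeasureOnCompacts_wMeasure (d := d) hs.2
  have hfin' := isFiniteMeasureOnCompacts_thinMeasure d
  obtain ⟨B₁, hB₁, hb₁⟩ := exists_bound_of_hasCompactSupport h.smooth.continuous h.compact
  obtain ⟨B₂, hB₂, hb₂⟩ := exists_bound_of_hasCompactSupport h.contDiff_deriv.continuous
    h.compact.deriv
  have hcd := h.contDiff_deriv_div.continuous
  have hη := h.smooth.continuous
  have hηn := h.contDiff_comp_norm (d := d)
  -- The factor `|x|` cancels the denominator, so the gradient of the cutoff contributes at most
  -- `sup |η'|`.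
  have hcoef : ∀ (a : ℝ) (x : Space d), ‖(deriv η ‖x‖ / ‖x‖ * a) • x‖ ≤ B₂ * ‖a‖ := by
    intro a x
    rw [norm_smul, norm_mul]
    rcases eq_or_ne ‖x‖ 0 with h0 | h0
    · simp only [h0, mul_zero]; positivity
    · have : ‖deriv η ‖x‖ / ‖x‖‖ * ‖a‖ * ‖x‖ = |deriv η ‖x‖| * ‖a‖ := by
        rw [norm_div, norm_norm, Real.norm_eq_abs]
        field_simp
      rw [this]
      gcongr
      exact hb₂ _
  have hv1 : ∀ k, ContDiff ℝ 1 (v k) := fun k => (S.smooth k).of_le (by simp)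
  have hgm : ∀ k, Measurable (gradient (v k)) := fun k => (continuous_gradient (hv1 k)).measurable
  have hgL : ∀ k, MemLp (gradient (v k)) 2 (wMeasure d s) := fun k =>
    (continuous_gradient (hv1 k)).memLp_of_hasCompactSupport
      (hasCompactSupport_gradient (S.compact k))
  have hvL : ∀ k, MemLp (v k) 2 (wMeasure d s) := fun k =>
    (hv1 k).continuous.memLp_of_hasCompactSupport (S.compact k)
  have hvL' : ∀ k, MemLp (v k) 2 (thinMeasure d) := fun k =>
    (hv1 k).continuous.memLp_of_hasCompactSupport (S.compact k)
  set φ : ℕ → Space d → ℝ := fun k x => η ‖x‖ * v k x with hφ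
  have hφt : ∀ k, IsTest (ball 0 ρ) (φ k) := by
    intro k
    obtain ⟨r₁, h0, h1, h2⟩ := h.supp
    have hsub : tsupport (φ k) ⊆ closedBall 0 r₁ := by
      refine closure_minimal (fun x hx => ?_) isClosed_closedBall
      by_contra hxr
      apply hx
      have : r₁ ≤ ‖x‖ := by simp at hxr; exact hxr.le
      simp [hφ, h2 _ this]
    exact ⟨hηn.mul (S.smooth k), (isCompact_closedBall 0 r₁).of_isClosed_subset
      (isClosed_tsupport _) hsub, hsub.trans (closedBall_subset_ball h1)⟩
  -- the operators applied to the approximations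
  set A : (Space d → ℝ) → (Space d → Space d) → Space d → Space d := fun f F x =>
    η ‖x‖ • F x + (deriv η ‖x‖ / ‖x‖ * f x) • x with hA
  have hAsub : ∀ f g F F', A f F - A g F' = A (f - g) (F - F') := by
    intro f g F F'
    ext1 x
    simp only [hA, Pi.sub_apply, smul_sub, mul_sub, sub_smul]
    abel
  have hAm : ∀ (f : Space d → ℝ) (F : Space d → Space d), Measurable f → Measurable F →
      (Measurable fun x => η ‖x‖ • F x) ∧
      Measurable fun x => (deriv η ‖x‖ / ‖x‖ * f x) • x := by
    intro f F hf hF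
    have h1 : Measurable fun x : Space d => η ‖x‖ := (hη.comp continuous_norm).measurable
    have h2 : Measurable fun x : Space d => deriv η ‖x‖ / ‖x‖ := (hcd.comp continuous_norm).measurable
    exact ⟨h1.smul hF, (h2.mul hf).smul measurable_id⟩
  have hAle : ∀ (f : Space d → ℝ) (F : Space d → Space d), Measurable f → Measurable F → eLpNorm (A f F) 2 (wMeasure d s) ≤
      ENNReal.ofReal B₁ * eLpNorm F 2 (wMeasure d s) +
        ENNReal.ofReal B₂ * eLpNorm f 2 (wMeasure d s) := by
    intro f F hf hF
    refine (eLpNorm_add_le (hAm f F hf hF).1.aestronglyMeasurable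
      (hAm f F hf hF).2.aestronglyMeasurable (by norm_num)).trans (add_le_add ?_ ?_)
    · refine eLpNorm_le_mul_eLpNorm_of_ae_le_mul (ae_of_all _ fun x => ?_) 2
      rw [norm_smul]
      gcongr
      exact hb₁ _
    · exact eLpNorm_le_mul_eLpNorm_of_ae_le_mul (ae_of_all _ fun x => hcoef _ _) 2
  have hφg : ∀ k, gradient (φ k) = A (v k) (gradient (v k)) := by
    intro k
    ext1 x
    rw [hφ]
    simp only
    rw [gradient_mul (hηn.differentiable (by simp) x) ((S.smooth k).differentiable (by simp) x),
      gradient_comp_norm h, smul_smul, mul_comm (v k x)]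
  have hAL : MemLp (A u G) 2 (wMeasure d s) :=
    ⟨((hAm u G S.meas_u S.meas_G).1.add (hAm u G S.meas_u S.meas_G).2).aestronglyMeasurable,
      (hAle u G S.meas_u S.meas_G).trans_lt (ENNReal.add_lt_top.2
        ⟨ENNReal.mul_lt_top ENNReal.ofReal_lt_top S.memLp_G.eLpNorm_lt_top,
        ENNReal.mul_lt_top ENNReal.ofReal_lt_top S.memLp_u.eLpNorm_lt_top⟩)⟩
  have hφL : ∀ k, MemLp (gradient (φ k)) 2 (wMeasure d s) := fun k =>
    (continuous_gradient ((hφt k).smooth.of_le (by simp))).memLp_of_hasCompactSupport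
      (hasCompactSupport_gradient (hφt k).compact)
  have hφL' : ∀ k, MemLp (φ k) 2 (thinMeasure d) := fun k =>
    (hφt k).smooth.continuous.memLp_of_hasCompactSupport (hφt k).compact
  have hT : MemLp (fun x => η ‖x‖ * τ x) 2 (thinMeasure d) := by
    refine MemLp.of_le_mul (c := B₁) S.memLp_τ
      (((hη.comp continuous_norm).measurable.mul S.meas_τ)).aestronglyMeasurable
      (ae_of_all _ fun x => ?_)
    rw [norm_mul]
    gcongr
    exact hb₁ _
  have hAt : Tendsto (fun k => eLpNorm (gradient (φ k) - A u G) 2 (wMeasure d s)) atTop (𝓝 0) := by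
    refine tendsto_of_tendsto_of_tendsto_of_le_of_le tendsto_const_nhds ?_ (fun _ => zero_le)
      (fun k => ?_) (h := fun k =>
        ENNReal.ofReal B₁ * eLpNorm (gradient (v k) - G) 2 (wMeasure d s) +
        ENNReal.ofReal B₂ * eLpNorm (v k - u) 2 (wMeasure d s))
    · simpa using (ENNReal.Tendsto.const_mul S.tendsto_G (Or.inr ENNReal.ofReal_ne_top)).add
        (ENNReal.Tendsto.const_mul S.tendsto_u (Or.inr ENNReal.ofReal_ne_top))
    · simp only [hφg, hAsub]
      exact hAle _ _ ((hv1 k).continuous.measurable.sub S.meas_u) ((hgm k).sub S.meas_G)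
  have hTt : Tendsto (fun k => eLpNorm (φ k - fun x => η ‖x‖ * τ x) 2 (thinMeasure d)) atTop
      (𝓝 0) := by
    refine tendsto_eLpNorm_of_le (A := ENNReal.ofReal B₁) ENNReal.ofReal_ne_top (fun k => ?_)
      S.tendsto_τ
    refine eLpNorm_le_mul_eLpNorm_of_ae_le_mul (ae_of_all _ fun x => ?_) 2
    simp only [hφ, Pi.sub_apply]
    rw [← mul_sub, norm_mul]
    gcongr
    exact hb₁ _
  have hbL : MemLp (fun x => 2 * b (τ x)) 2 (thinMeasure d) := by
    refine MemLp.of_le_mul (c := 2 * K) S.memLp_τ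
      ((hb.lipschitz.continuous.measurable.comp S.meas_τ).const_mul 2).aestronglyMeasurable
      (ae_of_all _ fun x => ?_)
    rw [norm_mul, Real.norm_eq_abs, Real.norm_eq_abs, Real.norm_eq_abs, abs_two, mul_assoc]
    gcongr
    exact hb.abs_le _
  have hself : Tendsto (fun _ : ℕ => eLpNorm (G - G) 2 (wMeasure d s)) atTop (𝓝 0) := by simp
  have hself' : Tendsto (fun _ : ℕ => eLpNorm ((fun x => 2 * b (τ x)) - fun x => 2 * b (τ x)) 2
    (thinMeasure d)) atTop (𝓝 0) := by simp
  -- The equation holds for the smooth test functions `η(|x|) v k`; it passes to the limit because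
  -- their gradients and their restrictions to the thin space converge in `L²`.
  have heq : ∫ x, inner ℝ (G x) (A u G x) ∂wMeasure d s +
      ∫ x, 2 * b (τ x) * (η ‖x‖ * τ x) ∂thinMeasure d = 0 := by
    have l1 := tendsto_integral_inner S.memLp_G hAL (fun _ => S.memLp_G) hφL hself hAt
    have l2 := tendsto_integral_mul hbL hT (fun _ => hbL) hφL' hself' hTt
    have l3 := l1.add l2
    refine tendsto_nhds_unique l3 ?_
    simp_rw [fun k => S.eq (φ k) (hφt k)]
    exact tendsto_const_nhds
  rw [← heq, ← integral_add]
  · congr 1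
    · refine integral_congr_ae (ae_of_all _ fun x => ?_)
      simp only [hA, inner_add_right, inner_smul_right, real_inner_self_eq_norm_sq]
      ring
    · exact integral_congr_ae (ae_of_all _ fun x => by simp only; ring)
  · exact (integrable_norm_sq S.memLp_G).bdd_mul (c := B₁)
      (hη.comp continuous_norm).aestronglyMeasurable (ae_of_all _ fun x => hb₁ _)
  · obtain ⟨B₃, -, hb₃⟩ := exists_bound_of_hasCompactSupport hcd h.hasCompactSupport_deriv_div
    refine Integrable.bdd_mul (c := B₃) ?_
      (hcd.comp continuous_norm).aestronglyMeasurable (ae_of_all _ fun x => hb₃ _)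
    simpa [mul_comm] using integrable_inner S.memLp_u S.memLp_inner_self

end ApproxSolution
end ThinReaction

/-! ### Radial test functions, tail integrals and the layer-cake formula -/

namespace ThinReaction
open Filter Topology
open scoped ENNReal

variable {d : ℕ} {s ρ κ : ℝ} {μ σ : Measure (Space d)} {ψ : ℝ → ℝ}

/-- `ψ` is a test function on `(0, ρ)`. -/
structure IsRadialTest (ρ : ℝ) (ψ : ℝ → ℝ) : Prop where
  smooth : ContDiff ℝ ∞ ψ
  compact : HasCompactSupport ψ
  support : tsupport ψ ⊆ Ioo 0 ρ

namespace IsRadialTest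

theorem exists_Icc (h : IsRadialTest ρ ψ) (hρ : 0 < ρ) :
    ∃ a b, 0 < a ∧ a < b ∧ b < ρ ∧ ∀ r, ψ r ≠ 0 → r ∈ Icc a b := by
  -- The two additional points make the set nonempty and force `a < b`, even when `ψ` is zero.
  have hK : IsCompact (insert (ρ / 2) (insert (ρ / 3) (tsupport ψ))) :=
    (h.compact.isCompact.insert _).insert _
  have hsub : insert (ρ / 2) (insert (ρ / 3) (tsupport ψ)) ⊆ Ioo 0 ρ := by
    refine insert_subset ⟨by linarith, by linarith⟩ (insert_subset ⟨by linarith, by linarith⟩ h.support)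
  obtain ⟨a, ha, hal⟩ := hK.exists_isLeast ⟨_, mem_insert _ _⟩
  obtain ⟨b, hb, hbl⟩ := hK.exists_isGreatest ⟨_, mem_insert _ _⟩
  refine ⟨a, b, (hsub ha).1, ?_, (hsub hb).2, fun r hr => ?_⟩
  · have h1 := hal (mem_insert_of_mem _ (mem_insert (ρ / 3) _))
    have h2 := hbl (mem_insert (ρ / 2) _)
    linarith
  · have hr' := mem_insert_of_mem (ρ / 2) (mem_insert_of_mem (ρ / 3) (subset_tsupport ψ hr))
    exact ⟨hal hr', hbl hr'⟩

theorem eq_zero_of_nonpos (h : IsRadialTest ρ ψ) {r : ℝ} (hr : r ≤ 0) : ψ r = 0 := by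
  by_contra h0
  exact absurd (h.support (subset_tsupport ψ h0)).1 (not_lt.2 hr)

theorem div_pow (h : IsRadialTest ρ ψ) (m : ℕ) : IsRadialTest ρ fun r => ψ r / r ^ m := by
  refine ⟨?_, ?_, ?_⟩
  · rw [contDiff_iff_contDiffAt]
    intro r
    rcases eq_or_ne r 0 with rfl | hr
    · have h0 : (0 : ℝ) ∉ tsupport ψ := fun h0 => lt_irrefl _ (h.support h0).1
      have : (fun r => ψ r / r ^ m) =ᶠ[𝓝 0] fun _ => 0 := by
        filter_upwards [notMem_tsupport_iff_eventuallyEq.1 h0] with r hr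
        rw [hr, Pi.zero_apply, zero_div]
      exact contDiffAt_const.congr_of_eventuallyEq this
    · exact h.smooth.contDiffAt.div (contDiffAt_id.pow m) (pow_ne_zero _ hr)
  · simp only [div_eq_mul_inv]
    exact h.compact.mul_right
  · simp only [div_eq_mul_inv]
    exact (closure_mono (Function.support_mul_subset_left ψ fun r => (r ^ m)⁻¹)).trans h.support

theorem deriv (h : IsRadialTest ρ ψ) : IsRadialTest ρ (deriv ψ) :=
  ⟨h.smooth.deriv', h.compact.deriv, tsupport_deriv_subset.trans h.support⟩

/-- The profile is the tail integral of `ψ` on the half-line, extended evenly. Since `ψ` vanishes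
near the origin, the profile is constant there; it vanishes beyond the support of `ψ`. -/
theorem exists_isRadialProfile (h : IsRadialTest ρ ψ) (hρ : 0 < ρ) :
    ∃ η, IsRadialProfile ρ η ∧ (∀ r, 0 ≤ r → _root_.deriv η r = -ψ r) ∧
      ∀ r, 0 ≤ r → η r = ∫ t in Ioi r, ψ t := by
  obtain ⟨a, b, ha, hab, hb, hψ⟩ := h.exists_Icc hρ
  -- Subtracting the reflection makes `g` odd, hence its primitive even and compactly supported on
  -- both sides; on the half-line `g` is just `-ψ`.
  set g : ℝ → ℝ := fun t => ψ (-t) - ψ t with hg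
  have hgs : ContDiff ℝ ∞ g := (h.smooth.comp contDiff_neg).sub h.smooth
  have hgc := hgs.continuous
  set η : ℝ → ℝ := fun r => (∫ t in Ioi (0 : ℝ), ψ t) + ∫ t in (0 : ℝ)..r, g t with hη
  have hd : ∀ r, HasDerivAt η (g r) r := fun r =>
    ((hgc.integral_hasStrictDerivAt 0 r).hasDerivAt).const_add _
  have hde : _root_.deriv η = g := funext fun r => (hd r).deriv
  have hi : Integrable ψ := h.smooth.continuous.integrable_of_hasCompactSupport h.compact
  have hg0 : ∀ r, 0 ≤ r → g r = -ψ r := fun r hr => by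
    simp [hg, h.eq_zero_of_nonpos (neg_nonpos.2 hr)]
  have hval : ∀ r, 0 ≤ r → η r = ∫ t in Ioi r, ψ t := by
    intro r hr
    rw [hη]
    simp only
    rw [← intervalIntegral.integral_interval_add_Ioi (a := 0) (b := r) hi.integrableOn
      hi.integrableOn]
    have : ∫ t in (0 : ℝ)..r, g t = -∫ t in (0 : ℝ)..r, ψ t := by
      rw [← intervalIntegral.integral_neg]
      refine intervalIntegral.integral_congr fun t ht => ?_
      rw [uIcc_of_le hr] at ht
      exact hg0 t ht.1
    rw [this]; ring
  have hbig : ∀ r, b ≤ r → η r = 0 := by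
    intro r hr
    rw [hval r (by linarith)]
    refine setIntegral_eq_zero_of_forall_eq_zero fun t ht => ?_
    by_contra h0
    exact absurd (hψ t h0).2 (not_le.2 (hr.trans_lt ht))
  have heven : ∀ r, η (-r) = η r := by
    intro r
    simp only [hη]
    congr 1
    have h1 := intervalIntegral.integral_comp_neg (a := 0) (b := r) g
    rw [neg_zero] at h1
    rw [intervalIntegral.integral_symm, ← h1, ← intervalIntegral.integral_neg]
    refine intervalIntegral.integral_congr fun t _ => ?_
    simp [hg]
  refine ⟨η, ⟨?_, ?_, ⟨a, ha, fun r hr => ?_⟩, b, ha.trans hab, hb, hbig⟩,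
    fun r hr => by rw [hde, hg0 r hr], hval⟩
  · rw [contDiff_infty_iff_deriv, hde]
    exact ⟨fun r => (hd r).differentiableAt, hgs⟩
  · refine HasCompactSupport.intro (isCompact_Icc (a := -b) (b := b)) fun r hr => ?_
    rcases le_total b r with h1 | h1
    · exact hbig r h1
    · rw [← heven]
      refine hbig _ ?_
      by_contra h2
      exact hr ⟨by linarith, h1⟩
  · have hz : ∀ r, |r| < a → ψ r = 0 := fun r hr => by
      by_contra h0
      exact absurd (hψ r h0).1 (not_le.2 ((le_abs_self r).trans_lt hr))
    rw [hde]
    simp [hg, hz r hr, hz (-r) (by rwa [abs_neg])]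

end IsRadialTest

/-- Layer-cake formula for radial multipliers. -/
theorem integral_comp_norm_mul_eq [SFinite μ] {f : Space d → ℝ} (hf : Integrable f μ) {q E : ℝ → ℝ}
    (hq : Integrable q) (hE : ∀ r, 0 ≤ r → E r = ∫ t in Ioi r, q t) :
    ∫ x, E ‖x‖ * f x ∂μ = ∫ t, q t * ∫ x in ball 0 t, f x ∂μ := by
  have hms : MeasurableSet {p : Space d × ℝ | ‖p.1‖ < p.2} :=
    measurableSet_lt (measurable_norm.comp measurable_fst) measurable_snd
  have hi : Integrable (fun p : Space d × ℝ =>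
      {p : Space d × ℝ | ‖p.1‖ < p.2}.indicator (fun p => f p.1 * q p.2) p) (μ.prod volume) :=
    (hf.mul_prod hq).indicator hms
  have h1 : ∀ x, E ‖x‖ * f x =
      ∫ t, {p : Space d × ℝ | ‖p.1‖ < p.2}.indicator (fun p => f p.1 * q p.2) (x, t) := by
    intro x
    rw [hE _ (norm_nonneg x), mul_comm, ← integral_const_mul, ← integral_indicator measurableSet_Ioi]
    rfl
  have h2 : ∀ t, q t * ∫ x in ball 0 t, f x ∂μ =
      ∫ x, {p : Space d × ℝ | ‖p.1‖ < p.2}.indicator (fun p => f p.1 * q p.2) (x, t) ∂μ := by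
    intro t
    rw [mul_comm, ← integral_mul_const, ← integral_indicator measurableSet_ball]
    congr 1
    ext x
    simp [indicator]
  simp_rw [h1, h2]
  exact integral_integral_swap hi

theorem IsPolar.measure_sphere (h : IsPolar μ σ κ) (r : ℝ) : μ (sphere 0 r) = 0 := by
  rw [← lintegral_indicator_one isClosed_sphere.measurableSet,
    h.lintegral_eq _ (measurable_one.indicator isClosed_sphere.measurableSet)]
  refine (lintegral_congr_ae (g := fun _ => 0) ?_).trans (by simp)
  filter_upwards [h.norm_eq] with θ hθ
  refine (lintegral_congr_ae (g := fun _ => 0) ?_).trans (by simp)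
  have : ∀ᵐ t : ℝ ∂volume.restrict (Ioi 0), t ≠ r :=
    ae_restrict_of_ae (Measure.ae_ne volume r)
  filter_upwards [this, ae_restrict_mem measurableSet_Ioi] with t ht ht0
  have : t • θ ∉ sphere (0 : Space d) r := by
    rw [mem_sphere_zero_iff_norm, norm_smul, hθ, mul_one, Real.norm_eq_abs, abs_of_pos ht0]
    exact ht
  rw [indicator_of_notMem this, mul_zero]

/-- Dominated convergence: the indicators of the balls converge off a sphere, and spheres are null
for a polar measure. -/
theorem IsPolar.continuousOn_setIntegral_ball (h : IsPolar μ σ κ) {f : Space d → ℝ}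
    (hf : Integrable f μ) : ContinuousOn (fun r => ∫ x in ball 0 r, f x ∂μ) (Ioi 0) := by
  intro r _
  refine ContinuousAt.continuousWithinAt ?_
  simp_rw [← integral_indicator measurableSet_ball]
  refine continuousAt_of_dominated (bound := fun x => ‖f x‖)
    (Eventually.of_forall fun t => hf.aestronglyMeasurable.indicator measurableSet_ball)
    (Eventually.of_forall fun t => ae_of_all _ fun x => norm_indicator_le_norm_self _ _)
    hf.norm ?_
  have : ∀ᵐ x ∂μ, x ∉ sphere (0 : Space d) r := measure_eq_zero_iff_ae_notMem.1 (h.measure_sphere r)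
  filter_upwards [this] with x hx
  rw [mem_sphere_zero_iff_norm] at hx
  rcases lt_or_gt_of_ne hx with hx | hx
  · have : (fun t => (ball (0 : Space d) t).indicator f x) =ᶠ[𝓝 r] fun _ => f x := by
      filter_upwards [lt_mem_nhds hx] with t ht
      exact indicator_of_mem (by simpa using ht) _
    exact continuousAt_const.congr_of_eventuallyEq this
  · have : (fun t => (ball (0 : Space d) t).indicator f x) =ᶠ[𝓝 r] fun _ => 0 := by
      filter_upwards [gt_mem_nhds hx] with t ht
      exact indicator_of_notMem (by simpa using ht.le) _
    exact continuousAt_const.congr_of_eventuallyEq this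

theorem IsPolar.sfinite (h : IsPolar μ σ κ) : SFinite μ := by
  have := h.finite
  rw [← h.measurePreserving.map_eq]
  infer_instance

end ThinReaction

/-! ### Restrictions to spheres and their limits -/

namespace ThinReaction
open Filter Topology
open scoped ENNReal

variable {d : ℕ} {s ρ κ : ℝ} {μ σ : Measure (Space d)} {b : ℝ → ℝ} {u : Space d → ℝ}
  {G : Space d → Space d} {τ : Space d → ℝ} {v : ℕ → Space d → ℝ}

/-- Traces on spheres are controlled by the first-order Sobolev energy. -/
theorem lintegral_enorm_smul_sq_le (hμ : IsPolar μ σ κ) (hκ : 0 ≤ κ) {r : ℝ} (hr : 0 < r)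
    {f : Space d → ℝ} (hf : ContDiff ℝ 1 f) (hfc : HasCompactSupport f) :
    ∫⁻ θ, ‖f (r • θ)‖ₑ ^ 2 ∂σ ≤
      ENNReal.ofReal (r ^ (-κ)) * ∫⁻ x, (‖f x‖ₑ ^ 2 + ‖gradient f x‖ₑ ^ 2) ∂μ := by
  have hgc := continuous_gradient hf
  have hfcont := hf.continuous
  have hm : Measurable fun x => ‖f x‖ₑ ^ 2 + ‖gradient f x‖ₑ ^ 2 :=
    (hfcont.measurable.enorm.pow_const 2).add (hgc.measurable.enorm.pow_const 2)
  rw [hμ.lintegral_eq _ hm, ← lintegral_const_mul' _ _ ENNReal.ofReal_ne_top]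
  refine lintegral_mono_ae ?_
  filter_upwards [hμ.norm_eq] with θ hθ
  have hline : ∀ t, HasDerivAt (fun t : ℝ => f (t • θ)) (inner ℝ (gradient f (t • θ)) θ) t := by
    intro t
    have h1 := (hf.differentiable (by simp) (t • θ)).hasFDerivAt.comp_hasDerivAt t
      ((hasDerivAt_id t).smul_const θ)
    rw [one_smul, ← inner_gradient_left] at h1
    exact h1
  have hcl : Topology.IsClosedEmbedding fun t : ℝ => t • θ := by
    have : Isometry fun t : ℝ => t • θ := Isometry.of_dist_eq fun t r => by
      rw [dist_eq_norm, ← sub_smul, norm_smul, hθ, mul_one, dist_eq_norm]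
    exact this.isClosedEmbedding
  have hgs : ContDiff ℝ 1 fun t : ℝ => f (t • θ) ^ 2 :=
    (hf.comp (contDiff_id.smul contDiff_const)).pow 2
  have hgcs : HasCompactSupport fun t : ℝ => f (t • θ) ^ 2 :=
    (hfc.comp_isClosedEmbedding hcl).comp_left (g := fun y : ℝ => y ^ 2) (by simp)
  have hderiv : deriv (fun t : ℝ => f (t • θ) ^ 2) =
      fun t => 2 * f (t • θ) * inner ℝ (gradient f (t • θ)) θ := by
    ext t
    simpa using ((hline t).fun_pow 2).deriv
  have h1 := hgcs.integral_Ioi_deriv_eq hgs r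
  -- By compact support, `f(rθ)²` is minus the integral of the derivative of `f²` along the ray from
  -- radius `r` to infinity.
  have h2 : ‖f (r • θ)‖ₑ ^ 2 ≤ ∫⁻ t in Ioi r, ‖deriv (fun t : ℝ => f (t • θ) ^ 2) t‖ₑ := by
    refine le_trans (le_of_eq ?_) (enorm_integral_le_lintegral_enorm _)
    rw [h1, enorm_neg, enorm_pow]
  refine h2.trans ?_
  rw [← lintegral_const_mul' _ _ ENNReal.ofReal_ne_top]
  refine (lintegral_mono_set (Ioi_subset_Ioi hr.le)).trans' ?_
  refine setLIntegral_mono' measurableSet_Ioi fun t ht => ?_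
  have ht0 : 0 < t := hr.trans ht
  -- The radial density is inserted at the price of `r^(-κ)`, since `t^κ ≥ r^κ` for `t > r` and `κ ≥
  -- 0`.
  have h3 : 1 ≤ ENNReal.ofReal (r ^ (-κ)) * ENNReal.ofReal (t ^ κ) := by
    rw [← ENNReal.ofReal_mul (by positivity), ENNReal.one_le_ofReal, Real.rpow_neg hr.le,
      ← div_eq_inv_mul, one_le_div (by positivity)]
    exact Real.rpow_le_rpow hr.le (le_of_lt ht) hκ
  rw [← mul_assoc]
  refine le_trans ?_ (le_mul_of_one_le_left' h3)
  rw [hderiv]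
  simp only
  rw [← ofReal_norm, ← ofReal_norm, ← ofReal_norm, ← ENNReal.ofReal_pow (norm_nonneg _),
    ← ENNReal.ofReal_pow (norm_nonneg _), ← ENNReal.ofReal_add (sq_nonneg _) (sq_nonneg _)]
  refine ENNReal.ofReal_le_ofReal ?_
  rw [norm_mul, norm_mul]
  have h4 : ‖(inner ℝ (gradient f (t • θ)) θ : ℝ)‖ ≤ ‖gradient f (t • θ)‖ := by
    simpa [hθ] using norm_inner_le_norm (𝕜 := ℝ) (gradient f (t • θ)) θ
  have h5 : ‖(2 : ℝ)‖ = 2 := by norm_num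
  rw [h5]
  nlinarith [sq_nonneg (‖f (t • θ)‖ - ‖gradient f (t • θ)‖), norm_nonneg (f (t • θ)),
    mul_le_mul_of_nonneg_left h4 (norm_nonneg (f (t • θ)))]

theorem eLpNorm_smul_le (hμ : IsPolar μ σ κ) (hκ : 0 ≤ κ) {r : ℝ} (hr : 0 < r)
    {f : Space d → ℝ} (hf : ContDiff ℝ 1 f) (hfc : HasCompactSupport f) :
    eLpNorm (fun θ => f (r • θ)) 2 σ ≤ ENNReal.ofReal (r ^ (-κ)) ^ (1 / 2 : ℝ) *
      (eLpNorm f 2 μ + eLpNorm (gradient f) 2 μ) := by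
  rw [eLpNorm_two_eq, eLpNorm_two_eq, eLpNorm_two_eq]
  refine (ENNReal.rpow_le_rpow (lintegral_enorm_smul_sq_le hμ hκ hr hf hfc)
    (by norm_num)).trans ?_
  rw [ENNReal.mul_rpow_of_nonneg _ _ (by norm_num),
    lintegral_add_left (hf.continuous.measurable.enorm.pow_const 2)]
  gcongr
  exact ENNReal.rpow_add_le_add_rpow _ _ (by norm_num) (by norm_num)

theorem gradient_sub {f g : Space d → ℝ} (hf : Differentiable ℝ f) (hg : Differentiable ℝ g) :
    gradient (f - g) = gradient f - gradient g := by
  ext1 x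
  refine ext_inner_right ℝ fun e => ?_
  rw [Pi.sub_apply, inner_sub_left, inner_gradient_left, inner_gradient_left, inner_gradient_left,
    fderiv_sub (hf x) (hg x)]
  rfl

theorem memLp_comp_smul [IsFiniteMeasure σ] (hσ : ∀ᵐ θ ∂σ, ‖θ‖ = 1) {f : Space d → ℝ}
    (hf : Continuous f) (r : ℝ) : MemLp (fun θ => f (r • θ)) 2 σ := by
  obtain ⟨C, hC⟩ := (isCompact_sphere (0 : Space d) 1).exists_bound_of_continuousOn
    (f := fun θ => f (r • θ)) (by fun_prop)
  refine MemLp.of_bound (Continuous.aestronglyMeasurable (by fun_prop)) C ?_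
  filter_upwards [hσ] with θ hθ
  exact hC θ (by simpa using hθ)

/-- A Cauchy sequence of square integrable functions, with explicit modulus, has a limit. -/
theorem exists_memLp_of_eLpNorm_sub_le {α : Type*} [MeasurableSpace α] {ν : Measure α}
    {f : ℕ → α → ℝ} (hf : ∀ k, MemLp (f k) 2 ν) {δ : ℕ → ℝ≥0∞} (hδ : Tendsto δ atTop (𝓝 0))
    (h : ∀ k m, eLpNorm (f k - f m) 2 ν ≤ δ k + δ m) :
    ∃ g : α → ℝ, Measurable g ∧ MemLp g 2 ν ∧ ∀ k, eLpNorm (f k - g) 2 ν ≤ δ k := by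
  set F : ℕ → Lp ℝ 2 ν := fun k => (hf k).toLp (f k) with hF
  have hFd : ∀ k m, edist (F k) (F m) ≤ δ k + δ m := fun k m => by
    rw [hF, Lp.edist_toLp_toLp]; exact h k m
  have hc : CauchySeq F := by
    rw [EMetric.cauchySeq_iff]
    intro ε hε
    obtain ⟨N, hN⟩ := eventually_atTop.1 (hδ.eventually_lt_const (ENNReal.half_pos hε.ne'))
    refine ⟨N, fun m hm n hn => (hFd m n).trans_lt ?_⟩
    rw [← ENNReal.add_halves ε]
    exact ENNReal.add_lt_add (hN m hm) (hN n hn)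
  obtain ⟨g, hg⟩ := cauchySeq_tendsto_of_complete hc
  refine ⟨g, (Lp.stronglyMeasurable g).measurable, Lp.memLp g, fun k => ?_⟩
  have h1 : edist (F k) g ≤ δ k := by
    refine le_of_tendsto_of_tendsto' (tendsto_const_nhds.edist hg)
      (by simpa using tendsto_const_nhds.add hδ : Tendsto (fun m => δ k + δ m) atTop (𝓝 (δ k)))
      fun m => hFd k m
  refine le_trans (le_of_eq ?_) h1
  rw [Lp.edist_def]
  refine eLpNorm_congr_ae ?_
  filter_upwards [(hf k).coeFn_toLp] with x hx
  simp [hF, hx]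

theorem isPolar_exponent_nonneg (hs : s ∈ Ioo (0 : ℝ) 1) (hd : 1 ≤ d) :
    0 ≤ (d : ℝ) + (1 - 2 * s) := by
  have : (1 : ℝ) ≤ d := by exact_mod_cast hd
  linarith [hs.2]

/-- Traces of `u` on the spheres centred at the origin, as limits of the traces of the
approximations. -/
structure IsSliceFamily (s : ℝ) (v : ℕ → Space d → ℝ) (δ : ℕ → ℝ≥0∞) (T : ℝ → Space d → ℝ) :
    Prop where
  meas : ∀ r, 0 < r → Measurable (T r)
  memLp : ∀ r, 0 < r → MemLp (T r) 2 (wSphereMeasure d s)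
  tendsto : Tendsto δ atTop (𝓝 0)
  le : ∀ k r, 0 < r → eLpNorm ((fun θ => v k (r • θ)) - T r) 2 (wSphereMeasure d s) ≤
    ENNReal.ofReal (r ^ (-((d : ℝ) + (1 - 2 * s)))) ^ (1 / 2 : ℝ) * δ k

/-- The sphere bound, applied to differences of the approximations, makes their restrictions to each
sphere Cauchy. The modulus of convergence factors into a power of `r` and a null sequence
independent of `r`. -/
theorem ApproxSolution.exists_isSliceFamily (S : ApproxSolution s ρ b u G τ v)
    (hs : s ∈ Ioo (0 : ℝ) 1) (hd : 1 ≤ d) : ∃ δ T, IsSliceFamily s v δ T := by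
  have hμ := isPolar_wMeasure (d := d) hs
  have := hμ.finite
  set δ : ℕ → ℝ≥0∞ := fun k => eLpNorm (v k - u) 2 (wMeasure d s) +
    eLpNorm (gradient (v k) - G) 2 (wMeasure d s) with hδ
  have hδ0 : Tendsto δ atTop (𝓝 0) := by simpa using S.tendsto_u.add S.tendsto_G
  have hv1 : ∀ k, ContDiff ℝ 1 (v k) := fun k => (S.smooth k).of_le (by simp)
  have key : ∀ r, 0 < r → ∃ g : Space d → ℝ, Measurable g ∧ MemLp g 2 (wSphereMeasure d s) ∧
      ∀ k, eLpNorm ((fun θ => v k (r • θ)) - g) 2 (wSphereMeasure d s) ≤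
        ENNReal.ofReal (r ^ (-((d : ℝ) + (1 - 2 * s)))) ^ (1 / 2 : ℝ) * δ k := by
    intro r hr
    refine exists_memLp_of_eLpNorm_sub_le
      (fun k => memLp_comp_smul hμ.norm_eq (S.smooth k).continuous r) ?_ fun k m => ?_
    · simpa using ENNReal.Tendsto.const_mul hδ0
        (Or.inr (ENNReal.rpow_ne_top_of_nonneg (by norm_num) ENNReal.ofReal_ne_top))
    · rw [← mul_add]
      refine (eLpNorm_smul_le hμ (isPolar_exponent_nonneg hs hd) hr ((hv1 k).sub (hv1 m))
        ((S.compact k).sub (S.compact m))).trans (mul_le_mul' le_rfl ?_)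
      have e1 : v k - v m = (v k - u) - (v m - u) := by abel
      have e2 : gradient (v k - v m) = (gradient (v k) - G) - (gradient (v m) - G) := by
        rw [gradient_sub ((hv1 k).differentiable (by simp)) ((hv1 m).differentiable (by simp))]
        abel
      have m1 : ∀ k, AEStronglyMeasurable (v k - u) (wMeasure d s) := fun k =>
        ((hv1 k).continuous.measurable.sub S.meas_u).aestronglyMeasurable
      have m2 : ∀ k, AEStronglyMeasurable (gradient (v k) - G) (wMeasure d s) := fun k =>
        ((continuous_gradient (hv1 k)).measurable.sub S.meas_G).aestronglyMeasurable
      change eLpNorm (v k - v m) 2 _ + eLpNorm (gradient (v k - v m)) 2 _ ≤ _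
      rw [e2, e1, hδ]
      refine (add_le_add (eLpNorm_sub_le (m1 k) (m1 m) (by norm_num))
        (eLpNorm_sub_le (m2 k) (m2 m) (by norm_num))).trans (le_of_eq ?_)
      simp only
      abel
  choose! T hT1 hT2 hT3 using key
  exact ⟨δ, T, hT1, hT2, hδ0, fun k r hr => hT3 r hr k⟩

theorem abs_sqrt_sub_sqrt_le {α : Type*} [MeasurableSpace α] {ν : Measure α} {f g : α → ℝ}
    (hf : MemLp f 2 ν) (hg : MemLp g 2 ν) :
    |√(∫ x, f x ^ 2 ∂ν) - √(∫ x, g x ^ 2 ∂ν)| ≤ (eLpNorm (f - g) 2 ν).toReal := by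
  have e : ∀ f : α → ℝ, ∀ hf : MemLp f 2 ν, √(∫ x, f x ^ 2 ∂ν) = ‖hf.toLp f‖ := by
    intro f hf
    rw [Lp.norm_toLp, eLpNorm_two_eq, ← ENNReal.toReal_rpow,
      ← integral_norm_sq_eq_toReal hf.aestronglyMeasurable, Real.sqrt_eq_rpow]
    simp
  rw [e f hf, e g hg, ← Lp.norm_toLp _ (hf.sub hg), MemLp.toLp_sub]
  exact abs_norm_sub_norm_le _ _

namespace IsSliceFamily
variable {δ : ℕ → ℝ≥0∞} {T : ℝ → Space d → ℝ}

theorem tendsto_eLpNorm (h : IsSliceFamily s v δ T) {r : ℝ} (hr : 0 < r) :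
    Tendsto (fun k => eLpNorm ((fun θ => v k (r • θ)) - T r) 2 (wSphereMeasure d s)) atTop
      (𝓝 0) := by
  refine tendsto_of_tendsto_of_tendsto_of_le_of_le tendsto_const_nhds ?_ (fun _ => zero_le)
    fun k => h.le k r hr
  simpa using ENNReal.Tendsto.const_mul h.tendsto
    (Or.inr (ENNReal.rpow_ne_top_of_nonneg (by norm_num) ENNReal.ofReal_ne_top))

/-- Square roots turn the integrals into `L²` norms, which differ by at most the norm of the
difference; the factor `r^(-κ/2)` is bounded for `r > a`. -/
theorem tendstoUniformlyOn_sqrt (h : IsSliceFamily s v δ T) (hs : s ∈ Ioo (0 : ℝ) 1) (hd : 1 ≤ d)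
    (hv : ∀ k, Continuous (v k)) {a : ℝ} (ha : 0 < a) :
    TendstoUniformlyOn (fun k r => √(∫ θ, v k (r • θ) ^ 2 ∂wSphereMeasure d s))
      (fun r => √(∫ θ, T r θ ^ 2 ∂wSphereMeasure d s)) atTop (Ioi a) := by
  have hμ := isPolar_wMeasure (d := d) hs
  have := hμ.finite
  rw [Metric.tendstoUniformlyOn_iff]
  intro ε hε
  set A := ENNReal.ofReal (a ^ (-((d : ℝ) + (1 - 2 * s)))) ^ (1 / 2 : ℝ) with hA
  have hAt : A ≠ ⊤ := ENNReal.rpow_ne_top_of_nonneg (by norm_num) ENNReal.ofReal_ne_top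
  have h1 : Tendsto (fun k => A * δ k) atTop (𝓝 0) := by
    simpa using ENNReal.Tendsto.const_mul h.tendsto (Or.inr hAt)
  filter_upwards [h1.eventually_lt_const (ENNReal.ofReal_pos.2 hε)] with k hk r hr
  have hr0 : 0 < r := ha.trans hr
  rw [dist_comm, Real.dist_eq]
  refine (abs_sqrt_sub_sqrt_le (memLp_comp_smul hμ.norm_eq (hv k) r) (h.memLp r hr0)).trans_lt ?_
  rw [← ENNReal.lt_ofReal_iff_toReal_lt
    ((memLp_comp_smul hμ.norm_eq (hv k) r).sub (h.memLp r hr0)).eLpNorm_ne_top]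
  refine (h.le k r hr0).trans_lt (lt_of_le_of_lt ?_ hk)
  gcongr
  refine ENNReal.rpow_le_rpow (ENNReal.ofReal_le_ofReal ?_) (by norm_num)
  exact Real.rpow_le_rpow_of_nonpos ha (le_of_lt hr)
    (neg_nonpos.2 (isPolar_exponent_nonneg hs hd))

theorem continuous_integral_smul [IsFiniteMeasure σ] (hσ : ∀ᵐ θ ∂σ, ‖θ‖ = 1) {f : ℝ → Space d → ℝ}
    (hf : Continuous (Function.uncurry f)) :
    Continuous fun r : ℝ => ∫ θ, f r θ ∂σ := by
  rw [continuous_iff_continuousAt]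
  intro r₀
  obtain ⟨C, hC⟩ := ((isCompact_Icc (a := r₀ - 1) (b := r₀ + 1)).prod
    (isCompact_sphere (0 : Space d) 1)).exists_bound_of_continuousOn hf.continuousOn
  refine continuousAt_of_dominated (bound := fun _ => C) (Eventually.of_forall fun r =>
    (hf.comp (continuous_const.prodMk continuous_id)).aestronglyMeasurable) ?_
    (integrable_const _) (ae_of_all _ fun θ =>
      (hf.comp (continuous_id.prodMk continuous_const)).continuousAt)
  filter_upwards [Icc_mem_nhds (by linarith : r₀ - 1 < r₀) (by linarith : r₀ < r₀ + 1)] with r hr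
  filter_upwards [hσ] with θ hθ
  exact hC (r, θ) ⟨hr, by simpa using hθ⟩

/-- The functions of `r` belonging to the smooth approximations are continuous, and they converge
uniformly away from the origin. -/
theorem continuousOn_integral_sq (h : IsSliceFamily s v δ T) (hs : s ∈ Ioo (0 : ℝ) 1) (hd : 1 ≤ d)
    (hv : ∀ k, Continuous (v k)) :
    ContinuousOn (fun r => ∫ θ, T r θ ^ 2 ∂wSphereMeasure d s) (Ioi 0) := by
  have hμ := isPolar_wMeasure (d := d) hs
  have := hμ.finite
  intro r hr
  have hr' : (0 : ℝ) < r := hr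
  refine ContinuousAt.continuousWithinAt ?_
  have h1 : ContinuousOn (fun r => √(∫ θ, T r θ ^ 2 ∂wSphereMeasure d s)) (Ioi (r / 2)) := by
    refine (h.tendstoUniformlyOn_sqrt hs hd hv (by linarith)).continuousOn
      (Frequently.of_forall fun k => ?_)
    refine (Real.continuous_sqrt.comp (continuous_integral_smul hμ.norm_eq
      (f := fun r θ => v k (r • θ) ^ 2) ?_)).continuousOn
    have := hv k
    simp only [Function.uncurry_def]
    fun_prop
  have h2 := (h1.continuousAt (x := r) (Ioi_mem_nhds (half_lt_self hr'))).fun_pow 2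
  refine h2.congr (Eventually.of_forall fun t => ?_)
  exact Real.sq_sqrt (integral_nonneg fun θ => sq_nonneg _)

theorem tendsto_integral_sq (h : IsSliceFamily s v δ T) (hs : s ∈ Ioo (0 : ℝ) 1)
    (hv : ∀ k, Continuous (v k)) {r : ℝ} (hr : 0 < r) :
    Tendsto (fun k => ∫ θ, v k (r • θ) ^ 2 ∂wSphereMeasure d s) atTop
      (𝓝 (∫ θ, T r θ ^ 2 ∂wSphereMeasure d s)) := by
  have hμ := isPolar_wMeasure (d := d) hs
  have := hμ.finite
  simpa using tendsto_integral_norm_sq (h.memLp r hr)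
    (fun k => memLp_comp_smul hμ.norm_eq (hv k) r) (h.tendsto_eLpNorm hr)

end IsSliceFamily
end ThinReaction

/-! ### The Gauss-Green formula on balls and the traces on spheres -/

namespace ThinReaction
open Filter Topology
open scoped ENNReal

variable {d : ℕ} {s ρ κ : ℝ} {μ σ : Measure (Space d)} {b : ℝ → ℝ} {u : Space d → ℝ}
  {G : Space d → Space d} {τ : Space d → ℝ} {v : ℕ → Space d → ℝ}

/-- This is the divergence theorem averaged over radii. Integration by parts against the profile
`η(|x|)` with `η' = -ψ` gives the left side through the layer-cake formula and the right side in
polar coordinates. -/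
theorem integral_mul_setIntegral_ball_fderiv {F : Space d → ℝ} (hF : ContDiff ℝ 1 F)
    (hFc : HasCompactSupport F) (e : Space d) {ψ : ℝ → ℝ} (hψ : IsRadialTest ρ ψ) (hρ : 0 < ρ) :
    ∫ r, ψ r * ∫ x in ball 0 r, fderiv ℝ F x e =
      ∫ r, ψ r * (r ^ d * ∫ θ, F (r • θ) * inner ℝ θ e ∂unitSphereMeasure (Space d)) := by
  obtain ⟨η, hη, hdη, hηi⟩ := hψ.exists_isRadialProfile hρ
  have hpol := isPolar_volume d
  have hηs := hη.contDiff_comp_norm (d := d)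
  have hFd : Continuous fun x => fderiv ℝ F x e :=
    (hF.continuous_fderiv (by simp)).clm_apply continuous_const
  have hFdc : HasCompactSupport fun x => fderiv ℝ F x e :=
    (hFc.fderiv ℝ).comp_left (g := fun L : Space d →L[ℝ] ℝ => L e) (by simp)
  have hηd : Continuous fun x : Space d => fderiv ℝ (fun x : Space d => η ‖x‖) x e :=
    (hηs.continuous_fderiv (by simp)).clm_apply continuous_const
  have hcoef : ∀ x : Space d, fderiv ℝ (fun x : Space d => η ‖x‖) x e * F x =
      -(ψ ‖x‖ / ‖x‖ * inner ℝ x e * F x) := by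
    intro x
    rw [(hη.hasFDerivAt_comp_norm x).fderiv, hdη _ (norm_nonneg x)]
    simp only [smul_apply, innerSL_apply_apply, smul_eq_mul]
    ring
  have hi : Integrable fun x : Space d => fderiv ℝ (fun x : Space d => η ‖x‖) x e * F x :=
    (hηd.mul hF.continuous).integrable_of_hasCompactSupport hFc.mul_left
  have h1 := integral_mul_fderiv_eq_neg_fderiv_mul_of_integrable (μ := volume) (v := e)
    (f := fun x : Space d => η ‖x‖) (g := F) hi
    ((hηs.continuous.mul hFd).integrable_of_hasCompactSupport hFdc.mul_left)
    ((hηs.continuous.mul hF.continuous).integrable_of_hasCompactSupport hFc.mul_left)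
    (fun x _ => hηs.differentiable (by simp) x) (fun x _ => hF.differentiable (by simp) x)
  rw [integral_comp_norm_mul_eq (hFd.integrable_of_hasCompactSupport hFdc)
    (hψ.smooth.continuous.integrable_of_hasCompactSupport hψ.compact) hηi] at h1
  rw [h1, ← integral_neg]
  have e1 : ∫ x : Space d, -(fderiv ℝ (fun x : Space d => η ‖x‖) x e * F x) =
      ∫ x : Space d, ψ ‖x‖ / ‖x‖ * inner ℝ x e * F x :=
    integral_congr_ae (ae_of_all _ fun x => by simp only; rw [hcoef, neg_neg])
  have hi' : Integrable fun x : Space d => ψ ‖x‖ / ‖x‖ * inner ℝ x e * F x :=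
    hi.neg.congr (ae_of_all _ fun x => by simp only [Pi.neg_apply]; rw [hcoef, neg_neg])
  rw [e1, hpol.integral_eq_swap hi']
  have hzero : ∀ r, r ∉ Ioi (0 : ℝ) → ψ r * (r ^ d *
      ∫ θ, F (r • θ) * inner ℝ θ e ∂unitSphereMeasure (Space d)) = 0 := fun r hr => by
    rw [hψ.eq_zero_of_nonpos (not_lt.1 hr), zero_mul]
  rw [← setIntegral_eq_integral_of_forall_compl_eq_zero hzero]
  refine setIntegral_congr_fun measurableSet_Ioi fun r hr => ?_
  have hr' : (0 : ℝ) < r := hr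
  rw [Real.rpow_natCast, ← integral_const_mul, ← integral_const_mul, ← integral_const_mul]
  refine integral_congr_ae ?_
  filter_upwards [hpol.norm_eq] with θ hθ
  rw [norm_smul, hθ, Real.norm_eq_abs, abs_of_pos hr', inner_smul_left]
  simp only [mul_one, RCLike.conj_to_real]
  field_simp

/-- The divergence theorem on balls. -/
theorem setIntegral_ball_fderiv {F : Space d → ℝ} (hF : ContDiff ℝ 1 F)
    (hFc : HasCompactSupport F) (e : Space d) {r : ℝ} (hr : 0 < r) :
    ∫ x in ball 0 r, fderiv ℝ F x e =
      r ^ d * ∫ θ, F (r • θ) * inner ℝ θ e ∂unitSphereMeasure (Space d) := by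
  have hpol := isPolar_volume d
  have hFd : Continuous fun x => fderiv ℝ F x e :=
    (hF.continuous_fderiv (by simp)).clm_apply continuous_const
  have hFdc : HasCompactSupport fun x => fderiv ℝ F x e :=
    (hFc.fderiv ℝ).comp_left (g := fun L : Space d →L[ℝ] ℝ => L e) (by simp)
  have hFcont := hF.continuous
  have hA : ContinuousOn (fun r => ∫ x in ball 0 r, fderiv ℝ F x e) (Ioi 0) :=
    hpol.continuousOn_setIntegral_ball (hFd.integrable_of_hasCompactSupport hFdc)
  have hQ : Continuous fun r : ℝ =>
      ∫ θ, F (r • θ) * inner ℝ θ e ∂unitSphereMeasure (Space d) := by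
    refine IsSliceFamily.continuous_integral_smul hpol.norm_eq
      (f := fun r θ => F (r • θ) * inner ℝ θ e) ?_
    simp only [Function.uncurry_def]
    fun_prop
  have hB : ContinuousOn (fun r : ℝ =>
      r ^ d * ∫ θ, F (r • θ) * inner ℝ θ e ∂unitSphereMeasure (Space d)) (Ioi 0) :=
    ((continuous_id.pow d).mul hQ).continuousOn
  -- The two sides agree as distributions in `r`; being continuous, they agree at every radius.
  have hae := isOpen_Ioi.ae_eq_zero_of_integral_contDiff_smul_eq_zero (μ := volume)
    ((hA.sub hB).locallyIntegrableOn measurableSet_Ioi) (fun g hg hgc hgs => by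
      obtain ⟨R, hR⟩ := hgc.isCompact.isBounded.subset_ball 0
      have hψ : IsRadialTest (max R 1) g := ⟨hg, hgc, fun t ht => ⟨hgs ht, by
        have h1 := hR ht
        rw [mem_ball_zero_iff, Real.norm_eq_abs] at h1
        exact (le_abs_self t).trans_lt (h1.trans_le (le_max_left _ _))⟩⟩
      have hcs : ∀ q : ℝ → ℝ, ContinuousOn q (Ioi 0) → Integrable fun r => g r * q r := by
        intro q hq
        have hsub : Function.support (fun r => g r * q r) ⊆ tsupport g :=
          (Function.support_mul_subset_left _ _).trans subset_closure
        rw [← integrableOn_iff_integrable_of_support_subset hsub]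
        exact (hg.continuous.continuousOn.mul (hq.mono hgs)).integrableOn_compact hgc.isCompact
      simp only [smul_eq_mul, Pi.sub_apply, mul_sub]
      rw [integral_sub (hcs _ hA) (hcs _ hB), sub_eq_zero]
      exact integral_mul_setIntegral_ball_fderiv hF hFc e hψ (by positivity))
  have hae' : (fun r => ∫ x in ball 0 r, fderiv ℝ F x e) =ᵐ[volume.restrict (Ioi 0)] fun r : ℝ =>
      r ^ d * ∫ θ, F (r • θ) * inner ℝ θ e ∂unitSphereMeasure (Space d) := by
    rw [EventuallyEq, ae_restrict_iff' measurableSet_Ioi]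
    filter_upwards [hae] with t ht h0
    exact sub_eq_zero.1 (ht h0)
  exact Measure.eqOn_open_of_ae_eq hae' isOpen_Ioi hA hB hr

/-- The equator spans a cone contained in the null set `{xₙ = 0}`; in polar coordinates an equator
of positive measure would give this cone positive volume. -/
theorem ae_unitSphereMeasure_last_ne_zero (d : ℕ) :
    ∀ᵐ θ ∂unitSphereMeasure (Space d), θ (Fin.last d) ≠ 0 := by
  have hm : MeasurableSet {x : Space d | x (Fin.last d) = 0} :=
    measurable_last (measurableSet_singleton (0 : ℝ))
  have h0 : (volume : Measure (Space d)) {x : Space d | x (Fin.last d) = 0} = 0 := by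
    simpa [ae_iff] using ae_last_ne_zero d
  rw [← lintegral_indicator_one hm,
    (isPolar_volume d).lintegral_eq _ (measurable_one.indicator hm),
    lintegral_eq_zero_iff ((IsPolar.measurable_inner (d : ℝ)
      (measurable_one.indicator hm)).lintegral_prod_right')] at h0
  filter_upwards [h0] with θ hθ h1
  have hm2 : Measurable fun t : ℝ => ENNReal.ofReal (t ^ (d : ℝ)) *
      {x : Space d | x (Fin.last d) = 0}.indicator 1 (t • θ) :=
    (IsPolar.measurable_inner (d : ℝ) (measurable_one.indicator hm)).comp measurable_prodMk_left
  rw [Pi.zero_apply, lintegral_eq_zero_iff hm2,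
    EventuallyEq, ae_restrict_iff' measurableSet_Ioi] at hθ
  have h2 : ∀ᵐ t : ℝ, t ∉ Ioi (0 : ℝ) := by
    filter_upwards [hθ] with t ht h3
    have h4 := ht h3
    have h5 : t • θ ∈ {x : Space d | x (Fin.last d) = 0} := by simp [h1]
    rw [indicator_of_mem h5] at h4
    simp only [Pi.one_apply, mul_one, Pi.zero_apply, ENNReal.ofReal_eq_zero] at h4
    exact absurd h4 (not_le.2 (Real.rpow_pos_of_pos h3 _))
  have h3 := measure_eq_zero_iff_ae_notMem.2 h2
  simp at h3

/-- Weighted `L²` convergence implies convergence of integrals against bounded functions, when the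
inverse weight is integrable. -/
theorem tendsto_integral_mul_of_withDensity {α F : Type*} [MeasurableSpace α]
    {ν : Measure α} {W V : α → ℝ≥0∞} (hW : Measurable W) (hV : Measurable V)
    (h : ∀ᵐ x ∂ν, W x * V x = 1) (hVi : ∫⁻ x, V x ∂ν ≠ ⊤) [NormedAddCommGroup F]
    [InnerProductSpace ℝ F] {f : ℕ → α → F} {g : α → F}
    (hf : ∀ k, AEStronglyMeasurable (f k) ν) (hg : AEStronglyMeasurable g ν)
    (hfL : ∀ k, eLpNorm (f k) 2 (ν.withDensity W) ≠ ⊤) (hgL : eLpNorm g 2 (ν.withDensity W) ≠ ⊤)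
    (ht : Tendsto (fun k => eLpNorm (f k - g) 2 (ν.withDensity W)) atTop (𝓝 0))
    {c : α → F} (hc : AEStronglyMeasurable c ν) {B : ℝ} (hB : ∀ᵐ x ∂ν, ‖c x‖ ≤ B) :
    Integrable g ν ∧ (∀ k, Integrable (fun x => inner ℝ (f k x) (c x)) ν) ∧
      Integrable (fun x => inner ℝ (g x) (c x)) ν ∧
      Tendsto (fun k => ∫ x, inner ℝ (f k x) (c x) ∂ν) atTop
        (𝓝 (∫ x, inner ℝ (g x) (c x) ∂ν)) := by
  have hV' : (∫⁻ x, V x ∂ν) ^ (1 / 2 : ℝ) ≠ ⊤ :=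
    ENNReal.rpow_ne_top_of_nonneg (by norm_num) hVi
  have hint : ∀ f : α → F, AEStronglyMeasurable f ν → eLpNorm f 2 (ν.withDensity W) ≠ ⊤ →
      Integrable f ν := fun f hf hfL => ⟨hf, (lintegral_enorm_le_eLpNorm hW hV h hf).trans_lt
        (ENNReal.mul_lt_top hfL.lt_top hV'.lt_top)⟩
  have hle : ∀ f : α → F, ∀ᵐ x ∂ν, ‖(inner ℝ (f x) (c x) : ℝ)‖ ≤ B * ‖f x‖ := by
    intro f
    filter_upwards [hB] with x hx
    refine (norm_inner_le_norm _ _).trans ?_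
    rw [mul_comm]
    gcongr
  have hint' : ∀ f : α → F, AEStronglyMeasurable f ν → eLpNorm f 2 (ν.withDensity W) ≠ ⊤ →
      Integrable (fun x => inner ℝ (f x) (c x)) ν := fun f hf hfL =>
    ((hint f hf hfL).norm.const_mul B).mono' (hf.inner hc) (hle f)
  refine ⟨hint g hg hgL, fun k => hint' _ (hf k) (hfL k), hint' g hg hgL, ?_⟩
  refine tendsto_integral_of_L1 _ (hint' g hg hgL).aestronglyMeasurable
    (Eventually.of_forall fun k => hint' _ (hf k) (hfL k)) ?_
  have h3 : Tendsto (fun k => ENNReal.ofReal B * (eLpNorm (f k - g) 2 (ν.withDensity W) *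
      (∫⁻ x, V x ∂ν) ^ (1 / 2 : ℝ))) atTop (𝓝 0) := by
    have := ENNReal.Tendsto.const_mul (a := ENNReal.ofReal B)
      (ENNReal.Tendsto.mul_const ht (Or.inr hV')) (Or.inr ENNReal.ofReal_ne_top)
    simpa using this
  refine tendsto_of_tendsto_of_tendsto_of_le_of_le tendsto_const_nhds h3 (fun _ => zero_le)
    fun k => ?_
  refine le_trans ?_ (mul_le_mul' le_rfl (lintegral_enorm_le_eLpNorm hW hV h ((hf k).sub hg)))
  rw [← lintegral_const_mul' _ _ ENNReal.ofReal_ne_top]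
  refine lintegral_mono_ae ?_
  filter_upwards [hB] with x hx
  rw [← inner_sub_left, ← ofReal_norm, ← ofReal_norm, ← ENNReal.ofReal_mul
    ((norm_nonneg _).trans hx)]
  refine ENNReal.ofReal_le_ofReal ((norm_inner_le_norm _ _).trans ?_)
  rw [mul_comm]
  exact mul_le_mul_of_nonneg_right hx (norm_nonneg _)

theorem integral_sphereMeasure (x₀ : Space d) {r : ℝ} (hr : 0 < r) (f : Space d → ℝ) :
    ∫ x, f x ∂sphereMeasure x₀ r =
      r ^ d * ∫ θ, f (x₀ + r • θ) ∂unitSphereMeasure (Space d) := by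
  have h1 : MeasurableEmbedding fun θ : sphere (0 : Space d) 1 => x₀ + r • (θ : Space d) :=
    ((Homeomorph.addLeft x₀).measurableEmbedding.comp
      (Homeomorph.smulOfNeZero r hr.ne').measurableEmbedding).comp
      (MeasurableEmbedding.subtype_coe isClosed_sphere.measurableSet)
  rw [sphereMeasure, integral_smul_measure, h1.integral_map, unitSphereMeasure,
    (MeasurableEmbedding.subtype_coe isClosed_sphere.measurableSet).integral_map,
    ENNReal.toReal_ofReal (by positivity), smul_eq_mul]

theorem integrable_sphereMeasure_iff (x₀ : Space d) {r : ℝ} (hr : 0 < r) (f : Space d → ℝ) :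
    Integrable f (sphereMeasure x₀ r) ↔
      Integrable (fun θ => f (x₀ + r • θ)) (unitSphereMeasure (Space d)) := by
  have h1 : MeasurableEmbedding fun θ : sphere (0 : Space d) 1 => x₀ + r • (θ : Space d) :=
    ((Homeomorph.addLeft x₀).measurableEmbedding.comp
      (Homeomorph.smulOfNeZero r hr.ne').measurableEmbedding).comp
      (MeasurableEmbedding.subtype_coe isClosed_sphere.measurableSet)
  rw [sphereMeasure, integrable_smul_measure (by simp; positivity) (by simp),
    h1.integrable_map_iff, unitSphereMeasure,
    (MeasurableEmbedding.subtype_coe isClosed_sphere.measurableSet).integrable_map_iff]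
  rfl

theorem ae_sphereMeasure (x₀ : Space d) {r : ℝ} (hr : 0 < r) :
    ∀ᵐ x ∂sphereMeasure x₀ r, ‖r⁻¹ • (x - x₀)‖ = 1 := by
  rw [sphereMeasure]
  refine Measure.ae_smul_measure ?_ _
  rw [ae_map_iff (by fun_prop) (measurableSet_eq_fun (by fun_prop) measurable_const)]
  refine ae_of_all _ fun θ => ?_
  rw [add_sub_cancel_left, smul_smul, inv_mul_cancel₀ hr.ne', one_smul]
  simp

/-- Sphere traces are unique. -/
theorem IsSphereTrace.ae_eq {x₀ : Space d} {r : ℝ} (hr : 0 < r) {T T' : Space d → ℝ}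
    (h : IsSphereTrace u G x₀ r T) (h' : IsSphereTrace u G x₀ r T') :
    T =ᵐ[sphereMeasure x₀ r] T' := by
  have key : ∀ e : Space d, ∀ᵐ x ∂sphereMeasure x₀ r,
      (T x - T' x) * inner ℝ (r⁻¹ • (x - x₀)) e = 0 := by
    intro e
    have hint : ∀ T : Space d → ℝ, Integrable T (sphereMeasure x₀ r) → ∀ φ : Space d → ℝ,
        Continuous φ → Integrable (fun x => T x * φ x * inner ℝ (r⁻¹ • (x - x₀)) e)
          (sphereMeasure x₀ r) := by
      intro T hT φ hφ
      rw [integrable_sphereMeasure_iff x₀ hr] at hT ⊢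
      obtain ⟨C, hC⟩ := (isCompact_sphere (0 : Space d) 1).exists_bound_of_continuousOn
        (f := fun θ => φ (x₀ + r • θ) * inner ℝ (r⁻¹ • (x₀ + r • θ - x₀)) e) (by fun_prop)
      simp only [mul_assoc]
      refine hT.mul_bdd (c := C) (Continuous.aestronglyMeasurable (by fun_prop)) ?_
      filter_upwards [ae_norm_unitSphereMeasure (Space d)] with θ hθ
      exact hC θ (by simpa using hθ)
    have hi1 : Integrable (fun x => (T x - T' x) * inner ℝ (r⁻¹ • (x - x₀)) e)
        (sphereMeasure x₀ r) := by
      refine ((hint T h.int (fun _ => 1) continuous_const).sub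
        (hint T' h'.int (fun _ => 1) continuous_const)).congr (ae_of_all _ fun x => ?_)
      simp only [Pi.sub_apply]; ring
    refine ae_eq_zero_of_integral_contDiff_smul_eq_zero hi1.locallyIntegrable fun φ hφ hφc => ?_
    have ht : IsTest univ φ := ⟨hφ, hφc, subset_univ _⟩
    have e1 := (h.eq φ ht e).symm.trans (h'.eq φ ht e)
    rw [← sub_eq_zero, ← integral_sub (hint T h.int φ hφ.continuous)
      (hint T' h'.int φ hφ.continuous)] at e1
    rw [← e1]
    exact integral_congr_ae (ae_of_all _ fun x => by simp only [smul_eq_mul]; ring)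
  -- The Gauss-Green formula determines the trace only multiplied by components of the normal. All
  -- of these components cannot vanish together, since the normal has length one.
  have hall : ∀ᵐ x ∂sphereMeasure x₀ r, ∀ i : Fin (d + 1),
      (T x - T' x) * inner ℝ (r⁻¹ • (x - x₀)) (EuclideanSpace.single i 1) = 0 :=
    ae_all_iff.2 fun i => key _
  filter_upwards [hall, ae_sphereMeasure x₀ hr] with x hx hn
  by_contra hne
  have hz : r⁻¹ • (x - x₀) = 0 := by
    ext i
    have := (mul_eq_zero.1 (hx i)).resolve_left (sub_ne_zero.2 hne)
    simpa [EuclideanSpace.inner_single_right] using this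
  rw [hz, norm_zero] at hn
  exact zero_ne_one hn

theorem sphereTrace_ae_eq {x₀ : Space d} {r : ℝ} (hr : 0 < r) {T : Space d → ℝ}
    (h : IsSphereTrace u G x₀ r T) : sphereTrace u G x₀ r =ᵐ[sphereMeasure x₀ r] T := by
  have hex : ∃ T, IsSphereTrace u G x₀ r T := ⟨T, h⟩
  rw [sphereTrace, dif_pos hex]
  exact hex.choose_spec.ae_eq hr h

theorem lintegral_weight_one_sub_ball_ne_top (hs : 0 < s) (r : ℝ) :
    ∫⁻ x in ball (0 : Space d) r, ENNReal.ofReal (weight (1 - s) x) ≠ ⊤ := by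
  have h := (wMeasure_ball_lt_top (d := d) (s := 1 - s) (by linarith) r).ne
  rwa [wMeasure, withDensity_apply _ measurableSet_ball] at h

/-- The Gauss-Green formula on balls for the weak solution and its slices. -/
theorem ApproxSolution.gaussGreen_ball (S : ApproxSolution s ρ b u G τ v)
    (hs : s ∈ Ioo (0 : ℝ) 1) {δ : ℕ → ℝ≥0∞} {T : ℝ → Space d → ℝ} (hT : IsSliceFamily s v δ T)
    {r : ℝ} (hr : 0 < r) :
    Integrable (T r) (unitSphereMeasure (Space d)) ∧
    ∀ φ : Space d → ℝ, IsTest univ φ → ∀ e : Space d,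
      ∫ x in ball 0 r, (u x * fderiv ℝ φ x e + inner ℝ (G x) e * φ x) =
        r ^ d * ∫ θ, T r θ * (φ (r • θ) * inner ℝ θ e) ∂unitSphereMeasure (Space d) := by
  have hμ := isPolar_wMeasure (d := d) hs
  have hpol := isPolar_volume d
  have := hμ.finite
  -- Weighted `L²` convergence on the sphere yields convergence of unweighted integrals against
  -- bounded functions, because the inverse weight is integrable on the sphere as well.
  have hsph : ∀ {c : Space d → ℝ}, Continuous c → _ := fun {c} hc =>
    tendsto_integral_mul_of_withDensity (ν := unitSphereMeasure (Space d))
      (W := fun θ => ENNReal.ofReal (weight s θ)) (V := fun θ => ENNReal.ofReal (weight (1 - s) θ))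
      (measurable_weight s).ennreal_ofReal (measurable_weight _).ennreal_ofReal
      (by
        filter_upwards [ae_unitSphereMeasure_last_ne_zero d] with θ hθ
        exact ofReal_weight_mul s hθ)
      (by
        have := isFiniteMeasure_wSphereMeasure (d := d) (s := 1 - s)
          ⟨by linarith [hs.2], by linarith [hs.1]⟩
        have h2 := measure_ne_top (wSphereMeasure d (1 - s)) univ
        rwa [wSphereMeasure, withDensity_apply _ MeasurableSet.univ, Measure.restrict_univ] at h2)
      (f := fun k θ => v k (r • θ)) (g := T r)
      (fun k => ((S.smooth k).continuous.comp (continuous_const_smul r)).aestronglyMeasurable)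
      (hT.meas r hr).aestronglyMeasurable
      (fun k => (memLp_comp_smul hμ.norm_eq (S.smooth k).continuous r).eLpNorm_ne_top)
      (hT.memLp r hr).eLpNorm_ne_top (hT.tendsto_eLpNorm hr)
      hc.aestronglyMeasurable (c := c)
      (B := ((isCompact_sphere (0 : Space d) 1).exists_bound_of_continuousOn
        hc.continuousOn).choose)
      (by
        filter_upwards [hpol.norm_eq] with θ hθ
        exact ((isCompact_sphere (0 : Space d) 1).exists_bound_of_continuousOn
          hc.continuousOn).choose_spec θ (by simpa using hθ))
  refine ⟨(hsph (c := fun _ => 0) continuous_const).1, fun φ hφ e => ?_⟩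
  have hφc := hφ.smooth.continuous
  have hv1 : ∀ k, ContDiff ℝ 1 (v k) := fun k => (S.smooth k).of_le (by simp)
  have hfd : Continuous fun x => fderiv ℝ φ x e :=
    (hφ.smooth.continuous_fderiv (by simp)).clm_apply continuous_const
  have hfdc : HasCompactSupport fun x => fderiv ℝ φ x e :=
    (hφ.compact.fderiv ℝ).comp_left (g := fun L : Space d →L[ℝ] ℝ => L e) (by simp)
  have hball : (volume.restrict (ball (0 : Space d) r)).withDensity
      (fun x => ENNReal.ofReal (weight s x)) = (wMeasure d s).restrict (ball 0 r) := by
    rw [wMeasure, restrict_withDensity measurableSet_ball]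
  have hwv : ∀ᵐ x ∂volume.restrict (ball (0 : Space d) r),
      ENNReal.ofReal (weight s x) * ENNReal.ofReal (weight (1 - s) x) = 1 := by
    refine ae_restrict_of_ae ?_
    filter_upwards [ae_last_ne_zero d] with x hx
    exact ofReal_weight_mul s hx
  have hfin := isFiniteMeasureOnCompacts_wMeasure (d := d) hs.2
  -- The same passage to the limit inside the ball, stated for a general inner product space so as
  -- to serve both the functions and their gradients.
  have hvol : ∀ {F : Type} [NormedAddCommGroup F] [InnerProductSpace ℝ F] {f : ℕ → Space d → F}
      {g c : Space d → F}, (∀ k, Continuous (f k)) → (∀ k, HasCompactSupport (f k)) →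
      AEStronglyMeasurable g volume → MemLp g 2 (wMeasure d s) →
      Tendsto (fun k => eLpNorm (f k - g) 2 (wMeasure d s)) atTop (𝓝 0) →
      Continuous c → HasCompactSupport c → _ :=
    fun {F} _ _ {f g c} hf hfc hg hgL ht hc hcc =>
    tendsto_integral_mul_of_withDensity (ν := volume.restrict (ball (0 : Space d) r))
      (W := fun θ => ENNReal.ofReal (weight s θ)) (V := fun θ => ENNReal.ofReal (weight (1 - s) θ))
      (measurable_weight s).ennreal_ofReal (measurable_weight _).ennreal_ofReal hwv
      (lintegral_weight_one_sub_ball_ne_top hs.1 r) (f := f) (g := g)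
      (fun k => (hf k).aestronglyMeasurable) hg.restrict
      (fun k => by
        rw [hball]
        exact (((hf k).memLp_of_hasCompactSupport (hfc k)).restrict _).eLpNorm_ne_top)
      (by rw [hball]; exact (hgL.restrict _).eLpNorm_ne_top)
      (by
        rw [hball]
        exact tendsto_of_tendsto_of_tendsto_of_le_of_le tendsto_const_nhds ht (fun _ => zero_le)
          fun k => eLpNorm_mono_measure _ Measure.restrict_le_self)
      (c := c) hc.aestronglyMeasurable (B := (hc.bounded_above_of_compact_support hcc).choose)
      (ae_of_all _ (hc.bounded_above_of_compact_support hcc).choose_spec)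
  obtain ⟨-, hu1, hu2, hu3⟩ := hvol (fun k => (hv1 k).continuous) S.compact
    S.meas_u.aestronglyMeasurable S.memLp_u S.tendsto_u hfd hfdc
  obtain ⟨-, hG1, hG2, hG3⟩ := hvol (fun k => continuous_gradient (hv1 k))
    (fun k => hasCompactSupport_gradient (S.compact k))
    S.meas_G.aestronglyMeasurable S.memLp_G S.tendsto_G
    (c := fun x => φ x • e) (hφc.smul continuous_const) hφ.compact.smul_right
  have hT3 := (hsph (c := fun θ => φ (r • θ) * inner ℝ θ e) (by fun_prop)).2.2.2
  beta_reduce at hu1 hu2 hu3 hG1 hG2 hG3 hT3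
  have hsum := hu3.add hG3
  rw [← integral_add hu2 hG2] at hsum
  -- For the smooth approximations the formula is the divergence theorem for the product `v k * φ`.
  have hlhs : ∀ k, (∫ x in ball 0 r, inner ℝ (v k x) (fderiv ℝ φ x e)) +
      ∫ x in ball 0 r, inner ℝ (gradient (v k) x) (φ x • e) =
      r ^ d * ∫ θ, inner ℝ (v k (r • θ)) (φ (r • θ) * inner ℝ θ e)
        ∂unitSphereMeasure (Space d) := by
    intro k
    rw [← integral_add (hu1 k) (hG1 k)]
    have h1 := setIntegral_ball_fderiv ((hv1 k).mul (hφ.smooth.of_le (by simp)))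
      ((S.compact k).mul_right (f' := φ)) e hr
    have h2 : ∀ x, fderiv ℝ (fun x => v k x * φ x) x e =
        inner ℝ (v k x) (fderiv ℝ φ x e) + inner ℝ (gradient (v k) x) (φ x • e) := by
      intro x
      rw [fderiv_fun_mul ((hv1 k).differentiable (by simp) x)
        (hφ.smooth.differentiable (by simp) x), inner_smul_right, inner_gradient_left]
      simp [mul_comm]
    have h3 : ∀ θ : Space d, (v k * φ) (r • θ) * inner ℝ θ e =
        inner ℝ (v k (r • θ)) (φ (r • θ) * inner ℝ θ e) := by
      intro θ
      rw [Pi.mul_apply, RCLike.inner_apply, conj_trivial]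
      ring
    calc _ = ∫ x in ball 0 r, fderiv ℝ (fun x => v k x * φ x) x e :=
          integral_congr_ae (ae_of_all _ fun x => (h2 x).symm)
      _ = _ := h1
      _ = _ := congrArg (r ^ d * ·) (integral_congr_ae (ae_of_all _ h3))
  have h4 := tendsto_nhds_unique hsum ((hT3.const_mul (r ^ d)).congr fun k => (hlhs k).symm)
  convert h4 using 2
  · ext x
    simp only [RCLike.inner_apply, conj_trivial, inner_smul_right]
    ring
  · congr 1
    ext θ
    simp only [RCLike.inner_apply, conj_trivial]
    ring

end ThinReaction

/-! ### Distributional monotonicity and integration by parts along rays -/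

namespace ThinReaction
open Filter Topology
open scoped ENNReal

variable {d : ℕ} {s ρ κ : ℝ} {μ σ : Measure (Space d)} {b P : ℝ → ℝ} {K : ℝ≥0} {u : Space d → ℝ}
  {G : Space d → Space d} {τ : Space d → ℝ} {v : ℕ → Space d → ℝ} {ψ : ℝ → ℝ}

theorem integrable_mul_of_continuousOn_Ioi {g q : ℝ → ℝ} (hg : Continuous g)
    (hgc : HasCompactSupport g) (hgs : tsupport g ⊆ Ioi 0) (hq : ContinuousOn q (Ioi 0)) :
    Integrable fun r => g r * q r := by
  have hsub : Function.support (fun r => g r * q r) ⊆ tsupport g :=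
    (Function.support_mul_subset_left _ _).trans subset_closure
  rw [← integrableOn_iff_integrable_of_support_subset hsub]
  exact (hg.continuousOn.mul (hq.mono hgs)).integrableOn_compact hgc.isCompact

theorem IsRadialTest.integrable_mul (h : IsRadialTest ρ ψ) {q : ℝ → ℝ}
    (hq : ContinuousOn q (Ioi 0)) : Integrable fun r => ψ r * q r :=
  integrable_mul_of_continuousOn_Ioi h.smooth.continuous h.compact
    (h.support.trans fun _ hx => hx.1) hq

/-- A continuous function with nonnegative distributional derivative is nondecreasing. -/
theorem monotoneOn_of_integral_deriv_mul_nonpos {W : ℝ → ℝ} (hW : ContinuousOn W (Ioi 0))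
    (h : ∀ ψ : ℝ → ℝ, IsRadialTest ρ ψ → (∀ r, 0 ≤ ψ r) → ∫ r, deriv ψ r * W r ≤ 0) :
    MonotoneOn W (Ioo 0 ρ) := by
  intro a ha b hb hab
  rcases hab.eq_or_lt with rfl | hab
  · exact le_rfl
  by_contra! hlt
  -- If monotonicity fails, two levels `m' < m` separate `W b` from `W a`, and by continuity they
  -- still separate the values of `W` near `b` from those near `a`.
  obtain ⟨m, hm1, hm2⟩ := exists_between hlt
  obtain ⟨m', hm'1, hm'2⟩ := exists_between hm1
  have hWa := hW.continuousAt (Ioi_mem_nhds ha.1)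
  have hWb := hW.continuousAt (Ioi_mem_nhds hb.1)
  obtain ⟨ε₁, hε₁, h1⟩ := Metric.eventually_nhds_iff.1 (hWa.eventually_const_lt hm2)
  obtain ⟨ε₂, hε₂, h2⟩ := Metric.eventually_nhds_iff.1 (hWb.eventually_lt_const hm'1)
  obtain ⟨ε, hε, hεm⟩ : ∃ ε, 0 < ε ∧ ε < ε₁ ∧ ε < ε₂ ∧ ε < a ∧ ε < ρ - b := by
    obtain ⟨ε, h0, h1⟩ := exists_between (lt_min (lt_min hε₁ hε₂) (lt_min ha.1 (sub_pos.2 hb.2)))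
    simp only [lt_min_iff] at h1
    exact ⟨ε, h0, h1.1.1, h1.1.2, h1.2.1, h1.2.2⟩
  obtain ⟨hεa, hεb, hεa', hεb'⟩ := hεm
  set f : ContDiffBump (0 : ℝ) := ⟨ε / 2, ε, half_pos hε, half_lt_self hε⟩ with hf
  set φ : ℝ → ℝ := f.normed volume with hφ
  have hφs : ContDiff ℝ ∞ φ := f.contDiff_normed
  have hφc := hφs.continuous
  have hφ0 : ∀ t, 0 ≤ φ t := fun t => f.nonneg_normed t
  have hφz : ∀ t, ε ≤ |t| → φ t = 0 := fun t ht => by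
    have h3 : t ∉ Function.support φ := by
      rw [hφ, f.support_normed_eq]
      simpa [hf] using ht
    simpa using h3
  have hφi : Integrable φ := f.integrable_normed
  have hφcs : ∀ c, HasCompactSupport fun t => φ (t - c) := fun c =>
    (f.hasCompactSupport_normed (μ := volume)).comp_homeomorph (Homeomorph.subRight c)
  -- This is the mollified indicator of `[a, b]`. Its derivative is a unit bump at `a` minus a unit
  -- bump at `b`, so the hypothesis says that the average of `W` near `a` is at most its average
  -- near `b`.
  set ψ : ℝ → ℝ := fun r => ∫ t in (r - b)..(r - a), φ t with hψ
  have hd : ∀ r, HasDerivAt ψ (φ (r - a) - φ (r - b)) r := by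
    intro r
    have e : ψ = fun r => (∫ t in (0 : ℝ)..(r - a), φ t) - ∫ t in (0 : ℝ)..(r - b), φ t := by
      ext r
      exact (intervalIntegral.integral_interval_sub_left (hφc.intervalIntegrable _ _)
        (hφc.intervalIntegrable _ _)).symm
    have h3 : ∀ c, HasDerivAt (fun r => ∫ t in (0 : ℝ)..(r - c), φ t) (φ (r - c)) r := by
      intro c
      have := ((hφc.integral_hasStrictDerivAt 0 (r - c)).hasDerivAt).comp_sub_const r c
      exact this
    rw [e]
    exact (h3 a).sub (h3 b)
  have hde : deriv ψ = fun r => φ (r - a) - φ (r - b) := funext fun r => (hd r).deriv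
  have hψz : ∀ r, r ∉ Icc (a - ε) (b + ε) → ψ r = 0 := by
    intro r hr
    simp only [hψ]
    rw [intervalIntegral.integral_congr (g := fun _ => 0), intervalIntegral.integral_zero]
    intro t ht
    rw [uIcc_of_le (by linarith)] at ht
    refine hφz t ?_
    by_contra! h3
    rw [abs_lt] at h3
    exact hr ⟨by linarith [ht.2], by linarith [ht.1]⟩
  have hψt : IsRadialTest ρ ψ := by
    refine ⟨?_, HasCompactSupport.intro isCompact_Icc hψz, ?_⟩
    · rw [contDiff_infty_iff_deriv, hde]
      exact ⟨fun r => (hd r).differentiableAt,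
        (hφs.comp (contDiff_id.sub contDiff_const)).sub (hφs.comp (contDiff_id.sub contDiff_const))⟩
    · refine (closure_minimal (fun r hr => ?_) isClosed_Icc).trans
        (Icc_subset_Ioo (a₁ := a - ε) (b₁ := b + ε) (by linarith) (by linarith))
      by_contra h3
      exact hr (hψz r h3)
  have hψ0 : ∀ r, 0 ≤ ψ r := fun r =>
    intervalIntegral.integral_nonneg (by linarith) fun t _ => hφ0 t
  have hts : ∀ c ∈ Icc a b, tsupport (fun t => φ (t - c)) ⊆ Ioi 0 := by
    intro c hc
    refine (closure_minimal (t := Ici (c - ε)) (fun t ht => ?_) isClosed_Ici).trans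
      (Ici_subset_Ioi.2 (by linarith [hc.1]))
    by_contra h3
    have h4 : t < c - ε := not_le.1 h3
    refine ht (hφz _ ?_)
    rw [abs_of_neg (by linarith)]
    linarith
  have hint : ∀ c ∈ Icc a b, Integrable fun t => φ (t - c) * W t := fun c hc =>
    integrable_mul_of_continuousOn_Ioi (hφc.comp (continuous_id.sub continuous_const)) (hφcs c)
      (hts c hc) hW
  have hone : ∀ c, ∫ t, φ (t - c) = 1 := fun c => by
    rw [integral_sub_right_eq_self φ c]
    exact f.integral_normed
  have hkey := h ψ hψt hψ0
  rw [hde] at hkey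
  simp only [sub_mul] at hkey
  rw [integral_sub (hint a ⟨le_rfl, hab.le⟩) (hint b ⟨hab.le, le_rfl⟩)] at hkey
  have hA : m ≤ ∫ t, φ (t - a) * W t := by
    calc m = ∫ t, φ (t - a) * m := by rw [integral_mul_const, hone, one_mul]
      _ ≤ _ := by
        refine integral_mono ((hφi.comp_sub_right a).mul_const m) (hint a ⟨le_rfl, hab.le⟩)
          fun t => ?_
        rcases le_or_gt ε |t - a| with h3 | h3
        · simp [hφz _ h3]
        · exact mul_le_mul_of_nonneg_left (h1 (by rw [Real.dist_eq]; linarith)).le (hφ0 _)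
  have hB : ∫ t, φ (t - b) * W t ≤ m' := by
    calc _ ≤ ∫ t, φ (t - b) * m' := by
          refine integral_mono (hint b ⟨hab.le, le_rfl⟩) ((hφi.comp_sub_right b).mul_const m')
            fun t => ?_
          rcases le_or_gt ε |t - b| with h3 | h3
          · simp [hφz _ h3]
          · exact mul_le_mul_of_nonneg_left (h2 (by rw [Real.dist_eq]; linarith)).le (hφ0 _)
      _ = m' := by rw [integral_mul_const, hone, one_mul]
  linarith

/-- The derivative of `r^(-2s) ψ g²` integrates to zero because `ψ` vanishes at both ends. The
origin, where the power is singular, stays outside the interval of integration. -/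
theorem integral_sq_ray {g : ℝ → ℝ} {g' : ℝ → ℝ} (hg : ∀ r, HasDerivAt g (g' r) r)
    (hg' : Continuous g') (hψ : IsRadialTest ρ ψ) (hρ : 0 < ρ) :
    ∫ r in Ioi (0 : ℝ), r ^ (-(2 * s)) * (deriv ψ r * g r ^ 2) =
      ∫ r in Ioi (0 : ℝ), r ^ (-(2 * s) - 1) * (ψ r * (2 * s * g r ^ 2 - 2 * g r * (r * g' r))) := by
  obtain ⟨a, b, ha, hab, hb, hψs⟩ := hψ.exists_Icc hρ
  obtain ⟨a', b', ha', hab', hb', hψs'⟩ := hψ.deriv.exists_Icc hρ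
  -- The endpoints `α` and `γ` lie strictly outside the intervals that carry `ψ` and its derivative,
  -- so neither function contributes at the ends or beyond them.
  set α := min a a' / 2 with hα
  set γ := max b b' + 1 with hγ
  have hα0 : 0 < α := half_pos (lt_min ha ha')
  have hαa : α < a := (half_lt_self (lt_min ha ha')).trans_le (min_le_left _ _)
  have hαa' : α < a' := (half_lt_self (lt_min ha ha')).trans_le (min_le_right _ _)
  have hγb : b < γ := (le_max_left b b').trans_lt (lt_add_one _)
  have hγb' : b' < γ := (le_max_right b b').trans_lt (lt_add_one _)
  have hαγ : α ≤ γ := by linarith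
  have hz : ∀ r, r ∉ Ioo α γ → ψ r = 0 := fun r hr => by
    by_contra h0
    have := hψs r h0
    exact hr ⟨hαa.trans_le this.1, this.2.trans_lt hγb⟩
  have hz' : ∀ r, r ∉ Ioo α γ → deriv ψ r = 0 := fun r hr => by
    by_contra h0
    have := hψs' r h0
    exact hr ⟨hαa'.trans_le this.1, this.2.trans_lt hγb'⟩
  have hgc : Continuous g := continuous_iff_continuousAt.2 fun r => (hg r).continuousAt
  have hψc := hψ.smooth.continuous
  have hψdc := hψ.deriv.smooth.continuous
  have hpos : ∀ r ∈ uIcc α γ, 0 < r := fun r hr => by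
    rw [uIcc_of_le hαγ] at hr; exact hα0.trans_le hr.1
  have hrp : ∀ p : ℝ, ContinuousOn (fun r : ℝ => r ^ p) (uIcc α γ) := fun p r hr =>
    (Real.continuousAt_rpow_const r p (Or.inl (hpos r hr).ne')).continuousWithinAt
  have hi1 : ContinuousOn (fun r : ℝ => r ^ (-(2 * s)) * (deriv ψ r * g r ^ 2)) (uIcc α γ) :=
    (hrp _).mul (hψdc.mul (hgc.pow 2)).continuousOn
  have hi2 : ContinuousOn (fun r : ℝ => r ^ (-(2 * s) - 1) *
      (ψ r * (2 * s * g r ^ 2 - 2 * g r * (r * g' r)))) (uIcc α γ) :=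
    (hrp _).mul (by fun_prop)
  have hsub : Ioc α γ ⊆ Ioi 0 := fun r hr => hα0.trans hr.1
  have hFTC := intervalIntegral.integral_eq_sub_of_hasDerivAt (a := α) (b := γ)
    (f := fun r : ℝ => r ^ (-(2 * s)) * (ψ r * g r ^ 2))
    (f' := fun r : ℝ => r ^ (-(2 * s)) * (deriv ψ r * g r ^ 2) -
      r ^ (-(2 * s) - 1) * (ψ r * (2 * s * g r ^ 2 - 2 * g r * (r * g' r))))
    (fun r hr => by
      have hr0 := hpos r hr
      have h1 := (Real.hasDerivAt_rpow_const (x := r) (p := -(2 * s)) (Or.inl hr0.ne')).mul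
        (((hψ.smooth.differentiable (by simp) r).hasDerivAt).mul ((hg r).pow 2))
      refine h1.congr_deriv ?_
      have e : r ^ (-(2 * s)) = r ^ (-(2 * s) - 1) * r := by
        rw [Real.rpow_sub_one hr0.ne']; field_simp
      simp only [Pi.mul_apply, Pi.pow_apply]
      rw [e]
      push_cast
      ring)
    ((hi1.sub hi2).intervalIntegrable)
  rw [intervalIntegral.integral_sub hi1.intervalIntegrable hi2.intervalIntegrable,
    hz α (by simp), hz γ (by simp)] at hFTC
  simp only [zero_mul, mul_zero, sub_zero] at hFTC
  rw [sub_eq_zero, intervalIntegral.integral_of_le hαγ, intervalIntegral.integral_of_le hαγ] at hFTC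
  rw [setIntegral_eq_of_subset_of_forall_sdiff_eq_zero measurableSet_Ioi hsub (fun r hr => by
      rw [hz' r (fun h => hr.2 ⟨h.1, h.2.le⟩)]; ring),
    setIntegral_eq_of_subset_of_forall_sdiff_eq_zero measurableSet_Ioi hsub (fun r hr => by
      rw [hz r (fun h => hr.2 ⟨h.1, h.2.le⟩)]; ring), hFTC]

/-- Integration by parts along rays, for smooth functions. -/
theorem integral_slice_sq_eq (hs : s ∈ Ioo (0 : ℝ) 1) {f : Space d → ℝ} (hf : ContDiff ℝ 1 f)
    (hfc : HasCompactSupport f) (hψ : IsRadialTest ρ ψ) (hρ : 0 < ρ) :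
    ∫ r, deriv ψ r * (r ^ (-(2 * s)) * ∫ θ, f (r • θ) ^ 2 ∂wSphereMeasure d s) =
      ∫ x, ψ ‖x‖ / ‖x‖ ^ (d + 2) * (2 * s * f x ^ 2 - 2 * f x * inner ℝ (gradient f x) x)
        ∂wMeasure d s := by
  have hμ := isPolar_wMeasure (d := d) hs
  have hfin := isFiniteMeasureOnCompacts_wMeasure (d := d) hs.2
  have hfcont := hf.continuous
  have hgc := continuous_gradient hf
  have hc1 : Continuous fun x : Space d => deriv ψ ‖x‖ / ‖x‖ ^ (d + 1) :=
    (hψ.deriv.div_pow (d + 1)).smooth.continuous.comp continuous_norm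
  have hc2 : Continuous fun x : Space d => ψ ‖x‖ / ‖x‖ ^ (d + 2) :=
    (hψ.div_pow (d + 2)).smooth.continuous.comp continuous_norm
  have hf2c : HasCompactSupport fun x => f x ^ 2 :=
    hfc.comp_left (g := fun y : ℝ => y ^ 2) (by simp)
  have hi1 : Integrable (fun x => deriv ψ ‖x‖ / ‖x‖ ^ (d + 1) * f x ^ 2) (wMeasure d s) :=
    (hc1.mul (hfcont.pow 2)).integrable_of_hasCompactSupport hf2c.mul_left
  have hc3 : HasCompactSupport
      fun x => 2 * s * f x ^ 2 - 2 * f x * inner ℝ (gradient f x) x := by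
    have e : (fun x => 2 * s * f x ^ 2 - 2 * f x * inner ℝ (gradient f x) x) =
        f * fun x => 2 * s * f x - 2 * inner ℝ (gradient f x) x := by
      ext x; simp only [Pi.mul_apply]; ring
    rw [e]; exact hfc.mul_right
  have hi2 : Integrable (fun x => ψ ‖x‖ / ‖x‖ ^ (d + 2) *
      (2 * s * f x ^ 2 - 2 * f x * inner ℝ (gradient f x) x)) (wMeasure d s) :=
    (hc2.mul (by fun_prop)).integrable_of_hasCompactSupport hc3.mul_left
  have hzero : ∀ r, r ∉ Ioi (0 : ℝ) →
      deriv ψ r * (r ^ (-(2 * s)) * ∫ θ, f (r • θ) ^ 2 ∂wSphereMeasure d s) = 0 := fun r hr => by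
    rw [hψ.deriv.eq_zero_of_nonpos (not_lt.1 hr), zero_mul]
  -- The polar density `r^(d+1-2s)` divided by `r^(d+m)` leaves the powers used on rays; the values
  -- `m = 1` and `m = 2` belong to the two sides.
  have e1 : ∀ r : ℝ, 0 < r → ∀ m : ℕ, r ^ ((d : ℝ) + (1 - 2 * s)) / r ^ (d + m) =
      r ^ (-(2 * s) - ((m : ℝ) - 1)) := fun r hr m => by
    rw [← Real.rpow_natCast, ← Real.rpow_sub hr]
    congr 1
    push_cast
    ring
  calc _ = ∫ x, deriv ψ ‖x‖ / ‖x‖ ^ (d + 1) * f x ^ 2 ∂wMeasure d s := by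
        rw [hμ.integral_eq_swap hi1, ← setIntegral_eq_integral_of_forall_compl_eq_zero hzero]
        refine setIntegral_congr_fun measurableSet_Ioi fun r hr => ?_
        have hr' : (0 : ℝ) < r := hr
        rw [← integral_const_mul, ← integral_const_mul, ← integral_const_mul]
        refine integral_congr_ae ?_
        filter_upwards [hμ.norm_eq] with θ hθ
        rw [norm_smul, hθ, Real.norm_eq_abs, abs_of_pos hr', mul_one]
        have := e1 r hr' 1
        rw [Nat.cast_one, sub_self, sub_zero] at this
        rw [← this]
        ring
    _ = _ := by
        rw [hμ.integral_eq hi1, hμ.integral_eq hi2]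
        refine integral_congr_ae ?_
        filter_upwards [hμ.norm_eq] with θ hθ
        have hline : ∀ t, HasDerivAt (fun t : ℝ => f (t • θ)) (inner ℝ (gradient f (t • θ)) θ) t := by
          intro t
          have h1 := (hf.differentiable (by simp) (t • θ)).hasFDerivAt.comp_hasDerivAt t
            ((hasDerivAt_id t).smul_const θ)
          rw [one_smul, ← inner_gradient_left] at h1
          exact h1
        have h2 := integral_sq_ray (s := s) hline (by fun_prop) hψ hρ
        refine Eq.trans ?_ (h2.trans ?_)
        · refine setIntegral_congr_fun measurableSet_Ioi fun r hr => ?_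
          have hr' : (0 : ℝ) < r := hr
          rw [norm_smul, hθ, Real.norm_eq_abs, abs_of_pos hr', mul_one]
          have := e1 r hr' 1
          rw [Nat.cast_one, sub_self, sub_zero] at this
          rw [← this]
          ring
        · refine setIntegral_congr_fun measurableSet_Ioi fun r hr => ?_
          have hr' : (0 : ℝ) < r := hr
          rw [norm_smul, hθ, Real.norm_eq_abs, abs_of_pos hr', mul_one, inner_smul_right]
          have := e1 r hr' 2
          rw [Nat.cast_ofNat, show (2 : ℝ) - 1 = 1 by norm_num] at this
          rw [← this]
          ring

/-- Integration by parts on a half-line. With `m = d` it presents the multiplier `d η + r η'` as a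
tail integral, the form needed for the layer-cake formula. -/
theorem IsRadialTest.integral_Ioi_deriv_div_pow (h : IsRadialTest ρ ψ) (m : ℕ) {r : ℝ}
    (hr : 0 ≤ r) : ∫ t in Ioi r, _root_.deriv ψ t / t ^ m =
      m * (∫ t in Ioi r, ψ t / t ^ (m + 1)) - ψ r / r ^ m := by
  have h1 := (h.div_pow m).compact.integral_Ioi_deriv_eq ((h.div_pow m).smooth.of_le (by simp)) r
  have hi : ∀ {q : ℝ → ℝ}, IsRadialTest ρ q → IntegrableOn q (Ioi r) := fun hq =>
    (hq.smooth.continuous.integrable_of_hasCompactSupport hq.compact).integrableOn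
  have h2 : ∫ t in Ioi r, _root_.deriv (fun t => ψ t / t ^ m) t =
      ∫ t in Ioi r, (_root_.deriv ψ t / t ^ m - m * (ψ t / t ^ (m + 1))) := by
    refine setIntegral_congr_fun measurableSet_Ioi fun t ht => ?_
    have ht0 : t ≠ 0 := (hr.trans_lt ht).ne'
    have h3 := ((h.smooth.differentiable (by simp) t).hasDerivAt).div
      (hasDerivAt_pow m t) (pow_ne_zero m ht0)
    refine h3.deriv.trans ?_
    rcases m with _ | m
    · simp
    · simp only [Nat.add_sub_cancel]
      field_simp
      ring
  rw [h2, integral_sub (hi (h.deriv.div_pow m)) ((hi (h.div_pow (m + 1))).const_mul _),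
    integral_const_mul] at h1
  linarith

end ThinReaction

/-! ### Monotonicity of the energy of a solution centred at the origin -/

namespace ThinReaction
open Filter Topology
open scoped ENNReal

variable {d : ℕ} {s ρ κ : ℝ} {μ σ : Measure (Space d)} {b P : ℝ → ℝ} {K : ℝ≥0} {u : Space d → ℝ}
  {G : Space d → Space d} {τ : Space d → ℝ} {v : ℕ → Space d → ℝ} {ψ : ℝ → ℝ}

theorem tendsto_eLpNorm_coef_mul {α F : Type*} [MeasurableSpace α] [NormedAddCommGroup F]
    [NormedSpace ℝ F] {ν : Measure α} {f : ℕ → α → F} {g : α → F} {c : α → ℝ} {B : ℝ}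
    (hB : ∀ x, |c x| ≤ B) (h : Tendsto (fun k => eLpNorm (f k - g) 2 ν) atTop (𝓝 0)) :
    Tendsto (fun k => eLpNorm ((fun x => c x • f k x) - fun x => c x • g x) 2 ν) atTop (𝓝 0) := by
  refine tendsto_eLpNorm_of_le (A := ENNReal.ofReal B) ENNReal.ofReal_ne_top (fun k => ?_) h
  refine eLpNorm_le_mul_eLpNorm_of_ae_le_mul (ae_of_all _ fun x => ?_) 2
  simp only [Pi.sub_apply]
  rw [← smul_sub, norm_smul]
  gcongr
  exact hB x

theorem memLp_coef_smul {α F : Type*} [MeasurableSpace α] [NormedAddCommGroup F]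
    [NormedSpace ℝ F] {ν : Measure α} {g : α → F} {c : α → ℝ} {B : ℝ}
    (hc : AEStronglyMeasurable c ν) (hB : ∀ x, |c x| ≤ B) (h : MemLp g 2 ν) :
    MemLp (fun x => c x • g x) 2 ν := by
  refine MemLp.of_le_mul (c := B) h (hc.smul h.aestronglyMeasurable) (ae_of_all _ fun x => ?_)
  rw [norm_smul]
  gcongr
  exact hB x

namespace ApproxSolution

/-- Integration by parts along rays, for the weak solution. -/
theorem integral_slice_sq_eq (S : ApproxSolution s ρ b u G τ v)
    (hs : s ∈ Ioo (0 : ℝ) 1) (hd : 1 ≤ d) {δ : ℕ → ℝ≥0∞} {T : ℝ → Space d → ℝ}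
    (hT : IsSliceFamily s v δ T) (hψ : IsRadialTest ρ ψ) (hρ : 0 < ρ) :
    ∫ r, deriv ψ r * (r ^ (-(2 * s)) * ∫ θ, T r θ ^ 2 ∂wSphereMeasure d s) =
      2 * s * ∫ x, ψ ‖x‖ / ‖x‖ ^ (d + 2) * u x ^ 2 ∂wMeasure d s -
      2 * ∫ x, ψ ‖x‖ / ‖x‖ ^ (d + 2) * (u x * inner ℝ (G x) x) ∂wMeasure d s := by
  have hμ := isPolar_wMeasure (d := d) hs
  have hfin := isFiniteMeasureOnCompacts_wMeasure (d := d) hs.2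
  have hv1 : ∀ k, ContDiff ℝ 1 (v k) := fun k => (S.smooth k).of_le (by simp)
  have hgL : ∀ k, MemLp (gradient (v k)) 2 (wMeasure d s) := fun k =>
    (continuous_gradient (hv1 k)).memLp_of_hasCompactSupport
      (hasCompactSupport_gradient (S.compact k))
  have hvL : ∀ k, MemLp (v k) 2 (wMeasure d s) := fun k =>
    (hv1 k).continuous.memLp_of_hasCompactSupport (S.compact k)
  have hv := fun k => (hv1 k).continuous
  -- the left-hand side
  obtain ⟨a, c, ha, hac, hc, hψs⟩ := hψ.deriv.exists_Icc hρ
  have hI := hT.continuousOn_integral_sq hs hd hv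
  obtain ⟨B, hB⟩ := isCompact_Icc.exists_bound_of_continuousOn (f := fun r =>
    √(∫ θ, T r θ ^ 2 ∂wSphereMeasure d s)) (s := Icc a c)
    ((hI.mono fun r hr => ha.trans_le hr.1).sqrt)
  have hunif := Metric.tendstoUniformlyOn_iff.1
    (hT.tendstoUniformlyOn_sqrt hs hd hv (half_pos ha)) 1 one_pos
  have hrp : ContinuousOn (fun r : ℝ => r ^ (-(2 * s))) (Ioi 0) := fun r hr =>
    (Real.continuousAt_rpow_const r _ (Or.inl (ne_of_gt hr))).continuousWithinAt
  have hIk : ∀ k, Continuous fun r : ℝ => ∫ θ, v k (r • θ) ^ 2 ∂wSphereMeasure d s := by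
    intro k
    have := hμ.finite
    refine IsSliceFamily.continuous_integral_smul hμ.norm_eq (f := fun r θ => v k (r • θ) ^ 2) ?_
    have := hv k
    simp only [Function.uncurry_def]
    fun_prop
  have hlhs : Tendsto (fun k => ∫ r, deriv ψ r * (r ^ (-(2 * s)) *
      ∫ θ, v k (r • θ) ^ 2 ∂wSphereMeasure d s)) atTop
      (𝓝 (∫ r, deriv ψ r * (r ^ (-(2 * s)) * ∫ θ, T r θ ^ 2 ∂wSphereMeasure d s))) := by
    -- On the compact interval carrying the derivative of `ψ` the norms of the slices are at most
    -- `B`. Uniform convergence bounds those of the approximations by `B + 1` for large `k`, which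
    -- gives the dominating function.
    refine tendsto_integral_filter_of_dominated_convergence
      (fun r => ‖deriv ψ r * r ^ (-(2 * s))‖ * (B + 1) ^ 2)
      (Eventually.of_forall fun k =>
        (hψ.deriv.integrable_mul (hrp.mul (hIk k).continuousOn)).aestronglyMeasurable)
      ?_ ((hψ.deriv.integrable_mul hrp).norm.mul_const _) (ae_of_all _ fun r => ?_)
    · filter_upwards [hunif] with k hk
      refine ae_of_all _ fun r => ?_
      rw [← mul_assoc, norm_mul]
      by_cases h0 : deriv ψ r = 0
      · simp [h0]
      · have hr := hψs r h0
        gcongr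
        have h1 := hk r (by have := hr.1; simp only [mem_Ioi]; linarith)
        have h2 := hB r hr
        rw [Real.dist_eq] at h1
        rw [Real.norm_eq_abs, abs_of_nonneg (Real.sqrt_nonneg _)] at h2
        have h3 : (0 : ℝ) ≤ ∫ θ, v k (r • θ) ^ 2 ∂wSphereMeasure d s :=
          integral_nonneg fun θ => sq_nonneg _
        rw [Real.norm_eq_abs, abs_of_nonneg h3, ← Real.sqrt_le_left (by
          linarith [Real.sqrt_nonneg (∫ θ, T r θ ^ 2 ∂wSphereMeasure d s)])]
        linarith [(abs_lt.1 h1).1]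
    · by_cases h0 : deriv ψ r = 0
      · simp [h0]
      · exact ((hT.tendsto_integral_sq hs hv (ha.trans_le (hψs r h0).1)).const_mul _).const_mul _
  -- the right-hand side
  have hcc : Continuous fun x : Space d => ψ ‖x‖ / ‖x‖ ^ (d + 2) :=
    (hψ.div_pow (d + 2)).smooth.continuous.comp continuous_norm
  obtain ⟨B₁, hB₁, hb₁⟩ := exists_bound_of_hasCompactSupport
    (hψ.div_pow (d + 2)).smooth.continuous (hψ.div_pow (d + 2)).compact
  obtain ⟨B₂, hB₂, hb₂⟩ := exists_bound_of_hasCompactSupport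
    (c := fun r => r * (ψ r / r ^ (d + 2)))
    (continuous_id.mul (hψ.div_pow (d + 2)).smooth.continuous) (hψ.div_pow (d + 2)).compact.mul_left
  have hcu : MemLp (fun x => ψ ‖x‖ / ‖x‖ ^ (d + 2) * u x) 2 (wMeasure d s) :=
    memLp_coef_smul hcc.aestronglyMeasurable (fun x => hb₁ ‖x‖) S.memLp_u
  have hcv : ∀ k, MemLp (fun x => ψ ‖x‖ / ‖x‖ ^ (d + 2) * v k x) 2 (wMeasure d s) := fun k =>
    memLp_coef_smul hcc.aestronglyMeasurable (fun x => hb₁ ‖x‖) (hvL k)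
  have hcut : Tendsto (fun k => eLpNorm ((fun x => ψ ‖x‖ / ‖x‖ ^ (d + 2) * v k x) -
      fun x => ψ ‖x‖ / ‖x‖ ^ (d + 2) * u x) 2 (wMeasure d s)) atTop (𝓝 0) :=
    tendsto_eLpNorm_coef_mul (fun x => hb₁ ‖x‖) S.tendsto_u
  have hNle : ∀ (g x : Space d),
      |ψ ‖x‖ / ‖x‖ ^ (d + 2) * inner ℝ g x| ≤ B₂ * ‖g‖ := by
    intro g x
    rw [abs_mul]
    have h1 : |(inner ℝ g x : ℝ)| ≤ ‖g‖ * ‖x‖ := abs_real_inner_le_norm g x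
    have h2 := hb₂ ‖x‖
    rw [abs_mul, abs_of_nonneg (norm_nonneg x)] at h2
    calc _ ≤ |ψ ‖x‖ / ‖x‖ ^ (d + 2)| * (‖g‖ * ‖x‖) := by gcongr
      _ = ‖x‖ * |ψ ‖x‖ / ‖x‖ ^ (d + 2)| * ‖g‖ := by ring
      _ ≤ _ := by gcongr
  have hN : ∀ {g : Space d → Space d}, MemLp g 2 (wMeasure d s) →
      MemLp (fun x => ψ ‖x‖ / ‖x‖ ^ (d + 2) * inner ℝ (g x) x) 2 (wMeasure d s) := fun {g} hg =>
    MemLp.of_le_mul (c := B₂) hg (hcc.aestronglyMeasurable.mul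
      (hg.aestronglyMeasurable.inner aestronglyMeasurable_id)) (ae_of_all _ fun x => hNle _ _)
  have hNt : Tendsto (fun k => eLpNorm ((fun x => ψ ‖x‖ / ‖x‖ ^ (d + 2) *
      inner ℝ (gradient (v k) x) x) - fun x => ψ ‖x‖ / ‖x‖ ^ (d + 2) * inner ℝ (G x) x) 2
      (wMeasure d s)) atTop (𝓝 0) := by
    refine tendsto_eLpNorm_of_le (A := ENNReal.ofReal B₂) ENNReal.ofReal_ne_top (fun k => ?_)
      S.tendsto_G
    refine eLpNorm_le_mul_eLpNorm_of_ae_le_mul (ae_of_all _ fun x => ?_) 2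
    simp only [Pi.sub_apply]
    rw [← mul_sub, ← inner_sub_left]
    exact hNle _ _
  have h1 := tendsto_integral_mul hcu S.memLp_u hcv hvL hcut S.tendsto_u
  have h2 := tendsto_integral_mul S.memLp_u (hN S.memLp_G) hvL (fun k => hN (hgL k))
    S.tendsto_u hNt
  have h3 := (h1.const_mul (2 * s)).sub (h2.const_mul 2)
  have h4 := tendsto_nhds_unique hlhs (h3.congr fun k => by
    rw [ThinReaction.integral_slice_sq_eq hs (hv1 k) (S.compact k) hψ hρ, ← integral_const_mul,
      ← integral_const_mul, ← integral_sub]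
    · refine integral_congr_ae (ae_of_all _ fun x => ?_)
      simp only; ring
    · have := integrable_inner (hcv k) (hvL k)
      simp only [RCLike.inner_apply, conj_trivial] at this
      refine Integrable.const_mul ?_ _
      simpa [mul_comm] using this
    · have := integrable_inner (hvL k) (hN (hgL k))
      simp only [RCLike.inner_apply, conj_trivial] at this
      refine Integrable.const_mul ?_ _
      simpa [mul_comm] using this)
  rw [h4]
  congr 2
  · refine integral_congr_ae (ae_of_all _ fun x => ?_)
    simp only; ring
  · refine integral_congr_ae (ae_of_all _ fun x => ?_)
    simp only; ring

/-- The Weiss energy of a weak solution, in terms of its slices, is nondecreasing. -/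
theorem monotoneOn_energy (S : ApproxSolution s ρ b u G τ v)
    (hs : s ∈ Ioo (0 : ℝ) 1) (hd : 1 ≤ d) (hb : IsReaction b P K) {δ : ℕ → ℝ≥0∞}
    {T : ℝ → Space d → ℝ} (hT : IsSliceFamily s v δ T) (hρ : 0 < ρ) :
    MonotoneOn (fun r => 1 / r ^ d * (∫ x in ball 0 r, ‖G x‖ ^ 2 ∂wMeasure d s) -
      s * (r ^ (-(2 * s)) * ∫ θ, T r θ ^ 2 ∂wSphereMeasure d s) +
      1 / r ^ d * ∫ x in ball 0 r, 4 * P (τ x) ∂thinMeasure d) (Ioo 0 ρ) := by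
  have hμ := isPolar_wMeasure (d := d) hs
  have hμ' := isPolar_thinMeasure hd
  have hsf := hμ.sfinite
  have hsf' := hμ'.sfinite
  have hG2 : Integrable (fun x => ‖G x‖ ^ 2) (wMeasure d s) := integrable_norm_sq S.memLp_G
  have hP : Integrable (fun x => 4 * P (τ x)) (thinMeasure d) := by
    refine Integrable.const_mul ?_ 4
    refine ((integrable_norm_sq S.memLp_τ).const_mul K).mono'
      (hb.continuous_prim.measurable.comp S.meas_τ).aestronglyMeasurable (ae_of_all _ fun x => ?_)
    simpa using hb.abs_prim_le (τ x)
  have hrp : ContinuousOn (fun r : ℝ => r ^ (-(2 * s))) (Ioi 0) := fun r hr =>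
    (Real.continuousAt_rpow_const r _ (Or.inl (ne_of_gt hr))).continuousWithinAt
  have hpow : ContinuousOn (fun r : ℝ => 1 / r ^ d) (Ioi 0) := fun r hr =>
    (continuousAt_const.div (continuousAt_id.pow d) (pow_ne_zero d (ne_of_gt hr))).continuousWithinAt
  have hc1 := hpow.mul (hμ.continuousOn_setIntegral_ball hG2)
  have hc2 := (hrp.mul (hT.continuousOn_integral_sq hs hd fun k => (S.smooth k).continuous)).const_mul s
  have hc3 := hpow.mul (hμ'.continuousOn_setIntegral_ball hP)
  refine monotoneOn_of_integral_deriv_mul_nonpos ((hc1.sub hc2).add hc3) fun ψ hψ hψ0 => ?_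
  -- The profile with `η' = -ψ / r^(d+1)` is the one for which `d η + r η'` is the tail integral of
  -- `ψ' / t^d`. The domain variation identity for `η` thus describes the energy tested against the
  -- derivative of `ψ`.
  obtain ⟨η, hη, hηd, hηi⟩ := (hψ.div_pow (d + 1)).exists_isRadialProfile hρ
  have i1 : Integrable fun r => deriv ψ r *
      (1 / r ^ d * ∫ x in ball 0 r, ‖G x‖ ^ 2 ∂wMeasure d s) := hψ.deriv.integrable_mul hc1
  have i2 : Integrable fun r => deriv ψ r *
      (s * (r ^ (-(2 * s)) * ∫ θ, T r θ ^ 2 ∂wSphereMeasure d s)) := hψ.deriv.integrable_mul hc2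
  have i3 : Integrable fun r => deriv ψ r *
      (1 / r ^ d * ∫ x in ball 0 r, 4 * P (τ x) ∂thinMeasure d) := hψ.deriv.integrable_mul hc3
  have i12 : Integrable fun r => deriv ψ r *
      (1 / r ^ d * ∫ x in ball 0 r, ‖G x‖ ^ 2 ∂wMeasure d s) - deriv ψ r *
      (s * (r ^ (-(2 * s)) * ∫ θ, T r θ ^ 2 ∂wSphereMeasure d s)) := i1.sub i2
  -- the volume terms
  have hE : ∀ r, 0 ≤ r → d * η r + r * deriv η r = ∫ t in Ioi r, deriv ψ t / t ^ d := by
    intro r hr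
    rw [hψ.integral_Ioi_deriv_div_pow d hr, hηd r hr, ← hηi r hr]
    rcases hr.eq_or_lt with rfl | hr
    · simp [hψ.eq_zero_of_nonpos le_rfl]
    · field_simp
      ring
  have hqi : Integrable fun t => deriv ψ t / t ^ d :=
    (hψ.deriv.div_pow d).smooth.continuous.integrable_of_hasCompactSupport (hψ.deriv.div_pow d).compact
  have l1 := integral_comp_norm_mul_eq hG2 hqi hE
  have l3 := integral_comp_norm_mul_eq hP hqi hE
  have l2 := S.integral_slice_sq_eq hs hd hT hψ hρ
  have h1 := S.inner_variation hs hb hη hd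
  have h2 := S.energy_identity hs hb hη
  have hη0 : ∀ r, 0 ≤ r → 0 ≤ η r := fun r hr => by
    rw [hηi r hr]
    refine setIntegral_nonneg measurableSet_Ioi fun t ht => div_nonneg (hψ0 t) ?_
    have : (0 : ℝ) < t := hr.trans_lt ht
    positivity
  have hR : 0 ≤ ∫ x, η ‖x‖ * (2 * (τ x * b (τ x))) ∂thinMeasure d :=
    integral_nonneg fun x => mul_nonneg (hη0 _ (norm_nonneg x))
      (mul_nonneg zero_le_two (hb.mul_nonneg _))
  -- coefficients
  have hcoef : ∀ x : Space d, deriv η ‖x‖ / ‖x‖ = -(ψ ‖x‖ / ‖x‖ ^ (d + 2)) := fun x => by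
    rw [hηd _ (norm_nonneg x), neg_div, div_div, ← pow_succ]
  have hηc := hη.smooth.continuous
  have hcc : Continuous fun x : Space d => ψ ‖x‖ / ‖x‖ ^ (d + 2) :=
    (hψ.div_pow (d + 2)).smooth.continuous.comp continuous_norm
  obtain ⟨B₁, hB₁, hb₁⟩ := exists_bound_of_hasCompactSupport
    (hψ.div_pow (d + 2)).smooth.continuous (hψ.div_pow (d + 2)).compact
  obtain ⟨B₂, hB₂, hb₂⟩ := exists_bound_of_hasCompactSupport hηc hη.compact
  obtain ⟨B₃, hB₃, hb₃⟩ := exists_bound_of_hasCompactSupport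
    (c := fun r => d * η r + r * deriv η r)
    ((continuous_const.mul hηc).add hη.contDiff_mul_deriv.continuous)
    (hasCompactSupport_fun_add hη.compact.mul_left hη.hasCompactSupport_mul_deriv)
  have hbm : ∀ {f : Space d → ℝ}, Integrable f (wMeasure d s) →
      Integrable (fun x => ψ ‖x‖ / ‖x‖ ^ (d + 2) * f x) (wMeasure d s) := fun hf =>
    hf.bdd_mul (c := B₁) hcc.aestronglyMeasurable (ae_of_all _ fun x => hb₁ ‖x‖)
  have hu2 : Integrable (fun x => u x ^ 2) (wMeasure d s) := by
    simpa using integrable_norm_sq S.memLp_u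
  have hN2 : Integrable (fun x => (inner ℝ (G x) x : ℝ) ^ 2) (wMeasure d s) := by
    simpa using integrable_norm_sq S.memLp_inner_self
  have huN : Integrable (fun x => u x * inner ℝ (G x) x) (wMeasure d s) := by
    simpa [mul_comm] using integrable_inner S.memLp_u S.memLp_inner_self
  have hηG : Integrable (fun x => η ‖x‖ * ‖G x‖ ^ 2) (wMeasure d s) :=
    hG2.bdd_mul (c := B₂) (hηc.comp continuous_norm).aestronglyMeasurable
      (ae_of_all _ fun x => hb₂ ‖x‖)
  have hEG : Integrable (fun x => (d * η ‖x‖ + ‖x‖ * deriv η ‖x‖) * ‖G x‖ ^ 2) (wMeasure d s) :=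
    hG2.bdd_mul (c := B₃) ((((continuous_const.mul hηc).add
      hη.contDiff_mul_deriv.continuous).comp continuous_norm).aestronglyMeasurable)
      (ae_of_all _ fun x => hb₃ ‖x‖)
  have e1 : ∫ x, ((d - 2 * s) * η ‖x‖ + ‖x‖ * deriv η ‖x‖) * ‖G x‖ ^ 2 ∂wMeasure d s =
      ∫ x, (d * η ‖x‖ + ‖x‖ * deriv η ‖x‖) * ‖G x‖ ^ 2 ∂wMeasure d s -
      2 * s * ∫ x, η ‖x‖ * ‖G x‖ ^ 2 ∂wMeasure d s := by
    rw [← integral_const_mul, ← integral_sub hEG (hηG.const_mul _)]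
    exact integral_congr_ae (ae_of_all _ fun x => by simp only; ring)
  simp only [hcoef, neg_mul, integral_neg] at h1 h2
  rw [e1] at h1
  -- This square vanishes exactly when `x · ∇u = s u` holds almost everywhere on the set where
  -- `ψ(|x|) > 0`, that is, under infinitesimal homogeneity of degree `s`.
  have hsq : 0 ≤ ∫ x, ψ ‖x‖ / ‖x‖ ^ (d + 2) * (inner ℝ (G x) x - s * u x) ^ 2 ∂wMeasure d s :=
    integral_nonneg fun x => mul_nonneg (div_nonneg (hψ0 _) (by positivity)) (sq_nonneg _)
  have e2 : ∫ x, ψ ‖x‖ / ‖x‖ ^ (d + 2) * (inner ℝ (G x) x - s * u x) ^ 2 ∂wMeasure d s =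
      ∫ x, ψ ‖x‖ / ‖x‖ ^ (d + 2) * inner ℝ (G x) x ^ 2 ∂wMeasure d s -
      2 * s * ∫ x, ψ ‖x‖ / ‖x‖ ^ (d + 2) * (u x * inner ℝ (G x) x) ∂wMeasure d s +
      s ^ 2 * ∫ x, ψ ‖x‖ / ‖x‖ ^ (d + 2) * u x ^ 2 ∂wMeasure d s := by
    have j : Integrable (fun x => ψ ‖x‖ / ‖x‖ ^ (d + 2) * inner ℝ (G x) x ^ 2 -
        2 * s * (ψ ‖x‖ / ‖x‖ ^ (d + 2) * (u x * inner ℝ (G x) x))) (wMeasure d s) :=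
      (hbm hN2).sub ((hbm huN).const_mul _)
    rw [← integral_const_mul, ← integral_const_mul,
      ← integral_sub (hbm hN2) ((hbm huN).const_mul _), ← integral_add j ((hbm hu2).const_mul _)]
    exact integral_congr_ae (ae_of_all _ fun x => by simp only; ring)
  rw [e2] at hsq
  have e3 : ∫ r, deriv ψ r * (1 / r ^ d * (∫ x in ball 0 r, ‖G x‖ ^ 2 ∂wMeasure d s) -
      s * (r ^ (-(2 * s)) * ∫ θ, T r θ ^ 2 ∂wSphereMeasure d s) +
      1 / r ^ d * ∫ x in ball 0 r, 4 * P (τ x) ∂thinMeasure d) =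
      ∫ x, (d * η ‖x‖ + ‖x‖ * deriv η ‖x‖) * ‖G x‖ ^ 2 ∂wMeasure d s -
      s * (∫ r, deriv ψ r * (r ^ (-(2 * s)) * ∫ θ, T r θ ^ 2 ∂wSphereMeasure d s)) +
      ∫ x, (d * η ‖x‖ + ‖x‖ * deriv η ‖x‖) * (4 * P (τ x)) ∂thinMeasure d := by
    rw [l1, l3, ← integral_const_mul]
    simp only [mul_add, mul_sub]
    rw [integral_add i12 i3, integral_sub i1 i2]
    · congr 1
      · congr 1
        · exact integral_congr_ae (ae_of_all _ fun r => by simp only; ring)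
        · exact integral_congr_ae (ae_of_all _ fun r => by simp only; ring)
      · exact integral_congr_ae (ae_of_all _ fun r => by simp only; ring)
  rw [e3, l2]
  -- Substituting the domain variation identity and `2s` times the energy identity leaves minus
  -- twice the square integral and minus `2s` times the nonnegative reaction term of `hR`.
  nlinarith [hsq, hR, h1, h2, hs.1]

end ApproxSolution
end ThinReaction

/-! ### Localization, smooth approximation and the thin trace of Sobolev functions -/

namespace ThinReaction
open Filter Topology
open scoped ENNReal

variable {d : ℕ} {s ρ κ : ℝ} {u : Space d → ℝ} {G : Space d → Space d} {τ : Space d → ℝ}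
  {U : Set (Space d)} {f χ : Space d → ℝ} {F : Space d → Space d}

/-- `f` is a compactly supported element of the weighted Sobolev space, with weak gradient `F`. -/
structure IsGlobalSobolev (s : ℝ) (f : Space d → ℝ) (F : Space d → Space d) : Prop where
  meas : Measurable f
  meas_grad : Measurable F
  memLp : MemLp f 2 (wMeasure d s)
  memLp_grad : MemLp F 2 (wMeasure d s)
  compact : HasCompactSupport f
  compact_grad : HasCompactSupport F
  eq : ∀ ψ : Space d → ℝ, ContDiff ℝ ∞ ψ → HasCompactSupport ψ → ∀ e : Space d,
    ∫ x, f x * fderiv ℝ ψ x e = -∫ x, inner ℝ (F x) e * ψ x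

theorem integrable_smul_of_locallyIntegrableOn {E : Type*} [NormedAddCommGroup E] [NormedSpace ℝ E]
    {ν : Measure (Space d)} {g : Space d → E} (hg : LocallyIntegrableOn g U ν) {c : Space d → ℝ} (hc : Continuous c)
    (hcc : HasCompactSupport c) (hcU : tsupport c ⊆ U) : Integrable (fun x => c x • g x) ν := by
  have hsub : Function.support (fun x => c x • g x) ⊆ tsupport c :=
    (Function.support_smul_subset_left _ _).trans subset_closure
  rw [← integrableOn_iff_integrable_of_support_subset hsub]
  exact (hg.integrableOn_compact_subset hcU hcc.isCompact).continuousOn_smul hc.continuousOn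
    hcc.isCompact

theorem exists_measurable_ae_eq_of_tsupport {E : Type*} [NormedAddCommGroup E]
    [MeasurableSpace E] [BorelSpace E] {g : Space d → E} (hg : AEStronglyMeasurable g volume)
    {L : Set (Space d)} (hL : IsCompact L) (hgL : ∀ x, x ∉ L → g x = 0) :
    ∃ g', Measurable g' ∧ HasCompactSupport g' ∧ g' =ᵐ[volume] g := by
  refine ⟨L.indicator (hg.mk g), hg.stronglyMeasurable_mk.measurable.indicator hL.measurableSet,
    HasCompactSupport.intro hL fun x hx => indicator_of_notMem hx _, ?_⟩
  filter_upwards [hg.ae_eq_mk] with x hx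
  by_cases hxL : x ∈ L
  · rw [indicator_of_mem hxL, hx]
  · rw [indicator_of_notMem hxL, hgL x hxL]

theorem memLp_wMeasure_of_integrable {E : Type*} [NormedAddCommGroup E] {g : Space d → E}
    (hg : AEStronglyMeasurable g volume) (h : Integrable fun x => weight s x * ‖g x‖ ^ 2) :
    MemLp g 2 (wMeasure d s) := by
  rw [memLp_two_iff_integrable_sq_norm (hg.mono_ac (wMeasure_absolutelyContinuous d s)),
    ← integrableOn_univ, integrableOn_wMeasure_iff s _ _ MeasurableSet.univ]
  exact h.integrableOn

/-- Localization of Sobolev functions by a cutoff function. -/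
theorem MemWeightedSobolevLoc.exists_isGlobalSobolev (h : MemWeightedSobolevLoc s U u G)
    (hχ : IsTest U χ) :
    ∃ f F, IsGlobalSobolev s f F ∧ f =ᵐ[volume] (fun x => χ x * u x) ∧
      F =ᵐ[volume] fun x => χ x • G x + u x • gradient χ x := by
  have hχc := hχ.smooth.continuous
  have hχ1 : ContDiff ℝ 1 χ := hχ.smooth.of_le (by simp)
  have hgc := continuous_gradient hχ1
  have hgcs := hasCompactSupport_gradient hχ.compact
  have hgz : ∀ x, x ∉ tsupport χ → gradient χ x = 0 := by
    intro x hx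
    rw [gradient, image_eq_zero_of_notMem_tsupport (f := fderiv ℝ χ)
      (fun h => hx (tsupport_fderiv_subset ℝ h)), map_zero]
  have hz : ∀ x, x ∉ tsupport χ → χ x = 0 := fun x hx => image_eq_zero_of_notMem_tsupport hx
  have i1 : Integrable fun x => χ x * u x :=
    integrable_smul_of_locallyIntegrableOn h.weakGradient.locInt hχc hχ.compact hχ.support
  have i2 : Integrable fun x => χ x • G x :=
    integrable_smul_of_locallyIntegrableOn h.weakGradient.locInt_grad hχc hχ.compact hχ.support
  have i3 : Integrable fun x => u x • gradient χ x := by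
    have hsub : Function.support (fun x => u x • gradient χ x) ⊆ tsupport χ := fun x hx => by
      by_contra h0
      exact hx (by simp [hgz x h0])
    rw [← integrableOn_iff_integrable_of_support_subset hsub]
    exact (h.weakGradient.locInt.integrableOn_compact_subset hχ.support
      hχ.compact.isCompact).smul_continuousOn hgc.continuousOn hχ.compact.isCompact
  have hs2 : ∀ {c : Space d → ℝ}, Continuous c → (∀ x, x ∉ tsupport χ → c x = 0) →
      HasCompactSupport c ∧ tsupport c ⊆ U := fun {c} _ hc0 => by
    have h1 : Function.support c ⊆ tsupport χ := fun x hx => by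
      by_contra h0
      exact hx (hc0 x h0)
    have h2 : tsupport c ⊆ tsupport χ := closure_minimal h1 (isClosed_tsupport _)
    exact ⟨HasCompactSupport.intro hχ.compact.isCompact hc0, h2.trans hχ.support⟩
  have m1 : MemLp (fun x => χ x * u x) 2 (wMeasure d s) := by
    refine memLp_wMeasure_of_integrable i1.aestronglyMeasurable ?_
    have hc : Continuous fun x => χ x ^ 2 := by fun_prop
    obtain ⟨a1, a2⟩ := hs2 hc fun x hx => by simp [hz x hx]
    refine (integrable_smul_of_locallyIntegrableOn h.sq hc a1 a2).congr (ae_of_all _ fun x => ?_)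
    simp only [smul_eq_mul, norm_mul, Real.norm_eq_abs, mul_pow, sq_abs]
    ring
  have m2 : MemLp (fun x => χ x • G x) 2 (wMeasure d s) := by
    refine memLp_wMeasure_of_integrable i2.aestronglyMeasurable ?_
    have hc : Continuous fun x => χ x ^ 2 := by fun_prop
    obtain ⟨a1, a2⟩ := hs2 hc fun x hx => by simp [hz x hx]
    refine (integrable_smul_of_locallyIntegrableOn h.sq_grad hc a1 a2).congr
      (ae_of_all _ fun x => ?_)
    simp only [smul_eq_mul, norm_smul, Real.norm_eq_abs, mul_pow, sq_abs]
    ring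
  have m3 : MemLp (fun x => u x • gradient χ x) 2 (wMeasure d s) := by
    refine memLp_wMeasure_of_integrable i3.aestronglyMeasurable ?_
    have hc : Continuous fun x => ‖gradient χ x‖ ^ 2 := by fun_prop
    obtain ⟨a1, a2⟩ := hs2 hc fun x hx => by simp [hgz x hx]
    refine (integrable_smul_of_locallyIntegrableOn h.sq hc a1 a2).congr (ae_of_all _ fun x => ?_)
    simp only [smul_eq_mul, norm_smul, Real.norm_eq_abs, mul_pow, sq_abs]
    ring
  obtain ⟨f, hf1, hf2, hf3⟩ := exists_measurable_ae_eq_of_tsupport i1.aestronglyMeasurable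
    hχ.compact.isCompact fun x hx => by simp [hz x hx]
  obtain ⟨F, hF1, hF2, hF3⟩ := exists_measurable_ae_eq_of_tsupport (i2.add i3).aestronglyMeasurable
    hχ.compact.isCompact fun x hx => by simp [hz x hx, hgz x hx]
  have hac := wMeasure_absolutelyContinuous d s
  refine ⟨f, F, ⟨hf1, hF1, m1.ae_eq (hac.ae_eq hf3.symm), (m2.add m3).ae_eq (hac.ae_eq hF3.symm),
    hf2, hF2, fun ψ hψ hψc e => ?_⟩, hf3, hF3⟩
  have hψ0 := hψ.continuous
  have hψd : Continuous fun x => fderiv ℝ ψ x e :=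
    (hψ.continuous_fderiv (by simp)).clm_apply continuous_const
  have hψdc : HasCompactSupport fun x => fderiv ℝ ψ x e :=
    (hψc.fderiv ℝ).comp_left (g := fun L : Space d →L[ℝ] ℝ => L e) (by simp)
  obtain ⟨B₁, hB₁⟩ := hψ0.bounded_above_of_compact_support hψc
  obtain ⟨B₂, hB₂⟩ := hψd.bounded_above_of_compact_support hψdc
  have j1 : Integrable fun x => (χ x * u x) * fderiv ℝ ψ x e :=
    i1.mul_bdd (c := B₂) hψd.aestronglyMeasurable (ae_of_all _ hB₂)
  have j2 : Integrable fun x => inner ℝ (χ x • G x) e * ψ x :=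
    (i2.inner_const e).mul_bdd (c := B₁) hψ0.aestronglyMeasurable (ae_of_all _ hB₁)
  have j3 : Integrable fun x => inner ℝ (u x • gradient χ x) e * ψ x :=
    (i3.inner_const e).mul_bdd (c := B₁) hψ0.aestronglyMeasurable (ae_of_all _ hB₁)
  -- The product rule for the weak gradient follows by testing the definition with `χ ψ` and moving
  -- the term containing the gradient of `χ` to the other side.
  have ht : IsTest U fun x => χ x * ψ x := ⟨hχ.smooth.mul hψ, hχ.compact.mul_right,
    (closure_mono (Function.support_mul_subset_left _ _)).trans hχ.support⟩
  have key := h.weakGradient.eq _ ht e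
  have hfd : ∀ x, fderiv ℝ (fun x => χ x * ψ x) x e =
      χ x * fderiv ℝ ψ x e + ψ x * inner ℝ (gradient χ x) e := by
    intro x
    rw [fderiv_fun_mul (hχ.smooth.differentiable (by simp) x) (hψ.differentiable (by simp) x),
      inner_gradient_left]
    simp
  have hout : ∀ x, x ∉ U → x ∉ tsupport χ := fun x hx h => hx (hχ.support h)
  rw [setIntegral_eq_integral_of_forall_compl_eq_zero (fun x hx => by
      rw [hfd, hz x (hout x hx), hgz x (hout x hx)]; simp),
    setIntegral_eq_integral_of_forall_compl_eq_zero (fun x hx => by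
      rw [hz x (hout x hx)]; simp)] at key
  have e1 : ∫ x, f x * fderiv ℝ ψ x e = ∫ x, (χ x * u x) * fderiv ℝ ψ x e :=
    integral_congr_ae (by filter_upwards [hf3] with x hx; rw [hx])
  have e2 : ∫ x, inner ℝ (F x) e * ψ x =
      (∫ x, inner ℝ (χ x • G x) e * ψ x) + ∫ x, inner ℝ (u x • gradient χ x) e * ψ x := by
    rw [← integral_add j2 j3]
    refine integral_congr_ae ?_
    filter_upwards [hF3] with x hx
    rw [hx, Pi.add_apply, inner_add_left, add_mul]
  have e3 : ∫ x, u x * fderiv ℝ (fun x => χ x * ψ x) x e =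
      (∫ x, (χ x * u x) * fderiv ℝ ψ x e) + ∫ x, inner ℝ (u x • gradient χ x) e * ψ x := by
    rw [← integral_add j1 j3]
    refine integral_congr_ae (ae_of_all _ fun x => ?_)
    simp only [hfd, inner_smul_left, RCLike.conj_to_real]
    ring
  have e4 : ∫ x, inner ℝ (G x) e * (χ x * ψ x) = ∫ x, inner ℝ (χ x • G x) e * ψ x := by
    refine integral_congr_ae (ae_of_all _ fun x => ?_)
    simp only [inner_smul_left, RCLike.conj_to_real]
    ring
  rw [e3, e4] at key
  rw [e1, e2]
  linarith

/-- Smooth approximation of compactly supported weighted Sobolev functions. -/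
theorem IsGlobalSobolev.exists_approx (h : IsGlobalSobolev s f F) (hs : s ∈ Ioo (0 : ℝ) 1) :
    ∃ v : ℕ → Space d → ℝ, (∀ k, ContDiff ℝ ∞ (v k)) ∧ (∀ k, HasCompactSupport (v k)) ∧
      Tendsto (fun k => eLpNorm (v k - f) 2 (wMeasure d s)) atTop (𝓝 0) ∧
      Tendsto (fun k => eLpNorm (gradient (v k) - F) 2 (wMeasure d s)) atTop (𝓝 0) := by
  have hf := locallyIntegrable_of_memLp_wMeasure hs h.memLp
  have hF := locallyIntegrable_of_memLp_wMeasure hs h.memLp_grad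
  -- The outer radius is twice the inner one at every scale, as the uniform bound on mollifications
  -- demands.
  set φ : ℕ → ContDiffBump (0 : Space d) := fun k =>
    ⟨1 / ((k : ℝ) + 1), 2 * (1 / ((k : ℝ) + 1)), by positivity,
      by have : (0 : ℝ) < 1 / ((k : ℝ) + 1) := by positivity
         linarith⟩ with hφ
  have hφt : Tendsto (fun k => (φ k).rOut) atTop (𝓝 0) := by
    simpa [hφ] using (tendsto_one_div_add_atTop_nhds_zero_nat (𝕜 := ℝ)).const_mul 2
  refine ⟨fun k => mollify (φ k) f, fun k => contDiff_mollify _ hf,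
    fun k => hasCompactSupport_mollify _ h.compact,
    tendsto_mollify hs hφt (fun k => rfl) h.meas.stronglyMeasurable h.memLp, ?_⟩
  simp_rw [fun k => gradient_mollify (φ k) hf hF h.eq]
  exact tendsto_mollify hs hφt (fun k => rfl) h.meas_grad.stronglyMeasurable h.memLp_grad

theorem exists_eLpNorm_thinMeasure_le (hs : s ∈ Ioo (0 : ℝ) 1) :
    ∃ A : ℝ≥0∞, A ≠ ⊤ ∧ ∀ v : Space d → ℝ, ContDiff ℝ 1 v →
      eLpNorm v 2 (thinMeasure d) ≤
        A * (eLpNorm (gradient v) 2 (wMeasure d s) + eLpNorm v 2 (wMeasure d s)) := by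
  obtain ⟨C, hC, h⟩ := exists_lintegral_thinMeasure_le (d := d) hs one_pos
  refine ⟨(1 + C) ^ (1 / 2 : ℝ), ENNReal.rpow_ne_top_of_nonneg (by norm_num)
    (ENNReal.add_ne_top.2 ⟨ENNReal.one_ne_top, hC⟩), fun v hv => ?_⟩
  rw [eLpNorm_two_eq, eLpNorm_two_eq, eLpNorm_two_eq]
  have h1 : ∫⁻ x, ‖v x‖ₑ ^ 2 ∂thinMeasure d ≤ (1 + C) *
      (∫⁻ x, ‖gradient v x‖ₑ ^ 2 ∂wMeasure d s + ∫⁻ x, ‖v x‖ₑ ^ 2 ∂wMeasure d s) := by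
    refine (h v hv).trans ?_
    rw [ENNReal.ofReal_one, mul_add]
    gcongr
    · exact le_self_add
    · exact le_add_self
  refine (ENNReal.rpow_le_rpow h1 (by norm_num)).trans ?_
  rw [ENNReal.mul_rpow_of_nonneg _ _ (by norm_num)]
  gcongr
  exact ENNReal.rpow_add_le_add_rpow _ _ (by norm_num) (by norm_num)

/-- The traces of the approximations on the thin space converge. -/
theorem IsGlobalSobolev.exists_thinTrace (h : IsGlobalSobolev s f F) (hs : s ∈ Ioo (0 : ℝ) 1)
    {v : ℕ → Space d → ℝ} (hv : ∀ k, ContDiff ℝ ∞ (v k)) (hvc : ∀ k, HasCompactSupport (v k))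
    (ht : Tendsto (fun k => eLpNorm (v k - f) 2 (wMeasure d s)) atTop (𝓝 0))
    (htg : Tendsto (fun k => eLpNorm (gradient (v k) - F) 2 (wMeasure d s)) atTop (𝓝 0)) :
    ∃ T : Space d → ℝ, Measurable T ∧ MemLp T 2 (thinMeasure d) ∧
      Tendsto (fun k => eLpNorm (v k - T) 2 (thinMeasure d)) atTop (𝓝 0) := by
  have hfin' := isFiniteMeasureOnCompacts_thinMeasure d
  obtain ⟨A, hA, hAb⟩ := exists_eLpNorm_thinMeasure_le (d := d) hs
  have hv1 : ∀ k, ContDiff ℝ 1 (v k) := fun k => (hv k).of_le (by simp)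
  set δ : ℕ → ℝ≥0∞ := fun k => A * (eLpNorm (gradient (v k) - F) 2 (wMeasure d s) +
    eLpNorm (v k - f) 2 (wMeasure d s)) with hδ
  have hδ0 : Tendsto δ atTop (𝓝 0) := by
    simpa using ENNReal.Tendsto.const_mul (htg.add ht) (Or.inr hA)
  obtain ⟨T, hT1, hT2, hT3⟩ := exists_memLp_of_eLpNorm_sub_le (ν := thinMeasure d) (f := v)
    (fun k => (hv1 k).continuous.memLp_of_hasCompactSupport (hvc k)) hδ0 (fun k m => by
      refine (hAb _ ((hv1 k).sub (hv1 m))).trans ?_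
      rw [hδ]
      simp only
      rw [← mul_add]
      refine mul_le_mul' le_rfl ?_
      change eLpNorm (gradient (v k - v m)) 2 _ + eLpNorm (v k - v m) 2 _ ≤ _
      have e1 : v k - v m = (v k - f) - (v m - f) := by abel
      have e2 : gradient (v k - v m) = (gradient (v k) - F) - (gradient (v m) - F) := by
        rw [gradient_sub ((hv1 k).differentiable (by simp)) ((hv1 m).differentiable (by simp))]
        abel
      have m1 : ∀ k, AEStronglyMeasurable (v k - f) (wMeasure d s) := fun k =>
        ((hv1 k).continuous.measurable.sub h.meas).aestronglyMeasurable
      have m2 : ∀ k, AEStronglyMeasurable (gradient (v k) - F) (wMeasure d s) := fun k =>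
        ((continuous_gradient (hv1 k)).measurable.sub h.meas_grad).aestronglyMeasurable
      rw [e2, e1]
      refine (add_le_add (eLpNorm_sub_le (m2 k) (m2 m) (by norm_num))
        (eLpNorm_sub_le (m1 k) (m1 m) (by norm_num))).trans (le_of_eq ?_)
      abel)
  exact ⟨T, hT1, hT2, tendsto_of_tendsto_of_tendsto_of_le_of_le tendsto_const_nhds hδ0
    (fun _ => zero_le) hT3⟩

/-- The Gauss-Green formula in the half-space. -/
theorem IsGlobalSobolev.integral_halfspace (h : IsGlobalSobolev s f F) (hs : s ∈ Ioo (0 : ℝ) 1)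
    {v : ℕ → Space d → ℝ} (hv : ∀ k, ContDiff ℝ ∞ (v k)) (hvc : ∀ k, HasCompactSupport (v k))
    (ht : Tendsto (fun k => eLpNorm (v k - f) 2 (wMeasure d s)) atTop (𝓝 0))
    (htg : Tendsto (fun k => eLpNorm (gradient (v k) - F) 2 (wMeasure d s)) atTop (𝓝 0))
    {T : Space d → ℝ} (hT : MemLp T 2 (thinMeasure d))
    (htT : Tendsto (fun k => eLpNorm (v k - T) 2 (thinMeasure d)) atTop (𝓝 0))
    {φ : Space d → ℝ} (hφ : ContDiff ℝ ∞ φ) (hφc : HasCompactSupport φ) :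
    ∫ x in {x : Space d | 0 < x (Fin.last d)},
        (f x * fderiv ℝ φ x (normalVec d) + inner ℝ (F x) (normalVec d) * φ x) =
      -∫ x, T x * φ x ∂thinMeasure d := by
  have hfin := isFiniteMeasureOnCompacts_wMeasure (d := d) hs.2
  have hfin' := isFiniteMeasureOnCompacts_thinMeasure d
  have hv1 : ∀ k, ContDiff ℝ 1 (v k) := fun k => (hv k).of_le (by simp)
  have hφ0 := hφ.continuous
  have hfd : Continuous fun x => fderiv ℝ φ x (normalVec d) :=
    (hφ.continuous_fderiv (by simp)).clm_apply continuous_const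
  have hfdc : HasCompactSupport fun x => fderiv ℝ φ x (normalVec d) :=
    (hφc.fderiv ℝ).comp_left (g := fun L : Space d →L[ℝ] ℝ => L (normalVec d)) (by simp)
  obtain ⟨R, hR⟩ := hφc.isCompact.isBounded.subset_ball 0
  have hms : MeasurableSet {x : Space d | 0 < x (Fin.last d)} :=
    measurableSet_lt measurable_const measurable_last
  -- The half-space is cut down to the ball containing the support of `φ`, because the inverse
  -- weight is integrable only locally.
  set S := {x : Space d | 0 < x (Fin.last d)} ∩ ball 0 R with hS
  have hSm : MeasurableSet S := hms.inter measurableSet_ball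
  have hred : ∀ (a : Space d → ℝ) (E : Space d → Space d),
      ∫ x in {x : Space d | 0 < x (Fin.last d)},
        (a x * fderiv ℝ φ x (normalVec d) + inner ℝ (E x) (normalVec d) * φ x) =
      ∫ x in S, (inner ℝ (a x) (fderiv ℝ φ x (normalVec d)) +
        inner ℝ (E x) (φ x • normalVec d)) := by
    intro a E
    rw [setIntegral_eq_of_subset_of_forall_sdiff_eq_zero hms (inter_subset_left (t := ball 0 R))]
    · refine integral_congr_ae (ae_of_all _ fun x => ?_)
      simp only [RCLike.inner_apply, conj_trivial, inner_smul_right]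
      ring
    · intro x hx
      have hx' : x ∉ tsupport φ := fun h => hx.2 ⟨hx.1, hR h⟩
      rw [image_eq_zero_of_notMem_tsupport hx', image_eq_zero_of_notMem_tsupport (f := fderiv ℝ φ)
        (fun h => hx' (tsupport_fderiv_subset ℝ h))]
      simp
  have hdens : (volume.restrict S).withDensity (fun x => ENNReal.ofReal (weight s x)) =
      (wMeasure d s).restrict S := by
    rw [wMeasure, restrict_withDensity hSm]
  have hwv : ∀ᵐ x ∂volume.restrict S,
      ENNReal.ofReal (weight s x) * ENNReal.ofReal (weight (1 - s) x) = 1 := by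
    refine ae_restrict_of_ae ?_
    filter_upwards [ae_last_ne_zero d] with x hx
    exact ofReal_weight_mul s hx
  have hVi : ∫⁻ x in S, ENNReal.ofReal (weight (1 - s) x) ≠ ⊤ :=
    ((lintegral_mono_set inter_subset_right).trans_lt
      (lintegral_weight_one_sub_ball_ne_top (d := d) hs.1 R).lt_top).ne
  have hlim : ∀ {E : Type} [NormedAddCommGroup E] [InnerProductSpace ℝ E] {a : ℕ → Space d → E}
      {g c : Space d → E}, (∀ k, Continuous (a k)) → (∀ k, HasCompactSupport (a k)) →
      AEStronglyMeasurable g volume → MemLp g 2 (wMeasure d s) →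
      Tendsto (fun k => eLpNorm (a k - g) 2 (wMeasure d s)) atTop (𝓝 0) →
      Continuous c → HasCompactSupport c → _ :=
    fun {E} _ _ {a g c} ha hac hg hgL ht hc hcc =>
    tendsto_integral_mul_of_withDensity (ν := volume.restrict S)
      (W := fun θ => ENNReal.ofReal (weight s θ)) (V := fun θ => ENNReal.ofReal (weight (1 - s) θ))
      (measurable_weight s).ennreal_ofReal (measurable_weight _).ennreal_ofReal hwv
      hVi (f := a) (g := g)
      (fun k => (ha k).aestronglyMeasurable) hg.restrict
      (fun k => by
        rw [hdens]
        exact (((ha k).memLp_of_hasCompactSupport (hac k)).restrict _).eLpNorm_ne_top)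
      (by rw [hdens]; exact (hgL.restrict _).eLpNorm_ne_top)
      (by
        rw [hdens]
        exact tendsto_of_tendsto_of_tendsto_of_le_of_le tendsto_const_nhds ht (fun _ => zero_le)
          fun k => eLpNorm_mono_measure _ Measure.restrict_le_self)
      (c := c) hc.aestronglyMeasurable (B := (hc.bounded_above_of_compact_support hcc).choose)
      (ae_of_all _ (hc.bounded_above_of_compact_support hcc).choose_spec)
  obtain ⟨-, hu1, hu2, hu3⟩ := hlim (fun k => (hv1 k).continuous) hvc
    h.meas.aestronglyMeasurable h.memLp ht hfd hfdc
  obtain ⟨-, hG1, hG2, hG3⟩ := hlim (fun k => continuous_gradient (hv1 k))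
    (fun k => hasCompactSupport_gradient (hvc k))
    h.meas_grad.aestronglyMeasurable h.memLp_grad htg
    (c := fun x => φ x • normalVec d) (hφ0.smul continuous_const) hφc.smul_right
  beta_reduce at hu1 hu2 hu3 hG1 hG2 hG3
  have hsum := hu3.add hG3
  rw [← integral_add hu2 hG2] at hsum
  have hφL : MemLp φ 2 (thinMeasure d) := hφ0.memLp_of_hasCompactSupport hφc
  have hthin := (tendsto_integral_mul hT hφL
    (fun k => (hv1 k).continuous.memLp_of_hasCompactSupport (hvc k)) (fun _ => hφL) htT
    (by simp : Tendsto (fun _ : ℕ => eLpNorm (φ - φ) 2 (thinMeasure d)) atTop (𝓝 0))).neg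
  rw [hred]
  refine tendsto_nhds_unique hsum (hthin.congr fun k => ?_)
  rw [← integral_add (hu1 k) (hG1 k), ← hred (v k) (gradient (v k)),
    ← integral_halfspace_fderiv ((hv1 k).mul (hφ.of_le (by simp)))
      ((hvc k).mul_right (f' := φ))]
  refine integral_congr_ae (ae_of_all _ fun x => ?_)
  simp only
  change fderiv ℝ (fun x => v k x * φ x) x (normalVec d) = _
  rw [fderiv_fun_mul ((hv1 k).differentiable (by simp) x) (hφ.differentiable (by simp) x),
    inner_gradient_left]
  simp [mul_comm]

end ThinReaction

/-! ### The reaction term, the prescribed thin trace and the reduction to the origin -/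

namespace ThinReaction
open Filter Topology
open scoped ENNReal

variable {d : ℕ} {s ρ ε : ℝ} {u : Space d → ℝ} {G : Space d → Space d} {τ : Space d → ℝ}
  {β : ℝ → ℝ} {M : ℝ} {A : ℝ≥0}

namespace IsCombustion

theorem eq_zero_of_neg (h : IsCombustion β M A) {t : ℝ} (ht : t < 0) : β t = 0 :=
  image_eq_zero_of_notMem_tsupport (by rw [h.tsupport_eq]; exact fun h0 => not_lt.2 h0.1 ht)

theorem map_zero (h : IsCombustion β M A) : β 0 = 0 := by
  have h1 : IsClosed {t | β t = 0} := isClosed_eq h.lipschitz.continuous continuous_const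
  have h2 : closure (Iio (0 : ℝ)) ⊆ {t | β t = 0} :=
    closure_minimal (fun t ht => h.eq_zero_of_neg ht) h1
  rw [closure_Iio] at h2
  exact h2 (mem_Iic.2 le_rfl)

/-- The scaling `β(t/ε)/ε` multiplies the Lipschitz constant by `ε⁻²`. The sign condition holds
since the reaction term is nonnegative and vanishes on the negative axis. -/
theorem isReaction (h : IsCombustion β M A) (hε : 0 < ε) :
    IsReaction (betaEps β ε) (primEps β ε) (A * (1 / ε ^ 2).toNNReal) := by
  have hlip : LipschitzWith (A * (1 / ε ^ 2).toNNReal) (betaEps β ε) := by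
    refine LipschitzWith.of_dist_le_mul fun x y => ?_
    have h1 := h.lipschitz.dist_le_mul (x / ε) (y / ε)
    rw [Real.dist_eq, Real.dist_eq] at h1 ⊢
    rw [betaEps, betaEps, ← mul_sub, abs_mul, abs_of_pos (by positivity), NNReal.coe_mul,
      Real.coe_toNNReal _ (by positivity)]
    calc 1 / ε * |β (x / ε) - β (y / ε)| ≤ 1 / ε * (A * |x / ε - y / ε|) := by gcongr
      _ = _ := by
        rw [← sub_div, abs_div, abs_of_pos hε]
        field_simp
  refine ⟨hlip, fun t => ?_, by simp [betaEps, h.map_zero], fun t => ?_, by simp [primEps]⟩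
  · rcases lt_or_ge t 0 with ht | ht
    · simp [betaEps, h.eq_zero_of_neg (div_neg_of_neg_of_pos ht hε)]
    · exact mul_nonneg ht (mul_nonneg (by positivity) (h.nonneg _))
  · exact (hlip.continuous.integral_hasStrictDerivAt 0 t).hasDerivAt

end IsCombustion

theorem measurePreserving_add_thinMeasure {z : Space d} (hz : z (Fin.last d) = 0) :
    MeasurePreserving (fun x => z + x) (thinMeasure d) (thinMeasure d) := by
  set z' : EuclideanSpace ℝ (Fin d) := WithLp.toLp 2 fun i => z i.castSucc with hz'
  have e : thinEmbed z' = z := by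
    ext i
    refine Fin.lastCases ?_ (fun j => ?_) i
    · rw [thinEmbed_last, hz]
    · rw [thinEmbed_castSucc]
  have hm := (continuous_thinEmbed (d := d)).measurable
  refine ⟨measurable_const_add z, ?_⟩
  rw [thinMeasure, Measure.map_map (measurable_const_add z) hm]
  have e2 : (fun x => z + x) ∘ thinEmbed = thinEmbed ∘ fun y => z' + y := by
    ext1 y
    simp only [Function.comp_apply]
    rw [thinEmbed_add, e]
  rw [e2, ← Measure.map_map hm (measurable_const_add z'),
    (measurePreserving_add_left volume z').map_eq]

theorem gradient_comp_add_left (f : Space d → ℝ) (z : Space d) :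
    gradient (fun y => f (z + y)) = fun y => gradient f (z + y) := by
  ext1 y
  rw [gradient, gradient, fderiv_comp_add_left]

/-- The trace obtained by approximation and the prescribed one satisfy the same Gauss-Green formula
in the half-space, the latter after testing with `χ φ`. They therefore agree against all test
functions. -/
theorem ae_eq_on_thinMeasure_of_trace {χ f : Space d → ℝ} {F : Space d → Space d}
    (hs : s ∈ Ioo (0 : ℝ) 1) (hτ : IsThinTrace u G τ) (hχ : IsTest (ball 0 1) χ)
    (h : IsGlobalSobolev s f F) (hf : f =ᵐ[volume] fun x => χ x * u x)
    (hF : F =ᵐ[volume] fun x => χ x • G x + u x • gradient χ x)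
    {v : ℕ → Space d → ℝ} (hv : ∀ k, ContDiff ℝ ∞ (v k)) (hvc : ∀ k, HasCompactSupport (v k))
    (ht : Tendsto (fun k => eLpNorm (v k - f) 2 (wMeasure d s)) atTop (𝓝 0))
    (htg : Tendsto (fun k => eLpNorm (gradient (v k) - F) 2 (wMeasure d s)) atTop (𝓝 0))
    {T : Space d → ℝ} (hT : MemLp T 2 (thinMeasure d))
    (htT : Tendsto (fun k => eLpNorm (v k - T) 2 (thinMeasure d)) atTop (𝓝 0)) :
    T =ᵐ[thinMeasure d] fun x => χ x * τ x := by
  have hfin' := isFiniteMeasureOnCompacts_thinMeasure d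
  have hi : Integrable (fun x => χ x * τ x) (thinMeasure d) :=
    integrable_smul_of_locallyIntegrableOn hτ.locInt hχ.smooth.continuous hχ.compact hχ.support
  have hTl : LocallyIntegrable T (thinMeasure d) := hT.locallyIntegrable (by norm_num)
  have hz : ∀ x, x ∉ ball (0 : Space d) 1 → χ x = 0 := fun x hx =>
    image_eq_zero_of_notMem_tsupport fun h => hx (hχ.support h)
  have hms : MeasurableSet {x : Space d | 0 < x (Fin.last d)} :=
    measurableSet_lt measurable_const measurable_last
  have key := ae_eq_zero_of_integral_contDiff_smul_eq_zero (hTl.sub hi.locallyIntegrable)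
    fun φ hφ hφc => by
      have hφ0 := hφ.continuous
      obtain ⟨B, hB⟩ := hφ0.bounded_above_of_compact_support hφc
      have ht' : IsTest (ball 0 1) fun x => χ x * φ x := ⟨hχ.smooth.mul hφ, hχ.compact.mul_right,
        (closure_mono (Function.support_mul_subset_left _ _)).trans hχ.support⟩
      have h1 := hτ.eq _ ht'
      have h2 := h.integral_halfspace hs hv hvc ht htg hT htT hφ hφc
      have hfd : ∀ x e, fderiv ℝ (fun x => χ x * φ x) x e =
          χ x * fderiv ℝ φ x e + φ x * inner ℝ (gradient χ x) e := by
        intro x e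
        rw [fderiv_fun_mul (hχ.smooth.differentiable (by simp) x)
          (hφ.differentiable (by simp) x), inner_gradient_left]
        simp
      have h3 : ∫ x in {x : Space d | 0 < x (Fin.last d)},
          (f x * fderiv ℝ φ x (normalVec d) + inner ℝ (F x) (normalVec d) * φ x) =
          ∫ x in {x : Space d | 0 < x (Fin.last d)},
          (u x * fderiv ℝ (fun x => χ x * φ x) x (normalVec d) +
            G x (Fin.last d) * (χ x * φ x)) := by
        refine integral_congr_ae (ae_restrict_of_ae ?_)
        filter_upwards [hf, hF] with x hx1 hx2
        have h5 : inner ℝ (G x) (normalVec d) = G x (Fin.last d) := by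
          simp [normalVec, EuclideanSpace.inner_single_right]
        rw [hx1, hx2, hfd, inner_add_left, inner_smul_left, inner_smul_left, h5]
        simp only [RCLike.conj_to_real]
        ring
      have h4 : ∫ x in {x : Space d | 0 < x (Fin.last d)},
          (u x * fderiv ℝ (fun x => χ x * φ x) x (normalVec d) +
            G x (Fin.last d) * (χ x * φ x)) =
          ∫ x in ball 0 1 ∩ {x | 0 < x (Fin.last d)},
          (u x * fderiv ℝ (fun x => χ x * φ x) x (EuclideanSpace.single (Fin.last d) 1) +
            G x (Fin.last d) * (χ x * φ x)) := by
        refine setIntegral_eq_of_subset_of_forall_sdiff_eq_zero hms inter_subset_right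
          fun x hx => ?_
        have hx' : x ∉ ball (0 : Space d) 1 := fun h => hx.2 ⟨h, hx.1⟩
        have hx2 : x ∉ tsupport fun x => χ x * φ x := fun h => hx' (ht'.support h)
        rw [hz x hx', image_eq_zero_of_notMem_tsupport (f := fderiv ℝ fun x => χ x * φ x)
          (fun h => hx2 (tsupport_fderiv_subset ℝ h))]
        simp
      have h5 : ∫ x in ball 0 1, τ x * (χ x * φ x) ∂thinMeasure d =
          ∫ x, τ x * (χ x * φ x) ∂thinMeasure d :=
        setIntegral_eq_integral_of_forall_compl_eq_zero fun x hx => by rw [hz x hx]; simp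
      have h6 : ∫ x, T x * φ x ∂thinMeasure d = ∫ x, τ x * (χ x * φ x) ∂thinMeasure d := by
        rw [← h5]
        linarith [h2.symm.trans (h3.trans (h4.trans h1))]
      have hφL : MemLp φ 2 (thinMeasure d) := hφ0.memLp_of_hasCompactSupport hφc
      have i1 : Integrable (fun x => T x * φ x) (thinMeasure d) := by
        simpa [mul_comm] using integrable_inner hT hφL
      have i2 : Integrable (fun x => τ x * (χ x * φ x)) (thinMeasure d) := by
        refine (hi.mul_bdd (c := B) hφ0.aestronglyMeasurable (ae_of_all _ hB)).congr
          (ae_of_all _ fun x => ?_)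
        simp only
        ring
      rw [← sub_eq_zero, ← integral_sub i1 i2] at h6
      rw [← h6]
      refine integral_congr_ae (ae_of_all _ fun x => ?_)
      simp only [Pi.sub_apply, smul_eq_mul]
      ring
  filter_upwards [key] with x hx
  exact sub_eq_zero.1 hx

/-- Localization of a weak solution to a ball centred on the thin space, moved to the origin, with
smooth approximations. -/
theorem IsWeakSolution.exists_approxSolution (hu : IsWeakSolution s ε β u G τ)
    (hs : s ∈ Ioo (0 : ℝ) 1) {x₀ : Space d} (hx₀ : x₀ (Fin.last d) = 0) (hρ0 : 0 < ρ)
    (hρ : ρ < 1 - ‖x₀‖) :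
    ∃ u₁ G₁ τ₁ v, ApproxSolution s ρ (betaEps β ε) u₁ G₁ τ₁ v ∧
      (∀ᵐ y, y ∈ ball (0 : Space d) ρ → u₁ y = u (x₀ + y) ∧ G₁ y = G (x₀ + y)) ∧
      ∀ᵐ y ∂thinMeasure d, y ∈ ball (0 : Space d) ρ → τ₁ y = τ (x₀ + y) := by
  -- The cutoff equals one on the ball where the equation is to be preserved, and its outer radius,
  -- halfway to the distance from the unit sphere, keeps the support inside the unit ball.
  set χ : ContDiffBump x₀ := ⟨ρ, (ρ + (1 - ‖x₀‖)) / 2, hρ0, by linarith⟩ with hχdef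
  have hχ : IsTest (ball 0 1) χ := by
    refine ⟨χ.contDiff, χ.hasCompactSupport, ?_⟩
    rw [χ.tsupport_eq]
    intro x hx
    rw [mem_closedBall, dist_eq_norm] at hx
    rw [mem_ball_zero_iff]
    have h1 : ‖x‖ ≤ ‖x - x₀‖ + ‖x₀‖ := by simpa using norm_add_le (x - x₀) x₀
    have h2 : χ.rOut = (ρ + (1 - ‖x₀‖)) / 2 := rfl
    rw [h2] at hx
    linarith
  have hone : ∀ x ∈ ball x₀ ρ, χ x = 1 := fun x hx =>
    χ.one_of_mem_closedBall (ball_subset_closedBall hx)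
  have hgz : ∀ x ∈ ball x₀ ρ, gradient χ x = 0 := fun x hx => by
    have h1 : (χ : Space d → ℝ) =ᶠ[𝓝 x] fun _ => 1 := by
      filter_upwards [isOpen_ball.mem_nhds hx] with y hy using hone y hy
    rw [gradient, h1.fderiv_eq]
    simp
  have hsub : ball x₀ ρ ⊆ ball (0 : Space d) 1 := fun x hx => by
    refine hχ.support (subset_tsupport _ ?_)
    rw [Function.mem_support, hone x hx]
    exact one_ne_zero
  obtain ⟨f, F, h, hf, hF⟩ := hu.sobolev.exists_isGlobalSobolev hχ
  obtain ⟨v, hv, hvc, ht, htg⟩ := h.exists_approx hs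
  obtain ⟨T, hTm, hT, htT⟩ := h.exists_thinTrace hs hv hvc ht htg
  have hTτ := ae_eq_on_thinMeasure_of_trace hs hu.trace hχ h hf hF hv hvc ht htg hT htT
  have hf' : ∀ᵐ x, x ∈ ball x₀ ρ → f x = u x ∧ F x = G x := by
    filter_upwards [hf, hF] with x h1 h2 hx
    rw [h1, h2, hone x hx, hgz x hx]
    simp
  have hT' : ∀ᵐ x ∂thinMeasure d, x ∈ ball x₀ ρ → T x = τ x := by
    filter_upwards [hTτ] with x h1 hx
    rw [h1, hone x hx, one_mul]
  have hmp := measurePreserving_add_wMeasure s hx₀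
  have hmp' := measurePreserving_add_thinMeasure hx₀
  have hem : MeasurableEmbedding fun x : Space d => x₀ + x := measurableEmbedding_addLeft x₀
  have hball : ∀ y : Space d, y ∈ ball (0 : Space d) ρ → x₀ + y ∈ ball x₀ ρ := fun y hy => by
    simpa [dist_eq_norm] using hy
  refine ⟨fun y => f (x₀ + y), fun y => F (x₀ + y), fun y => T (x₀ + y),
    fun k y => v k (x₀ + y), ?_, ?_, ?_⟩
  · refine ⟨h.meas.comp (measurable_const_add _), h.meas_grad.comp (measurable_const_add _),
      hTm.comp (measurable_const_add _), h.memLp.comp_measurePreserving hmp,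
      h.memLp_grad.comp_measurePreserving hmp, hT.comp_measurePreserving hmp', ?_,
      fun k => (hv k).comp (contDiff_const.add contDiff_id),
      fun k => (hvc k).comp_homeomorph (Homeomorph.addLeft x₀), ?_, ?_, ?_, ?_⟩
    · obtain ⟨R, hR⟩ := h.compact_grad.isCompact.isBounded.subset_ball 0
      refine ⟨R + ‖x₀‖, fun x hx => image_eq_zero_of_notMem_tsupport fun hx' => ?_⟩
      have h1 := mem_ball_zero_iff.1 (hR hx')
      have h2 : ‖x‖ ≤ ‖x₀ + x‖ + ‖x₀‖ := by simpa using norm_sub_le (x₀ + x) x₀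
      linarith
    · refine ht.congr fun k => ?_
      exact (eLpNorm_comp_measurePreserving (g := v k - f)
        ((hv k).continuous.measurable.sub h.meas).aestronglyMeasurable hmp).symm
    · refine htg.congr fun k => ?_
      rw [gradient_comp_add_left]
      exact (eLpNorm_comp_measurePreserving (g := gradient (v k) - F)
        ((continuous_gradient ((hv k).of_le (by simp))).measurable.sub
          h.meas_grad).aestronglyMeasurable hmp).symm
    · refine htT.congr fun k => ?_
      exact (eLpNorm_comp_measurePreserving (g := v k - T)
        ((hv k).continuous.measurable.sub hTm).aestronglyMeasurable hmp').symm
    · intro φ hφ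
      -- The translated test function is supported where the cutoff is one, so the truncated and the
      -- original solution satisfy the same equation against it.
      set φ' : Space d → ℝ := fun x => φ (x - x₀) with hφ'
      have hsupp : tsupport φ' ⊆ ball x₀ ρ := by
        intro x hx
        have h1 : x - x₀ ∈ tsupport φ :=
          tsupport_comp_subset_preimage φ (continuous_id.sub continuous_const) hx
        have h2 := hφ.support h1
        rw [mem_ball_zero_iff] at h2
        rwa [mem_ball, dist_eq_norm]
      have ht' : IsTest (ball 0 1) φ' := ⟨hφ.smooth.comp (contDiff_id.sub contDiff_const),
        hφ.compact.comp_homeomorph (Homeomorph.subRight x₀), hsupp.trans hsub⟩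
      have hφe : ∀ y, φ y = φ' (x₀ + y) := fun y => by simp [hφ']
      have hφg : ∀ y, gradient φ y = gradient φ' (x₀ + y) := fun y => by
        have h1 := congrFun (gradient_comp_add_left φ' x₀) y
        rw [← h1]
        congr 1
        ext y
        exact hφe y
      have h1 := hu.eq φ' ht'
      rw [← integral_wMeasure s (fun x => fderiv ℝ φ' x (G x)) _ measurableSet_ball] at h1
      simp_rw [hφe, hφg]
      have e1 : ∫ y, inner ℝ (F (x₀ + y)) (gradient φ' (x₀ + y)) ∂wMeasure d s =
          ∫ x in ball 0 1, fderiv ℝ φ' x (G x) ∂wMeasure d s := by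
        rw [hmp.integral_comp hem (fun x => inner ℝ (F x) (gradient φ' x)),
          setIntegral_eq_integral_of_forall_compl_eq_zero (fun x hx => by
            rw [image_eq_zero_of_notMem_tsupport (f := fderiv ℝ φ')
              (fun h => hx (ht'.support (tsupport_fderiv_subset ℝ h)))]; simp)]
        refine integral_congr_ae ((wMeasure_absolutelyContinuous d s).ae_le ?_)
        filter_upwards [hf'] with x hx
        by_cases hx' : x ∈ ball x₀ ρ
        · rw [(hx hx').2, real_inner_comm, inner_gradient_left]
        · have h0 : fderiv ℝ φ' x = 0 := image_eq_zero_of_notMem_tsupport (f := fderiv ℝ φ')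
              (fun h => hx' (hsupp (tsupport_fderiv_subset ℝ h)))
          rw [real_inner_comm, inner_gradient_left, h0]
          simp
      have e2 : ∫ y, 2 * betaEps β ε (T (x₀ + y)) * φ' (x₀ + y) ∂thinMeasure d =
          ∫ x in ball 0 1, 2 * betaEps β ε (τ x) * φ' x ∂thinMeasure d := by
        rw [hmp'.integral_comp hem (fun x => 2 * betaEps β ε (T x) * φ' x),
          setIntegral_eq_integral_of_forall_compl_eq_zero (fun x hx => by
            rw [image_eq_zero_of_notMem_tsupport (f := φ') (fun h => hx (ht'.support h)), mul_zero])]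
        refine integral_congr_ae ?_
        filter_upwards [hT'] with x hx
        by_cases hx' : x ∈ ball x₀ ρ
        · rw [hx hx']
        · rw [image_eq_zero_of_notMem_tsupport (f := φ') (fun h => hx' (hsupp h)), mul_zero,
            mul_zero]
      rw [e1, e2, h1]
  · filter_upwards [(measurePreserving_add_left volume x₀).quasiMeasurePreserving.ae hf']
      with y hy hy'
    exact hy (hball y hy')
  · filter_upwards [hmp'.quasiMeasurePreserving.ae hT'] with y hy hy'
    exact hy (hball y hy')

end ThinReaction

/-! ### The Weiss functional in terms of the translated solution -/

namespace ThinReaction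
open Filter Topology
open scoped ENNReal

variable {d : ℕ} {s ρ r ε : ℝ} {u u₁ : Space d → ℝ} {G G₁ : Space d → Space d}
  {τ τ₁ : Space d → ℝ} {v : ℕ → Space d → ℝ} {b P β : ℝ → ℝ} {K : ℝ≥0} {x₀ : Space d}
  {μ : Measure (Space d)} {δ : ℕ → ℝ≥0∞} {T : ℝ → Space d → ℝ}

theorem preimage_add_left_ball (x₀ : Space d) (r : ℝ) :
    (fun x => x₀ + x) ⁻¹' ball x₀ r = ball 0 r := by
  ext y
  simp [dist_eq_norm]

theorem setIntegral_ball_eq (hμ : MeasurePreserving (fun x => x₀ + x) μ μ) {f f₁ : Space d → ℝ}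
    (h : ∀ᵐ y ∂μ, y ∈ ball (0 : Space d) ρ → f₁ y = f (x₀ + y)) (hr : r ≤ ρ) :
    ∫ x in ball x₀ r, f x ∂μ = ∫ y in ball 0 r, f₁ y ∂μ := by
  rw [← hμ.setIntegral_preimage_emb (measurableEmbedding_addLeft x₀), preimage_add_left_ball]
  refine setIntegral_congr_ae measurableSet_ball ?_
  filter_upwards [h] with y hy hyr
  exact (hy (ball_subset_ball hr hyr)).symm

theorem integrableOn_ball_iff (hμ : MeasurePreserving (fun x => x₀ + x) μ μ) {f f₁ : Space d → ℝ}
    (h : ∀ᵐ y ∂μ, y ∈ ball (0 : Space d) ρ → f₁ y = f (x₀ + y)) (hr : r ≤ ρ) :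
    IntegrableOn f (ball x₀ r) μ ↔ IntegrableOn f₁ (ball 0 r) μ := by
  rw [← hμ.integrableOn_comp_preimage (measurableEmbedding_addLeft x₀), preimage_add_left_ball]
  refine integrableOn_congr_fun_ae ?_
  filter_upwards [ae_restrict_of_ae h, ae_restrict_mem measurableSet_ball] with y hy hyr
  exact (hy (ball_subset_ball hr hyr)).symm

theorem integral_wSphereMeasure (s : ℝ) (f : Space d → ℝ) :
    ∫ θ, f θ ∂wSphereMeasure d s = ∫ θ, weight s θ * f θ ∂unitSphereMeasure (Space d) := by
  rw [wSphereMeasure, integral_withDensity_eq_integral_toReal_smul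
    (measurable_weight s).ennreal_ofReal (by simp)]
  simp [ENNReal.toReal_ofReal, weight_nonneg]

theorem integrable_wSphereMeasure_iff (s : ℝ) (f : Space d → ℝ) :
    Integrable f (wSphereMeasure d s) ↔
      Integrable (fun θ => weight s θ * f θ) (unitSphereMeasure (Space d)) := by
  rw [wSphereMeasure,
    integrable_withDensity_iff_integrable_smul' (measurable_weight s).ennreal_ofReal (by simp)]
  simp [ENNReal.toReal_ofReal, weight_nonneg]

/-- The slices satisfy the Gauss-Green formula on balls about the origin, and translation carries it
to balls about `x₀`. By uniqueness of traces this determines the sphere term of the Weiss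
functional. -/
theorem ApproxSolution.isSphereTrace (S : ApproxSolution s ρ b u₁ G₁ τ₁ v)
    (hs : s ∈ Ioo (0 : ℝ) 1) (hT : IsSliceFamily s v δ T)
    (h : ∀ᵐ y, y ∈ ball (0 : Space d) ρ → u₁ y = u (x₀ + y) ∧ G₁ y = G (x₀ + y))
    (hr : 0 < r) (hrρ : r ≤ ρ) :
    IsSphereTrace u G x₀ r fun x => T r (r⁻¹ • (x - x₀)) := by
  obtain ⟨h1, h2⟩ := S.gaussGreen_ball hs hT hr
  have hc : ∀ θ : Space d, r⁻¹ • (x₀ + r • θ - x₀) = θ := fun θ => by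
    rw [add_sub_cancel_left, smul_smul, inv_mul_cancel₀ hr.ne', one_smul]
  refine ⟨?_, fun φ hφ e => ?_⟩
  · rw [integrable_sphereMeasure_iff x₀ hr]
    simpa only [hc] using h1
  · have hφ' : IsTest univ fun y => φ (x₀ + y) :=
      ⟨hφ.smooth.comp (contDiff_const.add contDiff_id),
        hφ.compact.comp_homeomorph (Homeomorph.addLeft x₀), subset_univ _⟩
    rw [integral_sphereMeasure x₀ hr, setIntegral_ball_eq (ρ := ρ)
      (f₁ := fun y => u₁ y * fderiv ℝ (fun y => φ (x₀ + y)) y e + inner ℝ (G₁ y) e * φ (x₀ + y))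
      (measurePreserving_add_left volume x₀) ?_ hrρ, h2 _ hφ' e]
    · simp only [hc, mul_assoc]
    · filter_upwards [h] with y hy hyρ
      rw [(hy hyρ).1, (hy hyρ).2, fderiv_comp_add_left]

theorem ApproxSolution.integrableOn_weight_mul_norm_sq (S : ApproxSolution s ρ b u₁ G₁ τ₁ v)
    (hx₀ : x₀ (Fin.last d) = 0)
    (h : ∀ᵐ y, y ∈ ball (0 : Space d) ρ → u₁ y = u (x₀ + y) ∧ G₁ y = G (x₀ + y)) (hrρ : r ≤ ρ) :
    IntegrableOn (fun x => weight s x * ‖G x‖ ^ 2) (ball x₀ r) := by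
  rw [← integrableOn_wMeasure_iff s _ _ measurableSet_ball,
    integrableOn_ball_iff (f₁ := fun y => ‖G₁ y‖ ^ 2) (measurePreserving_add_wMeasure s hx₀)
      ((wMeasure_absolutelyContinuous d s).ae_le ?_) hrρ]
  · exact (integrable_norm_sq S.memLp_G).integrableOn
  · filter_upwards [h] with y hy hyρ
    rw [(hy hyρ).2]

theorem ApproxSolution.integrableOn_prim (S : ApproxSolution s ρ b u₁ G₁ τ₁ v)
    (hb : IsReaction b P K) (hx₀ : x₀ (Fin.last d) = 0)
    (h : ∀ᵐ y ∂thinMeasure d, y ∈ ball (0 : Space d) ρ → τ₁ y = τ (x₀ + y)) (hrρ : r ≤ ρ) :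
    IntegrableOn (fun x => 4 * P (τ x)) (ball x₀ r) (thinMeasure d) := by
  rw [integrableOn_ball_iff (f₁ := fun y => 4 * P (τ₁ y)) (measurePreserving_add_thinMeasure hx₀)
      (h.mono fun y hy hyρ => by rw [hy hyρ]) hrρ]
  refine (Integrable.const_mul ?_ 4).integrableOn
  refine ((integrable_norm_sq S.memLp_τ).const_mul K).mono'
    (hb.continuous_prim.measurable.comp S.meas_τ).aestronglyMeasurable (ae_of_all _ fun x => ?_)
  simpa using hb.abs_prim_le (τ₁ x)

theorem weight_mul_trace_sq (hx₀ : x₀ (Fin.last d) = 0) (hr : 0 < r) (θ : Space d) :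
    weight s (x₀ + r • θ) * T r (r⁻¹ • (x₀ + r • θ - x₀)) ^ 2 =
      r ^ (1 - 2 * s) * (weight s θ * T r θ ^ 2) := by
  rw [weight_add_of_last_eq_zero s hx₀, weight_smul s hr.le, add_sub_cancel_left, smul_smul,
    inv_mul_cancel₀ hr.ne', one_smul, mul_assoc]

theorem weight_mul_sphereTrace_sq_ae_eq (hr : 0 < r)
    (h : IsSphereTrace u G x₀ r fun x => T r (r⁻¹ • (x - x₀))) :
    (fun x => weight s x * sphereTrace u G x₀ r x ^ 2) =ᵐ[sphereMeasure x₀ r]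
      fun x => weight s x * T r (r⁻¹ • (x - x₀)) ^ 2 := by
  filter_upwards [sphereTrace_ae_eq hr h] with x hx
  rw [hx]

theorem IsSliceFamily.integrable_weight_mul_sphereTrace_sq (hT : IsSliceFamily s v δ T)
    (hx₀ : x₀ (Fin.last d) = 0) (hr : 0 < r)
    (h : IsSphereTrace u G x₀ r fun x => T r (r⁻¹ • (x - x₀))) :
    Integrable (fun x => weight s x * sphereTrace u G x₀ r x ^ 2) (sphereMeasure x₀ r) := by
  rw [integrable_congr (weight_mul_sphereTrace_sq_ae_eq hr h), integrable_sphereMeasure_iff x₀ hr]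
  simp only [weight_mul_trace_sq hx₀ hr]
  refine Integrable.const_mul ?_ _
  rw [← integrable_wSphereMeasure_iff s fun θ => T r θ ^ 2]
  simpa using integrable_norm_sq (hT.memLp r hr)

theorem integral_weight_mul_sphereTrace_sq (hx₀ : x₀ (Fin.last d) = 0) (hr : 0 < r)
    (h : IsSphereTrace u G x₀ r fun x => T r (r⁻¹ • (x - x₀))) :
    ∫ x, weight s x * sphereTrace u G x₀ r x ^ 2 ∂sphereMeasure x₀ r =
      r ^ d * (r ^ (1 - 2 * s) * ∫ θ, T r θ ^ 2 ∂wSphereMeasure d s) := by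
  rw [integral_congr_ae (weight_mul_sphereTrace_sq_ae_eq hr h), integral_sphereMeasure x₀ hr]
  simp only [weight_mul_trace_sq hx₀ hr]
  rw [integral_const_mul, integral_wSphereMeasure]

/-- The Weiss functional is the energy of the translated and truncated solution. -/
theorem ApproxSolution.weiss_eq (S : ApproxSolution s ρ (betaEps β ε) u₁ G₁ τ₁ v)
    (hs : s ∈ Ioo (0 : ℝ) 1) (hT : IsSliceFamily s v δ T) (hx₀ : x₀ (Fin.last d) = 0)
    (h : ∀ᵐ y, y ∈ ball (0 : Space d) ρ → u₁ y = u (x₀ + y) ∧ G₁ y = G (x₀ + y))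
    (h' : ∀ᵐ y ∂thinMeasure d, y ∈ ball (0 : Space d) ρ → τ₁ y = τ (x₀ + y))
    (hr : 0 < r) (hrρ : r ≤ ρ) :
    weiss s ε β u G τ x₀ r = 1 / r ^ d * (∫ x in ball 0 r, ‖G₁ x‖ ^ 2 ∂wMeasure d s) -
      s * (r ^ (-(2 * s)) * ∫ θ, T r θ ^ 2 ∂wSphereMeasure d s) +
      1 / r ^ d * ∫ x in ball 0 r, 4 * primEps β ε (τ₁ x) ∂thinMeasure d := by
  -- The surface factor `r^d` and the homogeneity `r^(1-2s)` of the weight combine with `r^(-(d+1))`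
  -- to `r^(-2s)`, the power used in the ray computation.
  have e : s / r ^ (d + 1) * (r ^ d * (r ^ (1 - 2 * s) * ∫ θ, T r θ ^ 2 ∂wSphereMeasure d s)) =
      s * (r ^ (-(2 * s)) * ∫ θ, T r θ ^ 2 ∂wSphereMeasure d s) := by
    rw [sub_eq_add_neg, Real.rpow_add hr, Real.rpow_one, pow_succ]
    field_simp
  rw [weiss, integral_weight_mul_sphereTrace_sq hx₀ hr (S.isSphereTrace hs hT h hr hrρ), e,
    ← integral_wMeasure s (fun x => ‖G x‖ ^ 2) _ measurableSet_ball,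
    setIntegral_ball_eq (f₁ := fun y => ‖G₁ y‖ ^ 2) (measurePreserving_add_wMeasure s hx₀)
      ((wMeasure_absolutelyContinuous d s).ae_le
        (h.mono fun y hy hyρ => by rw [(hy hyρ).2])) hrρ,
    setIntegral_ball_eq (f₁ := fun y => 4 * primEps β ε (τ₁ y))
      (measurePreserving_add_thinMeasure hx₀) (h'.mono fun y hy hyρ => by rw [hy hyρ]) hrρ]

end ThinReaction

end

theorem theorem3p3 (d : ℕ) (hd : 1 ≤ d) (s : ℝ) (hs : s ∈ Ioo (0 : ℝ) 1)
    (ε : ℝ) (hε : 0 < ε) (β : ℝ → ℝ) (M : ℝ) (A : ℝ≥0) (hβ : ThinReaction.IsCombustion β M A)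
    (u : ThinReaction.Space d → ℝ) (G : ThinReaction.Space d → ThinReaction.Space d)
    (τ : ThinReaction.Space d → ℝ) (hu : ThinReaction.IsWeakSolution s ε β u G τ)
    (L : ℝ) (hL : ∀ᵐ x : ThinReaction.Space d, x ∈ ball (0 : ThinReaction.Space d) 1 → |u x| ≤ L)
    (x₀ : ThinReaction.Space d) (hx₀ : x₀ ∈ ball (0 : ThinReaction.Space d) 1)
    (hx₀' : x₀ (Fin.last d) = 0) :
    (∀ r ∈ Ioo (0 : ℝ) (1 - ‖x₀‖),
      (∃ T, ThinReaction.IsSphereTrace u G x₀ r T) ∧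
      IntegrableOn (fun x => ThinReaction.weight s x * ‖G x‖ ^ 2) (ball x₀ r) ∧
      Integrable (fun x => ThinReaction.weight s x * ThinReaction.sphereTrace u G x₀ r x ^ 2)
        (ThinReaction.sphereMeasure x₀ r) ∧
      IntegrableOn (fun x => 4 * ThinReaction.primEps β ε (τ x)) (ball x₀ r)
        (ThinReaction.thinMeasure d)) ∧
    MonotoneOn (fun r => ThinReaction.weiss s ε β u G τ x₀ r) (Ioo (0 : ℝ) (1 - ‖x₀‖)) := by
  -- The cutoff needs room between the ball of radius `ρ` and the unit sphere. The claim is proved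
  -- for each such `ρ`, and any radius in the full interval lies below one of them.
  have main : ∀ ρ, 0 < ρ → ρ < 1 - ‖x₀‖ →
      (∀ r ∈ Ioo (0 : ℝ) ρ,
        (∃ T, ThinReaction.IsSphereTrace u G x₀ r T) ∧
        IntegrableOn (fun x => ThinReaction.weight s x * ‖G x‖ ^ 2) (ball x₀ r) ∧
        Integrable (fun x => ThinReaction.weight s x * ThinReaction.sphereTrace u G x₀ r x ^ 2)
          (ThinReaction.sphereMeasure x₀ r) ∧
        IntegrableOn (fun x => 4 * ThinReaction.primEps β ε (τ x)) (ball x₀ r)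
          (ThinReaction.thinMeasure d)) ∧
      MonotoneOn (fun r => ThinReaction.weiss s ε β u G τ x₀ r) (Ioo (0 : ℝ) ρ) := by
    intro ρ hρ0 hρ
    have hb := hβ.isReaction hε
    obtain ⟨u₁, G₁, τ₁, v, S, h, h'⟩ := hu.exists_approxSolution hs hx₀' hρ0 hρ
    obtain ⟨δ, T, hT⟩ := S.exists_isSliceFamily hs hd
    refine ⟨fun r hr => ?_, ?_⟩
    · have ht := S.isSphereTrace hs hT h hr.1 hr.2.le
      exact ⟨⟨_, ht⟩, S.integrableOn_weight_mul_norm_sq hx₀' h hr.2.le,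
        hT.integrable_weight_mul_sphereTrace_sq hx₀' hr.1 ht,
        S.integrableOn_prim hb hx₀' h' hr.2.le⟩
    · refine (S.monotoneOn_energy hs hd hb hT hρ0).congr fun r hr => ?_
      exact (S.weiss_eq hs hT hx₀' h h' hr.1 hr.2.le).symm
  refine ⟨fun r hr => ?_, fun r₁ h₁ r₂ h₂ h₁₂ => ?_⟩
  · obtain ⟨ρ, h1, h2⟩ := exists_between hr.2
    exact (main ρ (hr.1.trans h1) h2).1 r ⟨hr.1, h1⟩
  · obtain ⟨ρ, h1, h2⟩ := exists_between h₂.2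
    exact (main ρ (h₂.1.trans h1) h2).2 ⟨h₁.1, h₁₂.trans_lt h1⟩ ⟨h₂.1, h1⟩ h₁₂
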